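/- Let $n,k\ge 0$ be integers. For $i=0,1$ let $M_i$ be a smooth manifold of dimension $2n+1$ (Hausdorff, second countable, without boundary) with a contact structure $\xi_i=\ker\alpha_i$, where $\alpha_i$ is a contact form on $M_i$, i.e. $\alpha_i\wedge(d\alpha_i)^n$ vanishes nowhere. Let $L_i\subset M_i$ be a closed (compact, without boundary, not necessarily connected) embedded isotropic submanifold of dimension $k$, i.e. $T_xL_i\subset\xi_i$ for all $x\in L_i$. Let $(TL_i)^{\perp}\subset\xi_i|_{L_i}$ be the orthogonal complement of $TL_i$ with respect to $d\alpha_i|_{\xi_i}$, and let $$\mathrm{CSN}(M_i,L_i)=(TL_i)^{\perp}/TL_i$$ be the conformal symplectic normal bundle, with the symplectic bundle structure $\omega_i$ induced by $d\alpha_i$ (its conformal class depends only on $\xi_i$). Let $\phi\colon L_0\to L_1$ be a diffeomorphism. (a) Let $\Phi\colon \mathrm{CSN}(M_0,L_0)\to\mathrm{CSN}(M_1,L_1)$ be an isomorphism of conformal symplectic vector bundles covering $\phi$, i.e. a smooth vector bundle isomorphism covering $\phi$ with $\Phi^*\omega_1=c\,\omega_0$ for a smooth nowhere vanishing function $c\colon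 L_0\to\mathbb{R}$. Then there are open neighbourhoods $\mathcal N(L_i)$ of $L_i$ in $M_i$ and a contactomorphism $\psi\colon\mathcal N(L_0)\to\mathcal N(L_1)$, i.e. a diffeomorphism with $T\psi(\xi_0)=\xi_1$, such that $\psi|_{L_0}=\phi$ and such that the map $\mathrm{CSN}(M_0,L_0)\to\mathrm{CSN}(M_1,L_1)$ induced by $T\psi$ is homotopic to $\Phi$ as a symplectic bundle isomorphism: there is a smooth homotopy $\Theta_t$, $t\in[0,1]$, of vector bundle isomorphisms covering $\phi$, with $\Theta_0=\Phi$, with $\Theta_1$ induced by $T\psi$, and with $\Theta_t^*\omega_1=c\,\omega_0$ for all $t\in[0,1]$. If $c>0$, then $\psi$ can moreover be chosen to preserve the coorientations given by $\alpha_0$ and $\alpha_1$. (b) In particular, if $L_0$ and $L_1$ are Legendrian, i.e. $k=n$, then every diffeomorphism $\phi\colon L_0\to L_1$ extends to a contactomorphism between suitable open neighbourhoods of $L_0$ and $L_1$; thus diffeomorphic closed Legendrian submanifolds have contactomorphic neighbourhoods. -/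

import Mathlib

open Set Topology Manifold
open scoped ContDiff

noncomputable section

namespace ContactGeometry

section OneForms

variable {m : ℕ} {M : Type*} [TopologicalSpace M] [ChartedSpace (EuclideanSpace ℝ (Fin m)) M]

/-- A (not necessarily smooth) differential `1`-form on the manifold `M`. -/
abbrev OneForm (m : ℕ) (M : Type*) [TopologicalSpace M]
    [ChartedSpace (EuclideanSpace ℝ (Fin m)) M] : Type _ :=
  ∀ p : M, TangentSpace (𝓡 m) p →L[ℝ] ℝ

/-- Smoothness of a `1`-form, as a section of the cotangent bundle. -/
def IsSmoothOneForm [IsManifold (𝓡 m) ∞ M] (α : OneForm m M) : Prop :=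
  ContMDiff (𝓡 m) ((𝓡 m).prod 𝓘(ℝ, EuclideanSpace ℝ (Fin m) →L[ℝ] ℝ)) ∞
    (fun p : M => Bundle.TotalSpace.mk' (EuclideanSpace ℝ (Fin m) →L[ℝ] ℝ)
      (E := fun q : M => TangentSpace (𝓡 m) q →L[ℝ] Bundle.Trivial M ℝ q) p (α p))

/-- The local representative of a `1`-form in the preferred chart around `p`, that is, its
pullback under the inverse of that chart. -/
def chartForm (α : OneForm m M) (p : M) (y : EuclideanSpace ℝ (Fin m)) :
    EuclideanSpace ℝ (Fin m) →L[ℝ] ℝ :=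
  (α ((extChartAt (𝓡 m) p).symm y)).comp
    (mfderiv 𝓘(ℝ, EuclideanSpace ℝ (Fin m)) (𝓡 m) (extChartAt (𝓡 m) p).symm y)

/-- The exterior derivative of a `1`-form at `p`, as a bilinear form on `T_p M`. In a chart, with
local representative `a`, it is `da (u, v) = D_u a (v) - D_v a (u)`. -/
def extD (α : OneForm m M) (p : M) :
    TangentSpace (𝓡 m) p →ₗ[ℝ] TangentSpace (𝓡 m) p →ₗ[ℝ] ℝ :=
  let T : TangentSpace (𝓡 m) p →L[ℝ] EuclideanSpace ℝ (Fin m) :=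
    mfderiv (𝓡 m) 𝓘(ℝ, EuclideanSpace ℝ (Fin m)) (extChartAt (𝓡 m) p) p
  let D : EuclideanSpace ℝ (Fin m) →L[ℝ] EuclideanSpace ℝ (Fin m) →L[ℝ] ℝ :=
    fderiv ℝ (chartForm α p) (extChartAt (𝓡 m) p p)
  LinearMap.mk₂ ℝ (fun u v => D (T u) (T v) - D (T v) (T u))
    (by intros; simp; ring) (by intros; simp; ring) (by intros; simp; ring) (by intros; simp; ring)

theorem extD_swap (α : OneForm m M) (p : M) (u v : TangentSpace (𝓡 m) p) :
    extD α p u v = -extD α p v u := by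
  simp [extD]

/-- The field of subspaces `ξ = ker α`. -/
def xi (α : OneForm m M) (p : M) : Submodule ℝ (TangentSpace (𝓡 m) p) :=
  LinearMap.ker (α p).toLinearMap

/-- A contact form: a smooth nowhere vanishing `1`-form whose exterior derivative is nondegenerate
on the hyperplane `ker α` at each point. In dimension `2 * n + 1` this says that
`α ∧ (dα) ^ n` vanishes nowhere. The cooriented contact structure it defines is `ker α`. -/
structure IsContactForm [IsManifold (𝓡 m) ∞ M] (α : OneForm m M) : Prop where
  smooth : IsSmoothOneForm α
  ne_zero : ∀ p, α p ≠ 0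
  nondegenerate : ∀ p, ∀ u ∈ xi α p, (∀ v ∈ xi α p, extD α p u v = 0) → u = 0

end OneForms

section Isotropic

variable {m k : ℕ} {M : Type*} [TopologicalSpace M] [ChartedSpace (EuclideanSpace ℝ (Fin m)) M]
  {L : Type*} [TopologicalSpace L] [ChartedSpace (EuclideanSpace ℝ (Fin k)) L]

/-- The tangent space `T_x L`, as a subspace of `T_{ι x} M`, of a submanifold `ι : L → M`. -/
def tangentImage (m k : ℕ) {M : Type*} [TopologicalSpace M]
    [ChartedSpace (EuclideanSpace ℝ (Fin m)) M] {L : Type*} [TopologicalSpace L]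
    [ChartedSpace (EuclideanSpace ℝ (Fin k)) L] (ι : L → M) (x : L) :
    Submodule ℝ (TangentSpace (𝓡 m) (ι x)) :=
  LinearMap.range (mfderiv (𝓡 k) (𝓡 m) ι x).toLinearMap

/-- `ι : L → M` is an embedded isotropic submanifold of `(M, ker α)`: it is a smooth embedding
and its tangent spaces are contained in `ker α`. -/
structure IsIsotropicEmbedding (k : ℕ) {L : Type*} [TopologicalSpace L]
    [ChartedSpace (EuclideanSpace ℝ (Fin k)) L] (α : OneForm m M) (ι : L → M) : Prop where
  embedding : Manifold.IsSmoothEmbedding (𝓡 k) (𝓡 m) ∞ ι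
  isotropic : ∀ x, tangentImage m k ι x ≤ xi α (ι x)

/-- The symplectic orthogonal complement `(T_x L)^⊥` of `T_x L` in `(ker α, dα)`. -/
def symplOrth (k : ℕ) {L : Type*} [TopologicalSpace L]
    [ChartedSpace (EuclideanSpace ℝ (Fin k)) L] (α : OneForm m M) (ι : L → M) (x : L) :
    Submodule ℝ (TangentSpace (𝓡 m) (ι x)) where
  carrier := {v | v ∈ xi α (ι x) ∧ ∀ w ∈ tangentImage m k ι x, extD α (ι x) v w = 0}
  add_mem' := by
    rintro a b ⟨ha, ha'⟩ ⟨hb, hb'⟩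
    refine ⟨Submodule.add_mem _ ha hb, fun w hw => ?_⟩
    rw [map_add, LinearMap.add_apply, ha' w hw, hb' w hw, add_zero]
  zero_mem' := by
    refine ⟨Submodule.zero_mem _, fun w _ => ?_⟩
    rw [map_zero, LinearMap.zero_apply]
  smul_mem' := by
    rintro c a ⟨ha, ha'⟩
    refine ⟨Submodule.smul_mem _ c ha, fun w hw => ?_⟩
    rw [map_smul, LinearMap.smul_apply, ha' w hw, smul_zero]

/-- The fibre `(T_x L)^⊥ / T_x L` of the conformal symplectic normal bundle at `x`. (If `L` is
isotropic, then `T_x L` is contained in `(T_x L)^⊥`.) -/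
abbrev CSN (k : ℕ) {L : Type*} [TopologicalSpace L]
    [ChartedSpace (EuclideanSpace ℝ (Fin k)) L] (α : OneForm m M) (ι : L → M) (x : L) : Type :=
  ↥(symplOrth k α ι x) ⧸ (tangentImage m k ι x).submoduleOf (symplOrth k α ι x)

/-- The class in the conformal symplectic normal bundle of a vector of `(T_x L)^⊥`. -/
def CSN.mk {α : OneForm m M} {ι : L → M} {x : L} (v : ↥(symplOrth k α ι x)) : CSN k α ι x :=
  Submodule.Quotient.mk v

/-- The restriction of `dα` to `(T_x L)^⊥`. -/
def orthForm (k : ℕ) {L : Type*} [TopologicalSpace L]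
    [ChartedSpace (EuclideanSpace ℝ (Fin k)) L] (α : OneForm m M) (ι : L → M) (x : L) :
    ↥(symplOrth k α ι x) →ₗ[ℝ] ↥(symplOrth k α ι x) →ₗ[ℝ] ℝ :=
  LinearMap.mk₂ ℝ (fun u v => extD α (ι x) u.1 v.1)
    (by intros; simp) (by intros; simp) (by intros; simp) (by intros; simp)

/-- The symplectic form which `dα` induces on the fibre of the conformal symplectic normal
bundle: `csnForm [u] [v] = dα (u, v)`. -/
def csnForm (k : ℕ) {L : Type*} [TopologicalSpace L]
    [ChartedSpace (EuclideanSpace ℝ (Fin k)) L] (α : OneForm m M) (ι : L → M) (x : L) :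
    CSN k α ι x →ₗ[ℝ] CSN k α ι x →ₗ[ℝ] ℝ :=
  Submodule.liftQ _
    (LinearMap.flip (Submodule.liftQ _ (LinearMap.flip (orthForm k α ι x)) (by
      intro w hw
      ext u
      exact u.2.2 w.1 hw)))
    (by
      intro w hw
      ext v
      change extD α (ι x) w.1 v.1 = 0
      rw [extD_swap, v.2.2 w.1 hw, neg_zero])

theorem csnForm_mk {α : OneForm m M} {ι : L → M} {x : L} (u v : ↥(symplOrth k α ι x)) :
    csnForm k α ι x (CSN.mk u) (CSN.mk v) = extD α (ι x) u.1 v.1 := rfl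

end Isotropic

section Maps

variable {m k : ℕ}
  {M₀ : Type*} [TopologicalSpace M₀] [ChartedSpace (EuclideanSpace ℝ (Fin m)) M₀]
  {M₁ : Type*} [TopologicalSpace M₁] [ChartedSpace (EuclideanSpace ℝ (Fin m)) M₁]
  {L₀ : Type*} [TopologicalSpace L₀] [ChartedSpace (EuclideanSpace ℝ (Fin k)) L₀]
  {L₁ : Type*} [TopologicalSpace L₁] [ChartedSpace (EuclideanSpace ℝ (Fin k)) L₁]

/-- The linear map `A : T_{ι₀ x} M₀ → T_{ι₁ y} M₁` maps `(T_x L₀)^⊥` to `(T_y L₁)^⊥` and induces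
the linear map `F` on the quotients `CSN`. -/
def InducesOnCSN (α₀ : OneForm m M₀) (α₁ : OneForm m M₁) (ι₀ : L₀ → M₀) (ι₁ : L₁ → M₁)
    (x : L₀) (y : L₁)
    (A : TangentSpace (𝓡 m) (ι₀ x) →L[ℝ] TangentSpace (𝓡 m) (ι₁ y))
    (F : CSN k α₀ ι₀ x →ₗ[ℝ] CSN k α₁ ι₁ y) : Prop :=
  ∀ v : ↥(symplOrth k α₀ ι₀ x), ∃ h : A v.1 ∈ symplOrth k α₁ ι₁ y, F (CSN.mk v) = CSN.mk ⟨A v.1, h⟩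

/-- Let `N` be a manifold with maps `a : N → L₀` and `b : N → L₁`. A family of linear maps
`F z : CSN (M₀, L₀)_{a z} → CSN (M₁, L₁)_{b z}` is smooth on `s ⊆ N`, with respect to the quotient
bundle structures, if locally it is induced by a smooth family of linear maps
`A z : T_{ι₀ (a z)} M₀ → T_{ι₁ (b z)} M₁`; smoothness of the latter is smoothness in the local
trivialisations of the tangent bundles. -/
def IsSmoothCSNFamily {E : Type*} [NormedAddCommGroup E] [NormedSpace ℝ E]
    {H : Type*} [TopologicalSpace H] (J : ModelWithCorners ℝ E H)
    {N : Type*} [TopologicalSpace N] [ChartedSpace H N]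
    [IsManifold (𝓡 m) ∞ M₀] [IsManifold (𝓡 m) ∞ M₁]
    (α₀ : OneForm m M₀) (α₁ : OneForm m M₁) (ι₀ : L₀ → M₀) (ι₁ : L₁ → M₁)
    (a : N → L₀) (b : N → L₁) (s : Set N)
    (F : ∀ z, CSN k α₀ ι₀ (a z) →ₗ[ℝ] CSN k α₁ ι₁ (b z)) : Prop :=
  ∀ z₀ ∈ s, ∃ U ∈ 𝓝 z₀,
    ∃ A : ∀ z, TangentSpace (𝓡 m) (ι₀ (a z)) →L[ℝ] TangentSpace (𝓡 m) (ι₁ (b z)),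
      (∀ z ∈ s ∩ U,
        ContMDiffWithinAt J 𝓘(ℝ, EuclideanSpace ℝ (Fin m) →L[ℝ] EuclideanSpace ℝ (Fin m)) ∞
          (inTangentCoordinates (𝓡 m) (𝓡 m) (ι₀ ∘ a) (ι₁ ∘ b) A z) (s ∩ U) z) ∧
      ∀ z ∈ s ∩ U, InducesOnCSN α₀ α₁ ι₀ ι₁ (a z) (b z) (A z) (F z)

/-- `Φ`, a family of linear isomorphisms `CSN (M₀, L₀)_x → CSN (M₁, L₁)_{φ x}`, is an isomorphism
of conformal symplectic vector bundles over `φ`: it is smooth, and it pulls the symplectic bundle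
structure given by `dα₁` back to `c` times the one given by `dα₀`, where `c` is a smooth nowhere
vanishing function on `L₀`. -/
structure IsConformalCSNIso [IsManifold (𝓡 m) ∞ M₀] [IsManifold (𝓡 m) ∞ M₁]
    (α₀ : OneForm m M₀) (α₁ : OneForm m M₁) (ι₀ : L₀ → M₀) (ι₁ : L₁ → M₁) (φ : L₀ → L₁)
    (c : L₀ → ℝ) (Φ : ∀ x, CSN k α₀ ι₀ x ≃ₗ[ℝ] CSN k α₁ ι₁ (φ x)) : Prop where
  smooth : IsSmoothCSNFamily (𝓡 k) α₀ α₁ ι₀ ι₁ id φ univ (fun x => (Φ x).toLinearMap)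
  factor_smooth : ContMDiff (𝓡 k) 𝓘(ℝ, ℝ) ∞ c
  factor_ne_zero : ∀ x, c x ≠ 0
  conformal : ∀ x u v, csnForm k α₁ ι₁ (φ x) (Φ x u) (Φ x v) = c x * csnForm k α₀ ι₀ x u v

/-- `Θ t`, `0 ≤ t ≤ 1`, is a smooth homotopy, over the fixed map `φ`, of bundle isomorphisms
`CSN (M₀, L₀) → CSN (M₁, L₁)`, all of which are symplectic with respect to the symplectic bundle
structures given by `c • dα₀` and `dα₁`. -/
structure IsSymplecticCSNHomotopy [IsManifold (𝓡 m) ∞ M₀] [IsManifold (𝓡 m) ∞ M₁]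
    (α₀ : OneForm m M₀) (α₁ : OneForm m M₁) (ι₀ : L₀ → M₀) (ι₁ : L₁ → M₁) (φ : L₀ → L₁)
    (c : L₀ → ℝ) (Θ : ℝ → ∀ x, CSN k α₀ ι₀ x ≃ₗ[ℝ] CSN k α₁ ι₁ (φ x)) : Prop where
  smooth : IsSmoothCSNFamily (𝓘(ℝ, ℝ).prod (𝓡 k)) α₀ α₁ ι₀ ι₁
    (fun z : ℝ × L₀ => z.2) (fun z => φ z.2) (Icc 0 1 ×ˢ univ)
    (fun z => (Θ z.1 z.2).toLinearMap)
  symplectic : ∀ t ∈ Icc (0 : ℝ) 1, ∀ x u v,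
    csnForm k α₁ ι₁ (φ x) (Θ t x u) (Θ t x v) = c x * csnForm k α₀ ι₀ x u v

/-- The diffeomorphism `ψ` from an open subset `ψ.source` of `M₀` onto an open subset `ψ.target`
of `M₁` is a contactomorphism for `ξ₀ = ker α₀` and `ξ₁ = ker α₁`, i.e. `Tψ (ξ₀) = ξ₁`. -/
def IsContactomorphism (α₀ : OneForm m M₀) (α₁ : OneForm m M₁)
    (ψ : PartialDiffeomorph (𝓡 m) (𝓡 m) M₀ M₁ ∞) : Prop :=
  ∀ p ∈ ψ.source, (xi α₀ p).map (mfderiv (𝓡 m) (𝓡 m) ψ p).toLinearMap = xi α₁ (ψ p)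

/-- `ψ` respects the coorientations of `ker α₀` and `ker α₁` given by `α₀` and `α₁`. -/
def PreservesCoorientation (α₀ : OneForm m M₀) (α₁ : OneForm m M₁)
    (ψ : PartialDiffeomorph (𝓡 m) (𝓡 m) M₀ M₁ ∞) : Prop :=
  ∀ p ∈ ψ.source, ∀ v : TangentSpace (𝓡 m) p,
    0 < α₀ p v → 0 < α₁ (ψ p) (mfderiv (𝓡 m) (𝓡 m) ψ p v)

/-- `ψ` is a diffeomorphism between open neighbourhoods of the submanifolds `ι₀ : L₀ → M₀` and
`ι₁ : L₁ → M₁`, and it extends `φ : L₀ → L₁`. -/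
structure IsNbhdExtension (ι₀ : L₀ → M₀) (ι₁ : L₁ → M₁) (φ : L₀ → L₁)
    (ψ : PartialDiffeomorph (𝓡 m) (𝓡 m) M₀ M₁ ∞) : Prop where
  range_subset_source : range ι₀ ⊆ ψ.source
  range_subset_target : range ι₁ ⊆ ψ.target
  apply_eq : ∀ x, ψ (ι₀ x) = ι₁ (φ x)

end Maps

end ContactGeometry

end

/-! The proof is Moser's method, arranged so that the contactomorphism induces `Φ` on the normal
bundle exactly; the homotopy can then be constant. Write T for the tangent space of L₀, ξ₀ for ker
α₀, and V = T^⊥ ⊆ ξ₀, so that the fibre of the normal bundle is V / T.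

First-order model. One needs a smooth map ψ near L₀ which extends φ and whose derivative A along L₀
satisfies α₁ ∘ A = c α₀ and dα₁(A u, A v) = c dα₀(u, v) for u in T, and induces `Φ` on V / T
(`IsAdmissible`). Being conformally symplectic on all of ξ₀ is not demanded: that condition is
quadratic in A, whereas those above are affine (`convex_isAdmissible`). Hence such maps can be built
in charts by correcting an arbitrary lift of `Φ` (`adjust`, `exists_local_admissible`) and averaged
by cut-off functions (`exists_admissible_map`); no global complements are chosen. Let f extend c and
put β = ψ*α₁ - f α₀. At points of L₀ the form β vanishes, and dβ vanishes on T × ξ₀ and on V × V.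
This already makes f α₀ + t β a contact form along L₀ for every t: a vector of ξ₀ orthogonal to ξ₀
for the 2-form on the path lies in V, hence in V^⊥ = T, hence is zero (`eq_zero_of_orthogonal`).

Moser field. Put a_t = f α₀ + t β. For a function h, let X_t solve a_t(X_t) = h and da_t(X_t, ·) + β
+ dh = μ_t a_t. By Cartan's formula the Lie derivative of a_t along X_t plus β is μ_t a_t, so the
time-one map G pulls ψ*α₁ back to a positive multiple of f α₀, and ψ ∘ G is a contact map. If h
vanishes to first order along L₀, then X_t vanishes there, so its flow exists up to time one near L₀
and fixes L₀.

The choice of h. With h = 0 the derivative of G could change the induced map on V / T. The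
linearisation of X_t along L₀ is governed by the derivative of β + dh, so h is chosen with Hessian
-Dβ on V × V (`IsCorrection`). This is consistent because dβ = 0 on V × V makes Dβ symmetric there;
locally h(y) = -β_y(y - r(y)) / 2 for a retraction r onto L₀. The linearised field then kills T and
maps V into T, so DG - id maps V into T (`IsMoserMapAt.shear`, `exists_mfd_eq_add`), and ψ ∘ G still
induces `Φ`.

Conclusion. ψ ∘ G is injective on the compact set L₀ and has invertible derivatives there, hence is
a diffeomorphism between neighbourhoods (`exists_partialDiffeomorph`). If c > 0 the conformal factor
of the contact forms is positive. For Legendrians V = T, so the normal bundle is zero and its only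
map is conformal with c = 1.

The flow comes from the inverse function theorem on a Banach space of paths
(`exists_flow_near_zero`), one chart at a time; the flows in different charts agree by uniqueness of
integral curves (`exists_moser_map`). -/

open Filter

noncomputable section

namespace ContactGeometry

set_option linter.unusedSectionVars false

/-! ### Smooth dependence of flows on the initial point, via the Banach space of paths -/

section ODE

variable {E F : Type} [NormedAddCommGroup E] [NormedSpace ℝ E]
  [NormedAddCommGroup F] [NormedSpace ℝ F]

/-- The superposition operator `γ ↦ (t ↦ f (t, γ t))` on continuous paths. -/
def superposition (f : ℝ × E → F) (hf : Continuous f) (γ : C(Icc (0 : ℝ) 1, E)) :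
    C(Icc (0 : ℝ) 1, F) :=
  ⟨fun t => f (t, γ t), by fun_prop⟩

theorem continuous_superposition (f : ℝ × E → F) (hf : Continuous f) :
    Continuous (superposition f hf) := by
  refine ContinuousMap.continuous_of_continuous_uncurry _ ?_
  change Continuous fun p : C(Icc (0 : ℝ) 1, E) × Icc (0 : ℝ) 1 => f (p.2, p.1 p.2)
  fun_prop

/-- Pointwise application of a path of operators to a path of vectors. -/
def applyPath : C(Icc (0 : ℝ) 1, E →L[ℝ] F) →L[ℝ] C(Icc (0 : ℝ) 1, E) →L[ℝ]
    C(Icc (0 : ℝ) 1, F) :=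
  LinearMap.mkContinuous₂
    (LinearMap.mk₂ ℝ (fun (A : C(Icc (0 : ℝ) 1, E →L[ℝ] F)) (η : C(Icc (0 : ℝ) 1, E)) =>
        (⟨fun t => A t (η t), by fun_prop⟩ : C(Icc (0 : ℝ) 1, F)))
      (by intros; ext; simp) (by intros; ext; simp) (by intros; ext; simp) (by intros; ext; simp))
    1 (by
      intro A η
      rw [ContinuousMap.norm_le _ (by positivity)]
      intro t
      rw [one_mul]
      exact (A t).le_of_opNorm_le_of_le (A.norm_coe_le_norm t) (η.norm_coe_le_norm t))

@[simp] theorem applyPath_apply (A : C(Icc (0 : ℝ) 1, E →L[ℝ] F)) (η : C(Icc (0 : ℝ) 1, E))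
    (t : Icc (0 : ℝ) 1) : applyPath A η t = A t (η t) := rfl

theorem contDiff_applyPath {n : ℕ∞ω} : ContDiff ℝ n (applyPath (E := E) (F := F)) := by
  apply ContinuousLinearMap.contDiff

/-- The partial derivative in the space variable. -/
def spaceDeriv (f : ℝ × E → F) (p : ℝ × E) : E →L[ℝ] F :=
  (fderiv ℝ f p).comp (ContinuousLinearMap.inr ℝ ℝ E)

theorem contDiff_spaceDeriv {f : ℝ × E → F} (hf : ContDiff ℝ ∞ f) :
    ContDiff ℝ ∞ (spaceDeriv f) :=
  (hf.fderiv_right (m := ∞) (by simp)).clm_comp contDiff_const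

theorem hasFDerivAt_slice {f : ℝ × E → F} {t : ℝ} {y : E} (hf : DifferentiableAt ℝ f (t, y)) :
    HasFDerivAt (fun z => f (t, z)) (spaceDeriv f (t, y)) y :=
  hf.hasFDerivAt.comp y (hasFDerivAt_prodMk_right t y)

/-- The mean value inequality on the segment from `γ t` to `γ t + η t`. The estimate is uniform in
`t` because superposition by the space derivative is continuous for the sup norm, so one `δ` serves
all times. -/
theorem hasFDerivAt_superposition {f : ℝ × E → F} (hf : ContDiff ℝ ∞ f)
    (γ : C(Icc (0 : ℝ) 1, E)) :
    HasFDerivAt (superposition f hf.continuous)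
      (applyPath (superposition (spaceDeriv f) (contDiff_spaceDeriv hf).continuous γ)) γ := by
  rw [hasFDerivAt_iff_isLittleO_nhds_zero, Asymptotics.isLittleO_iff]
  intro ε hε
  have hc := (continuous_superposition (spaceDeriv f) (contDiff_spaceDeriv hf).continuous).tendsto γ
  rw [Metric.tendsto_nhds_nhds] at hc
  obtain ⟨δ, hδ, hd⟩ := hc ε hε
  filter_upwards [Metric.ball_mem_nhds (0 : C(Icc (0 : ℝ) 1, E)) hδ] with η hη
  rw [ContinuousMap.norm_le _ (by positivity)]
  intro t
  have hη' : ‖η‖ < δ := by simpa using hη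
  have key := Convex.norm_image_sub_le_of_norm_hasFDerivWithin_le (𝕜 := ℝ)
    (f := fun z => f (t, z) - spaceDeriv f (t, γ t) z)
    (f' := fun z => spaceDeriv f (t, z) - spaceDeriv f (t, γ t))
    (C := ε) (s := segment ℝ (γ t) (γ t + η t)) (x := γ t) (y := γ t + η t) ?_ ?_
    (convex_segment _ _) (left_mem_segment _ _ _) (right_mem_segment _ _ _)
  · have h2 : ‖(γ t + η t) - γ t‖ ≤ ‖η‖ := by simpa using η.norm_coe_le_norm t
    refine le_trans (le_of_eq ?_) (key.trans (mul_le_mul_of_nonneg_left h2 hε.le))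
    congr 1
    simp [superposition]
    abel
  · intro z _
    exact ((hasFDerivAt_slice (hf.differentiable (by simp) _)).sub
      (spaceDeriv f (t, γ t)).hasFDerivAt).hasFDerivWithinAt
  · intro z hz
    rw [segment_eq_image'] at hz
    obtain ⟨s, hs, rfl⟩ := hz
    have h3 : dist (γ + s • η) γ < δ := by
      rw [dist_eq_norm]
      simp only [add_sub_cancel_left, norm_smul, Real.norm_eq_abs, abs_of_nonneg hs.1]
      nlinarith [norm_nonneg η, hs.2, hs.1]
    have h4 := (ContinuousMap.dist_apply_le_dist (f := superposition (spaceDeriv f)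
      (contDiff_spaceDeriv hf).continuous (γ + s • η)) (g := superposition (spaceDeriv f)
      (contDiff_spaceDeriv hf).continuous γ) t).trans (hd h3).le
    simpa [dist_eq_norm, superposition] using h4

/-- The derivative of a superposition operator is again one, followed by the bounded bilinear
`applyPath`. The target space is quantified inside the induction because the space derivative takes
values in operators. -/
theorem contDiff_superposition_nat (n : ℕ) : ∀ {F : Type} [NormedAddCommGroup F] [NormedSpace ℝ F]
    {f : ℝ × E → F} (hf : ContDiff ℝ ∞ f), ContDiff ℝ n (superposition f hf.continuous) := by
  induction n with
  | zero => exact fun hf => contDiff_zero.2 (continuous_superposition _ _)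
  | succ n ih =>
    intro F _ _ f hf
    push_cast
    rw [contDiff_succ_iff_hasFDerivAt]
    exact ⟨fun γ => applyPath (superposition (spaceDeriv f) (contDiff_spaceDeriv hf).continuous γ),
      contDiff_applyPath.comp (ih (contDiff_spaceDeriv hf)), hasFDerivAt_superposition hf⟩

theorem contDiff_superposition {f : ℝ × E → F} (hf : ContDiff ℝ ∞ f) :
    ContDiff ℝ ∞ (superposition f hf.continuous) :=
  contDiff_infty.2 fun n => contDiff_superposition_nat n hf

/-- The extension of a path parametrised by the unit interval to the real line. -/
def extendPath (γ : C(Icc (0 : ℝ) 1, E)) : ℝ → E := IccExtend zero_le_one γ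

theorem continuous_extendPath (γ : C(Icc (0 : ℝ) 1, E)) : Continuous (extendPath γ) :=
  γ.continuous.Icc_extend'

theorem extendPath_of_mem (γ : C(Icc (0 : ℝ) 1, E)) {t : ℝ} (ht : t ∈ Icc (0 : ℝ) 1) :
    extendPath γ t = γ ⟨t, ht⟩ := IccExtend_of_mem _ _ ht

theorem norm_extendPath_le (γ : C(Icc (0 : ℝ) 1, E)) (t : ℝ) : ‖extendPath γ t‖ ≤ ‖γ‖ :=
  γ.norm_coe_le_norm _

/-- Integration of paths from `0`. -/
def integratePath : C(Icc (0 : ℝ) 1, E) →L[ℝ] C(Icc (0 : ℝ) 1, E) :=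
  LinearMap.mkContinuous
    { toFun := fun γ => ⟨fun t => ∫ s in (0 : ℝ)..t, extendPath γ s,
        (intervalIntegral.continuous_primitive
          (fun a b => (continuous_extendPath γ).intervalIntegrable a b) 0).comp
          continuous_subtype_val⟩
      map_add' := by
        intro γ η
        ext t
        exact intervalIntegral.integral_add ((continuous_extendPath γ).intervalIntegrable _ _)
          ((continuous_extendPath η).intervalIntegrable _ _)
      map_smul' := by
        intro c γ
        ext t
        exact intervalIntegral.integral_smul c _ }
    1 (by
      intro γ
      rw [ContinuousMap.norm_le _ (by positivity)]
      intro t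
      have h := intervalIntegral.norm_integral_le_of_norm_le_const (a := 0) (b := (t : ℝ))
        (f := extendPath γ) (C := ‖γ‖) (fun s _ => norm_extendPath_le γ s)
      refine h.trans ?_
      rw [sub_zero, abs_of_nonneg t.2.1, mul_comm]
      exact mul_le_mul_of_nonneg_right t.2.2 (norm_nonneg _))

theorem integratePath_apply (γ : C(Icc (0 : ℝ) 1, E)) (t : Icc (0 : ℝ) 1) :
    integratePath γ t = ∫ s in (0 : ℝ)..t, extendPath γ s := rfl

/-- The Volterra operator of a path of operators. -/
def volterra (A : C(Icc (0 : ℝ) 1, E →L[ℝ] E)) : C(Icc (0 : ℝ) 1, E) →L[ℝ] C(Icc (0 : ℝ) 1, E) :=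
  integratePath.comp (applyPath A)

/-- Iterated integration produces the factor tⁿ / n!, so high powers of a Volterra operator are
contractions however large `A` is. -/
theorem norm_volterra_pow_apply_le (A : C(Icc (0 : ℝ) 1, E →L[ℝ] E)) (n : ℕ)
    (γ : C(Icc (0 : ℝ) 1, E)) (t : Icc (0 : ℝ) 1) :
    ‖(volterra A ^ n) γ t‖ ≤ ‖A‖ ^ n * ‖γ‖ / n.factorial * (t : ℝ) ^ n := by
  induction n generalizing t with
  | zero => simpa using γ.norm_coe_le_norm t
  | succ n ih =>
    rw [pow_succ', mul_apply_eq_comp, volterra, ContinuousLinearMap.comp_apply,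
      integratePath_apply]
    have h1 := intervalIntegral.norm_integral_le_of_norm_le (a := 0) (b := (t : ℝ))
      (f := extendPath (applyPath A ((volterra A ^ n) γ)))
      (g := fun s => ‖A‖ ^ (n + 1) * ‖γ‖ / n.factorial * s ^ n) (μ := MeasureTheory.volume) t.2.1
      (Eventually.of_forall fun s hs => by
        have hs' : s ∈ Icc (0 : ℝ) 1 := ⟨hs.1.le, hs.2.trans t.2.2⟩
        rw [extendPath_of_mem _ hs', applyPath_apply]
        refine ((A _).le_of_opNorm_le_of_le (A.norm_coe_le_norm _) (ih _)).trans (le_of_eq ?_)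
        ring)
      (Continuous.intervalIntegrable (by fun_prop) _ _)
    refine h1.trans (le_of_eq ?_)
    rw [intervalIntegral.integral_const_mul, integral_pow, Nat.factorial_succ]
    push_cast
    have h2 : (n.factorial : ℝ) ≠ 0 := by exact_mod_cast n.factorial_ne_zero
    have h3 : (n : ℝ) + 1 ≠ 0 := by positivity
    field_simp
    simp

/-- Some power V^n has norm less than one, so 1 - V^n is a unit; it is the product of 1 - V and a
geometric sum which commutes with it. Invertibility without any smallness is what gives the flow up
to time one in a single step. -/
theorem isUnit_one_sub_volterra [CompleteSpace E] (A : C(Icc (0 : ℝ) 1, E →L[ℝ] E)) :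
    IsUnit (1 - volterra A) := by
  have hlim := FloorSemiring.tendsto_pow_div_factorial_atTop (‖A‖)
  obtain ⟨n, hn⟩ := (hlim.eventually (gt_mem_nhds one_pos)).exists
  have hnorm : ‖volterra A ^ n‖ < 1 := by
    refine lt_of_le_of_lt (ContinuousLinearMap.opNorm_le_bound _ (by positivity) fun γ => ?_) hn
    rw [ContinuousMap.norm_le _ (by positivity)]
    intro t
    refine (norm_volterra_pow_apply_le A n γ t).trans ?_
    have h1 : (t : ℝ) ^ n ≤ 1 := pow_le_one₀ t.2.1 t.2.2
    calc _ ≤ ‖A‖ ^ n * ‖γ‖ / n.factorial * 1 := by gcongr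
      _ = _ := by ring
  have hu := isUnit_one_sub_of_norm_lt_one
    (R := C(Icc (0 : ℝ) 1, E) →L[ℝ] C(Icc (0 : ℝ) 1, E)) hnorm
  rw [← mul_neg_geom_sum] at hu
  refine ((Commute.isUnit_mul_iff ?_).1 hu).1
  exact ((Commute.one_left _).sub_left (Commute.sum_right _ _ _ fun i _ =>
    Commute.pow_right rfl i))

/-- Constant paths. -/
def constPath : E →L[ℝ] C(Icc (0 : ℝ) 1, E) :=
  LinearMap.mkContinuous
    { toFun := fun y => ContinuousMap.const _ y
      map_add' := by intros; rfl
      map_smul' := by intros; rfl }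
    1 (by
      intro y
      rw [ContinuousMap.norm_le _ (by positivity)]
      intro t
      rw [one_mul]
      exact le_rfl)

@[simp] theorem constPath_apply (y : E) (t : Icc (0 : ℝ) 1) : constPath y t = y := rfl

theorem extendPath_constPath_add_integratePath (y : E) (δ : C(Icc (0 : ℝ) 1, E)) {t : ℝ}
    (ht : t ∈ Icc (0 : ℝ) 1) :
    extendPath (constPath y + integratePath δ) t = y + ∫ s in (0 : ℝ)..t, extendPath δ s := by
  rw [extendPath_of_mem _ ht]
  rfl

theorem hasDerivWithinAt_extendPath {y : E} [CompleteSpace E] {γ δ : C(Icc (0 : ℝ) 1, E)}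
    (h : γ = constPath y + integratePath δ) {t : ℝ} (ht : t ∈ Icc (0 : ℝ) 1) :
    HasDerivWithinAt (extendPath γ) (extendPath δ t) (Icc 0 1) t := by
  have h1 : HasDerivAt (fun t => y + ∫ s in (0 : ℝ)..t, extendPath δ s) (extendPath δ t) t :=
    ((continuous_extendPath δ).integral_hasStrictDerivAt 0 t).hasDerivAt.const_add y
  refine h1.hasDerivWithinAt.congr (fun s hs => ?_) ?_
  · rw [h, extendPath_constPath_add_integratePath y δ hs]
  · rw [h, extendPath_constPath_add_integratePath y δ ht]

theorem extendPath_zero {y : E} {γ δ : C(Icc (0 : ℝ) 1, E)}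
    (h : γ = constPath y + integratePath δ) : extendPath γ 0 = y := by
  rw [h, extendPath_constPath_add_integratePath y δ ⟨le_rfl, zero_le_one⟩]
  simp

/-- Near a common zero `y₀` of the vector fields `f (t, ·)`, the flow exists up to time `1` and
depends smoothly on the initial point. -/
theorem exists_flow_near_zero [CompleteSpace E] {f : ℝ × E → E} (hf : ContDiff ℝ ∞ f) {y₀ : E}
    (h₀ : ∀ t ∈ Icc (0 : ℝ) 1, f (t, y₀) = 0) :
    ∃ Ψ : E → C(Icc (0 : ℝ) 1, E), Ψ y₀ = constPath y₀ ∧ ∀ᶠ y in 𝓝 y₀, ContDiffAt ℝ ∞ Ψ y ∧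
      Ψ y = constPath y + integratePath (superposition f hf.continuous (Ψ y)) := by
  -- The integral curves starting at `y` are the solutions of `G γ = constPath y`. The derivative of
  -- `G` is one minus a Volterra operator, and the constant path at the zero `y₀` is a solution, so
  -- the inverse function theorem applies there.
  set G : C(Icc (0 : ℝ) 1, E) → C(Icc (0 : ℝ) 1, E) :=
    fun γ => γ - integratePath (superposition f hf.continuous γ) with hG
  have hGs : ContDiff ℝ ∞ G :=
    contDiff_id.sub ((integratePath (E := E)).contDiff.comp (contDiff_superposition hf))
  have hd : ∀ γ, ∃ e : C(Icc (0 : ℝ) 1, E) ≃L[ℝ] C(Icc (0 : ℝ) 1, E),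
      HasFDerivAt G (e : C(Icc (0 : ℝ) 1, E) →L[ℝ] C(Icc (0 : ℝ) 1, E)) γ := by
    intro γ
    obtain ⟨u, hu⟩ := isUnit_one_sub_volterra
      (superposition (spaceDeriv f) (contDiff_spaceDeriv hf).continuous γ)
    refine ⟨ContinuousLinearEquiv.unitsEquiv ℝ _ u, ?_⟩
    have h1 : HasFDerivAt G (1 - volterra (superposition (spaceDeriv f)
        (contDiff_spaceDeriv hf).continuous γ)) γ :=
      (hasFDerivAt_id _).sub ((integratePath (E := E)).hasFDerivAt.comp _
        (hasFDerivAt_superposition hf _))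
    convert h1 using 1
    rw [← hu]
    rfl
  have hGy : G (constPath y₀) = constPath y₀ := by
    have : superposition f hf.continuous (constPath y₀) = 0 := by
      ext t
      exact h₀ t t.2
    simp [hG, this]
  obtain ⟨e, he⟩ := hd (constPath y₀)
  set R := hGs.contDiffAt.toOpenPartialHomeomorph G he (by simp) with hR
  have hRG : ∀ γ, R γ = G γ := fun γ => rfl
  have hmem : constPath y₀ ∈ R.source :=
    ContDiffAt.mem_toOpenPartialHomeomorph_source hGs.contDiffAt he (by simp)
  have htar : constPath y₀ ∈ R.target := by
    have := R.map_source hmem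
    rwa [hRG, hGy] at this
  refine ⟨fun y => R.symm (constPath y), ?_, ?_⟩
  · have := R.left_inv hmem
    rwa [hRG, hGy] at this
  · filter_upwards [(constPath (E := E)).continuous.continuousAt.eventually
      (R.open_target.mem_nhds htar)] with y hy
    obtain ⟨e', he'⟩ := hd (R.symm (constPath y))
    refine ⟨(R.contDiffAt_symm hy he' hGs.contDiffAt).comp y
      (constPath (E := E)).contDiff.contDiffAt, ?_⟩
    have := R.right_inv hy
    rw [hRG, hG] at this
    exact sub_eq_iff_eq_add.1 this

/-- The derivative of the flow in the initial point solves the linearised equation. -/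
theorem eventually_fderiv_flow [CompleteSpace E] {f : ℝ × E → E} (hf : ContDiff ℝ ∞ f) {y₀ : E}
    {Ψ : E → C(Icc (0 : ℝ) 1, E)}
    (hΨ : ∀ᶠ y in 𝓝 y₀, ContDiffAt ℝ ∞ Ψ y ∧ Ψ y = constPath y +
      integratePath (superposition f hf.continuous (Ψ y))) :
    ∀ᶠ y in 𝓝 y₀, DifferentiableAt ℝ Ψ y ∧ ∀ v, fderiv ℝ Ψ y v = constPath v + integratePath
      (applyPath (superposition (spaceDeriv f) (contDiff_spaceDeriv hf).continuous (Ψ y))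
        (fderiv ℝ Ψ y v)) := by
  filter_upwards [hΨ.eventually_nhds] with y hy'
  have hy : DifferentiableAt ℝ Ψ y := hy'.self_of_nhds.1.differentiableAt (by simp)
  have hy2 := hy'.mono fun z hz => hz.2
  refine ⟨hy, fun v => ?_⟩
  have h2 : HasFDerivAt (fun y => constPath y + integratePath (superposition f hf.continuous (Ψ y)))
      (constPath + (integratePath (E := E)).comp ((applyPath (superposition (spaceDeriv f)
        (contDiff_spaceDeriv hf).continuous (Ψ y))).comp (fderiv ℝ Ψ y))) y :=
    (constPath (E := E)).hasFDerivAt.add ((integratePath (E := E)).hasFDerivAt.comp _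
      ((hasFDerivAt_superposition hf _).comp y hy.hasFDerivAt))
  have h3 := (h2.congr_of_eventuallyEq hy2).fderiv
  conv_lhs => rw [h3]
  rfl

end ODE

/-! ### The linear system defining the Moser field, and its smooth solvability -/

section ContactSystem

variable {E : Type} [NormedAddCommGroup E] [NormedSpace ℝ E]

/-- The exterior derivative of a `1`-form on a vector space. -/
def dOne (a : E → E →L[ℝ] ℝ) (y : E) : E →L[ℝ] E →L[ℝ] ℝ :=
  fderiv ℝ a y - (fderiv ℝ a y).flip

theorem dOne_apply (a : E → E →L[ℝ] ℝ) (y u v : E) :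
    dOne a y u v = fderiv ℝ a y u v - fderiv ℝ a y v u := rfl

/-- The linear operator `(Z, μ) ↦ (Ω (Z, ·) - μ A, A Z)`. -/
def contactSystem (A : E →L[ℝ] ℝ) (Ω : E →L[ℝ] E →L[ℝ] ℝ) : E × ℝ →L[ℝ] (E →L[ℝ] ℝ) × ℝ :=
  (Ω.comp (ContinuousLinearMap.fst ℝ E ℝ) - (ContinuousLinearMap.snd ℝ E ℝ).smulRight A).prod
    (A.comp (ContinuousLinearMap.fst ℝ E ℝ))

@[simp] theorem contactSystem_apply (A : E →L[ℝ] ℝ) (Ω : E →L[ℝ] E →L[ℝ] ℝ) (p : E × ℝ) :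
    contactSystem A Ω p = (Ω p.1 - p.2 • A, A p.1) := rfl

/-- For a kernel element (u, μ), `u` lies in ker A and Ω(u, ·) = μ A vanishes on ker A, so u = 0 and
then μ = 0. Source and target have equal dimension. This solves Moser's equation for the field and
the conformal rate at once. -/
theorem isInvertible_contactSystem [FiniteDimensional ℝ E] {A : E →L[ℝ] ℝ}
    {Ω : E →L[ℝ] E →L[ℝ] ℝ} (hA : A ≠ 0)
    (hΩ : ∀ u, A u = 0 → (∀ v, A v = 0 → Ω u v = 0) → u = 0) :
    (contactSystem A Ω).IsInvertible := by
  have hinj : Function.Injective (contactSystem A Ω).toLinearMap := by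
    rw [← LinearMap.ker_eq_bot, LinearMap.ker_eq_bot']
    rintro ⟨u, μ⟩ h
    have h' : contactSystem A Ω (u, μ) = 0 := h
    rw [contactSystem_apply, Prod.mk_eq_zero] at h'
    have hu : u = 0 := hΩ u h'.2 fun v hv => by
      have := congrArg (fun B : E →L[ℝ] ℝ => B v) h'.1
      simpa [hv] using this
    subst hu
    have h2 : μ • A = 0 := by simpa using h'.1
    rcases smul_eq_zero.1 h2 with h3 | h3
    · simp [h3]
    · exact absurd h3 hA
  have hfin : Module.finrank ℝ (E × ℝ) = Module.finrank ℝ ((E →L[ℝ] ℝ) × ℝ) := by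
    rw [Module.finrank_prod, Module.finrank_prod]
    congr 1
    rw [← (LinearMap.toContinuousLinearMap (𝕜 := ℝ) (E := E) (F' := ℝ)).finrank_eq]
    exact (Subspace.dual_finrank_eq (K := ℝ) (V := E)).symm
  exact ⟨(LinearMap.linearEquivOfInjective _ hinj hfin).toContinuousLinearEquiv, by ext <;> rfl⟩

theorem contDiffAt_smul_of {F G : Type} [NormedAddCommGroup F] [NormedSpace ℝ F]
    [NormedAddCommGroup G] [NormedSpace ℝ G] {f : G → ℝ} {g : G → F} {p : G}
    (hf : ContDiffAt ℝ ∞ f p) (hg : ContDiffAt ℝ ∞ g p) : ContDiffAt ℝ ∞ (fun q => f q • g q) p :=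
  hf.smul hg

/-- A function which is smooth in a neighbourhood of a point. -/
def SmoothNear {E F : Type} [NormedAddCommGroup E] [NormedSpace ℝ E] [NormedAddCommGroup F]
    [NormedSpace ℝ F] (f : E → F) (y : E) : Prop :=
  ∀ᶠ z in 𝓝 y, ContDiffAt ℝ ∞ f z

theorem contDiffAt_fderiv {F : Type} [NormedAddCommGroup F] [NormedSpace ℝ F] {f : E → F} {y : E}
    (hf : ContDiffAt ℝ ∞ f y) : ContDiffAt ℝ ∞ (fderiv ℝ f) y :=
  hf.fderiv_right (m := ∞) (by simp)

theorem contDiffAt_dOne {a : E → E →L[ℝ] ℝ} {y : E} (ha : ContDiffAt ℝ ∞ a y) :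
    ContDiffAt ℝ ∞ (dOne a) y := by
  have h1 := contDiffAt_fderiv ha
  have h2 : ContDiff ℝ ∞ (ContinuousLinearMap.flipₗᵢ ℝ E E ℝ) := by
    apply LinearIsometryEquiv.contDiff
  exact h1.sub (h2.contDiffAt.comp y h1)

variable (a b : E → E →L[ℝ] ℝ) (h : E → ℝ)

/-- The form `a + t b`. -/
def pathForm (p : ℝ × E) : E →L[ℝ] ℝ := a p.2 + p.1 • b p.2

/-- The exterior derivative of `a + t b`. -/
def pathD (p : ℝ × E) : E →L[ℝ] E →L[ℝ] ℝ := dOne a p.2 + p.1 • dOne b p.2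

/-- The linear operator which determines the field of Moser's method. -/
def pathSystem (p : ℝ × E) : E × ℝ →L[ℝ] (E →L[ℝ] ℝ) × ℝ :=
  contactSystem (pathForm a b p) (pathD a b p)

/-- The `1`-form `b + dh`. -/
def addD (y : E) : E →L[ℝ] ℝ := b y + fderiv ℝ h y

/-- The right-hand side of the equation of Moser's method. -/
def moserRHS (y : E) : (E →L[ℝ] ℝ) × ℝ := (-addD b h y, h y)

/-- The solution `(X, μ)` of `d(a + t b) (X, ·) + b + dh = μ (a + t b)`, `(a + t b) X = h`. -/
def moserField (p : ℝ × E) : E × ℝ := (pathSystem a b p).inverse (moserRHS b h p.2)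

variable {a b h}

theorem contDiffAt_pathForm {p : ℝ × E} (ha : ContDiffAt ℝ ∞ a p.2) (hb : ContDiffAt ℝ ∞ b p.2) :
    ContDiffAt ℝ ∞ (pathForm a b) p :=
  (ha.comp p contDiffAt_snd).add (contDiffAt_fst.smul (hb.comp p contDiffAt_snd))

theorem contDiffAt_pathSystem {p : ℝ × E} (ha : ContDiffAt ℝ ∞ a p.2)
    (hb : ContDiffAt ℝ ∞ b p.2) : ContDiffAt ℝ ∞ (pathSystem a b) p := by
  have h1 := contDiffAt_pathForm ha hb
  have h2 : ContDiffAt ℝ ∞ (pathD a b) p := by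
    refine ((contDiffAt_dOne ha).comp p contDiffAt_snd).add ?_
    apply contDiffAt_smul_of contDiffAt_fst ((contDiffAt_dOne hb).comp p contDiffAt_snd)
  have h3 : ContDiffAt ℝ ∞ (fun q => (ContinuousLinearMap.snd ℝ E ℝ).smulRight
      (pathForm a b q)) p := by
    have h : ContDiff ℝ ∞ (ContinuousLinearMap.smulRightL ℝ (E × ℝ) (E →L[ℝ] ℝ)
      (ContinuousLinearMap.snd ℝ E ℝ)) := by apply ContinuousLinearMap.contDiff
    exact h.contDiffAt.comp p h1
  have h4 := (h2.clm_comp (contDiffAt_const (c := ContinuousLinearMap.fst ℝ E ℝ))).sub h3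
  have h5 := h1.clm_comp (contDiffAt_const (c := ContinuousLinearMap.fst ℝ E ℝ))
  have h6 := ((contDiffAt_const (c := ContinuousLinearMap.inl ℝ (E →L[ℝ] ℝ) ℝ)).clm_comp h4).add
    ((contDiffAt_const (c := ContinuousLinearMap.inr ℝ (E →L[ℝ] ℝ) ℝ)).clm_comp h5)
  refine h6.congr_of_eventuallyEq (Eventually.of_forall fun q => ?_)
  refine ContinuousLinearMap.ext fun z => ?_
  simp [pathSystem]

theorem contDiffAt_addD {y : E} (hb : ContDiffAt ℝ ∞ b y) (hh : ContDiffAt ℝ ∞ h y) :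
    ContDiffAt ℝ ∞ (addD b h) y :=
  hb.add (contDiffAt_fderiv hh)

theorem contDiffAt_moserRHS {y : E} (hb : ContDiffAt ℝ ∞ b y) (hh : ContDiffAt ℝ ∞ h y) :
    ContDiffAt ℝ ∞ (moserRHS b h) y :=
  (contDiffAt_addD hb hh).neg.prodMk hh

theorem contDiffAt_moserField [CompleteSpace E] {p : ℝ × E} (ha : ContDiffAt ℝ ∞ a p.2)
    (hb : ContDiffAt ℝ ∞ b p.2) (hh : ContDiffAt ℝ ∞ h p.2) (hS : (pathSystem a b p).IsInvertible) :
    ContDiffAt ℝ ∞ (moserField a b h) p :=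
  ((hS.contDiffAt_map_inverse (n := ∞)).comp p (contDiffAt_pathSystem ha hb)).clm_apply
    ((contDiffAt_moserRHS hb hh).comp p contDiffAt_snd)

theorem moserField_eq_iff {p : ℝ × E} (hS : (pathSystem a b p).IsInvertible) {z : E × ℝ} :
    moserField a b h p = z ↔ pathSystem a b p z = moserRHS b h p.2 := by
  rw [moserField, hS.inverse_apply_eq, eq_comm]

theorem eventually_isInvertible [CompleteSpace E] {p : ℝ × E} (ha : ContDiffAt ℝ ∞ a p.2)
    (hb : ContDiffAt ℝ ∞ b p.2) (hS : (pathSystem a b p).IsInvertible) :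
    ∀ᶠ q in 𝓝 p, (pathSystem a b q).IsInvertible := by
  obtain ⟨e, he⟩ := hS
  have := (contDiffAt_pathSystem ha hb).continuousAt.eventually (he ▸ e.nhds)
  exact this

end ContactSystem

/-! ### Moser's method on a vector space, near a zero of the field -/

section MoserFlow

variable {E : Type} [NormedAddCommGroup E] [NormedSpace ℝ E]
  {a b : E → E →L[ℝ] ℝ} {h : E → ℝ} {y₀ : E}

/-- All data are smooth, and `a + t b` is a contact form, at the point `(t, y)`. -/
structure MoserGood (a b : E → E →L[ℝ] ℝ) (h : E → ℝ) (p : ℝ × E) : Prop where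
  smooth_a : ContDiffAt ℝ ∞ a p.2
  smooth_b : ContDiffAt ℝ ∞ b p.2
  smooth_h : ContDiffAt ℝ ∞ h p.2
  invertible : (pathSystem a b p).IsInvertible

theorem MoserGood.eventually [CompleteSpace E] {p : ℝ × E} (ha : SmoothNear a p.2)
    (hb : SmoothNear b p.2) (hh : SmoothNear h p.2) (hS : (pathSystem a b p).IsInvertible) :
    ∀ᶠ q in 𝓝 p, MoserGood a b h q := by
  filter_upwards [continuous_snd.continuousAt.eventually ha,
    continuous_snd.continuousAt.eventually hb, continuous_snd.continuousAt.eventually hh,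
    eventually_isInvertible ha.self_of_nhds hb.self_of_nhds hS] with q h1 h2 h3 h4
  exact ⟨h1, h2, h3, h4⟩

/-- A globally smooth field which agrees with the Moser field near `[0, 1] × {y₀}`. -/
theorem exists_cutoff_moserField [FiniteDimensional ℝ E]
    (hgood : ∀ t ∈ Icc (0 : ℝ) 1, ∀ᶠ q in 𝓝 (t, y₀), MoserGood a b h q) :
    ∃ f : ℝ × E → E × ℝ, ContDiff ℝ ∞ f ∧ ∃ W : Set (ℝ × E), IsOpen W ∧
      (∀ t ∈ Icc (0 : ℝ) 1, (t, y₀) ∈ W) ∧ ∀ p ∈ W, MoserGood a b h p ∧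
        f p = moserField a b h p := by
  have : CompleteSpace E := FiniteDimensional.complete ℝ E
  set O : Set (ℝ × E) := interior {q | MoserGood a b h q}
  set K : Set (ℝ × E) := Icc (0 : ℝ) 1 ×ˢ {y₀}
  have hK : IsCompact K := isCompact_Icc.prod isCompact_singleton
  have hKO : K ⊆ O := by
    rintro ⟨t, y⟩ ⟨ht, hy⟩
    obtain rfl : y = y₀ := hy
    exact mem_interior_iff_mem_nhds.2 (hgood t ht)
  obtain ⟨T, hT, hKT, hTO⟩ := exists_compact_between hK isOpen_interior hKO
  -- The flow theorem needs a globally smooth field, while the Moser field is only known to be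
  -- smooth near the segment; the cut-off leaves it unchanged near the segment.
  obtain ⟨χ, hχ1, hχ0, -⟩ := exists_contMDiffMap_one_nhds_of_subset_interior (n := ⊤)
    𝓘(ℝ, ℝ × E) hK.isClosed hKT
  have hχs : ContDiff ℝ ∞ (χ : ℝ × E → ℝ) := χ.contMDiff.contDiff
  refine ⟨fun p => χ p • moserField a b h p, ?_, O ∩ interior {p | χ p = 1},
    isOpen_interior.inter isOpen_interior, ?_, ?_⟩
  · rw [contDiff_iff_contDiffAt]
    intro p
    by_cases hp : p ∈ O
    · have hg := interior_subset hp
      exact hχs.contDiffAt.smul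
        (contDiffAt_moserField hg.smooth_a hg.smooth_b hg.smooth_h hg.invertible)
    · have hp' : Tᶜ ∈ 𝓝 p := hT.isClosed.isOpen_compl.mem_nhds fun h => hp (hTO h)
      refine (contDiffAt_const (c := (0 : E × ℝ))).congr_of_eventuallyEq ?_
      filter_upwards [hp'] with q hq
      rw [hχ0 q hq, zero_smul]
  · intro t ht
    have hm : (t, y₀) ∈ K := ⟨ht, rfl⟩
    exact ⟨hKO hm, mem_interior_iff_mem_nhds.2 (hχ1.filter_mono (nhds_le_nhdsSet hm))⟩
  · rintro p ⟨hp1, hp2⟩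
    refine ⟨interior_subset hp1, ?_⟩
    have : χ p = 1 := (interior_subset hp2 : p ∈ {p | χ p = 1})
    simp only [this, one_smul]

theorem moserField_spec {p : ℝ × E} (hp : MoserGood a b h p) :
    pathSystem a b p (moserField a b h p) = moserRHS b h p.2 :=
  (moserField_eq_iff hp.invertible).1 rfl

theorem pathForm_moserField {p : ℝ × E} (hp : MoserGood a b h p) :
    pathForm a b p (moserField a b h p).1 = h p.2 :=
  congrArg Prod.snd (moserField_spec hp)

theorem pathD_moserField {p : ℝ × E} (hp : MoserGood a b h p) (v : E) :
    pathD a b p (moserField a b h p).1 v + addD b h p.2 v =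
      (moserField a b h p).2 * pathForm a b p v := by
  have h1 := congrArg (fun B : E →L[ℝ] ℝ => B v) (congrArg Prod.fst (moserField_spec hp))
  simp only [pathSystem, contactSystem_apply, moserRHS, sub_apply,
    smul_apply, neg_apply, smul_eq_mul] at h1
  linarith

theorem hasFDerivAt_pathForm_slice {p : ℝ × E} (ha : ContDiffAt ℝ ∞ a p.2)
    (hb : ContDiffAt ℝ ∞ b p.2) :
    HasFDerivAt (fun z => pathForm a b (p.1, z)) (fderiv ℝ a p.2 + p.1 • fderiv ℝ b p.2) p.2 :=
  (ha.differentiableAt (by simp)).hasFDerivAt.add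
    ((hb.differentiableAt (by simp)).hasFDerivAt.const_smul p.1)

/-- The evaluation of `a + t b` on a solution of the linearised Moser equation satisfies a scalar
linear differential equation. -/
theorem hasDerivWithinAt_pathForm {f : ℝ × E → E × ℝ} (hf : ContDiff ℝ ∞ f) {W : Set (ℝ × E)}
    (hW : IsOpen W) (hfW : ∀ p ∈ W, MoserGood a b h p ∧ f p = moserField a b h p)
    {ψ w : ℝ → E} {s : Set ℝ} {t : ℝ} (ht : (t, ψ t) ∈ W)
    (hψ : HasDerivWithinAt ψ (f (t, ψ t)).1 s t)
    (hw : HasDerivWithinAt w (spaceDeriv (fun p => (f p).1) (t, ψ t) (w t)) s t) :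
    HasDerivWithinAt (fun t => pathForm a b (t, ψ t) (w t))
      ((f (t, ψ t)).2 * pathForm a b (t, ψ t) (w t)) s t := by
  obtain ⟨hg, hm⟩ := hfW _ ht
  have da : HasFDerivAt a (fderiv ℝ a (ψ t)) (ψ t) :=
    (hg.smooth_a.differentiableAt (by simp)).hasFDerivAt
  have db : HasFDerivAt b (fderiv ℝ b (ψ t)) (ψ t) :=
    (hg.smooth_b.differentiableAt (by simp)).hasFDerivAt
  have h1 := ((da.comp_hasDerivWithinAt t hψ).add
    ((hasDerivWithinAt_id t s).smul (db.comp_hasDerivWithinAt t hψ))).clm_apply hw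
  have h2 : HasFDerivAt (fun z => pathForm a b (t, z) (f (t, z)).1) _ (ψ t) :=
    (hasFDerivAt_pathForm_slice (p := (t, ψ t)) hg.smooth_a hg.smooth_b).clm_apply
      (hasFDerivAt_slice (f := fun p => (f p).1) (t := t)
        ((contDiff_fst.comp hf).differentiable (by simp) (t, ψ t)))
  -- Differentiating (a + t b)(X) = h in space is the exact term of Cartan's formula; combined with
  -- the equation for d(a + t b)(X, ·) it leaves only the multiple μ of a + t b.
  have h3 : (fun z => pathForm a b (t, z) (f (t, z)).1) =ᶠ[𝓝 (ψ t)] h := by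
    have : ∀ᶠ z in 𝓝 (ψ t), (t, z) ∈ W :=
      (Continuous.prodMk_right t).continuousAt.eventually (hW.mem_nhds ht)
    filter_upwards [this] with z hz
    rw [(hfW _ hz).2]
    exact pathForm_moserField (hfW _ hz).1
  have h4 := congrArg (fun B : E →L[ℝ] ℝ => B (w t)) (h2.unique
    ((hg.smooth_h.differentiableAt (by simp)).hasFDerivAt.congr_of_eventuallyEq h3))
  have h5 := pathD_moserField hg (w t)
  rw [← hm] at h5
  refine HasDerivWithinAt.congr_deriv h1 ?_
  rw [← h5]
  simp only [add_apply, smul_apply,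
    ContinuousLinearMap.comp_apply, ContinuousLinearMap.flip_apply, smul_eq_mul] at h4
  have h6 : ∀ v, (a ∘ ψ + (id : ℝ → ℝ) • b ∘ ψ) t v = a (ψ t) v + t * b (ψ t) v := fun v => rfl
  simp only [h6, pathD, addD, dOne_apply, add_apply,
    smul_apply, smul_eq_mul, pathForm, id, Function.comp, one_smul] at h4 ⊢
  linarith

theorem eventually_forall_mem_of_continuousAt {Ψ : E → C(Icc (0 : ℝ) 1, E)}
    (hΨ : ContinuousAt Ψ y₀) (h₀ : Ψ y₀ = constPath y₀) {W : Set (ℝ × E)} (hW : IsOpen W)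
    (hyW : ∀ t ∈ Icc (0 : ℝ) 1, (t, y₀) ∈ W) :
    ∀ᶠ y in 𝓝 y₀, ∀ t ∈ Icc (0 : ℝ) 1, (t, extendPath (Ψ y) t) ∈ W := by
  have h1 := (continuous_superposition (id : ℝ × E → ℝ × E) continuous_id).continuousAt.comp hΨ
  have h2 : {g : C(Icc (0 : ℝ) 1, ℝ × E) | MapsTo g univ W} ∈
      𝓝 (superposition (id : ℝ × E → ℝ × E) continuous_id (Ψ y₀)) := by
    refine (ContinuousMap.isOpen_setOfPred_mapsTo isCompact_univ hW).mem_nhds ?_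
    intro t _
    rw [h₀]
    exact hyW t t.2
  filter_upwards [h1.eventually h2] with y hy t ht
  have := hy (mem_univ ⟨t, ht⟩)
  rwa [extendPath_of_mem _ ht]

/-- The integrating factor is exp(-∫ μ). The constant depends on μ alone and not on the solution, so
one conformal factor serves all tangent vectors at a point. -/
theorem exists_pos_forall_eq_mul_of_hasDerivWithinAt {μ : ℝ → ℝ} (hμ : Continuous μ) :
    ∃ c > 0, ∀ g : ℝ → ℝ, (∀ t ∈ Icc (0 : ℝ) 1, HasDerivWithinAt g (μ t * g t) (Icc 0 1) t) →
      g 1 = c * g 0 := by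
  set M : ℝ → ℝ := fun t => ∫ s in (0 : ℝ)..t, μ s
  have hM : ∀ t, HasDerivAt M (μ t) t := fun t => (hμ.integral_hasStrictDerivAt 0 t).hasDerivAt
  refine ⟨Real.exp (M 1), Real.exp_pos _, fun g hg => ?_⟩
  have hd : ∀ t ∈ Icc (0 : ℝ) 1, HasDerivWithinAt (fun t => g t * Real.exp (-M t)) 0
      (Icc 0 1) t := by
    intro t ht
    refine ((hg t ht).mul (hM t).neg.exp.hasDerivWithinAt).congr_deriv ?_
    ring
  have hc := constant_of_derivWithin_zero (fun t ht => (hd t ht).differentiableWithinAt)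
    (fun t ht => (hd t (Ico_subset_Icc_self ht)).derivWithin
      (uniqueDiffOn_Icc zero_lt_one t (Ico_subset_Icc_self ht))) 1 ⟨zero_le_one, le_rfl⟩
  have h0 : M 0 = 0 := intervalIntegral.integral_same
  simp only [h0, neg_zero, Real.exp_zero, mul_one] at hc
  rw [← hc, Real.exp_neg]
  field_simp

/-- A projection with kernel `T` is continuous and commutes with the integral. -/
theorem intervalIntegral_mem_submodule [FiniteDimensional ℝ E] (T : Submodule ℝ E) {g : ℝ → E}
    (hg : Continuous g) (hT : ∀ t ∈ Icc (0 : ℝ) 1, g t ∈ T) {t : ℝ} (ht : t ∈ Icc (0 : ℝ) 1) :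
    ∫ s in (0 : ℝ)..t, g s ∈ T := by
  have : CompleteSpace E := FiniteDimensional.complete ℝ E
  obtain ⟨T', hT'⟩ := T.exists_isCompl
  set P : E →L[ℝ] E := LinearMap.toContinuousLinearMap (T'.projection T hT'.symm)
  have hP : ∀ x, P x = 0 ↔ x ∈ T := fun x => Submodule.projection_apply_eq_zero_iff hT'.symm
  rw [← hP, ← P.intervalIntegral_comp_comm (hg.intervalIntegrable _ _)]
  refine intervalIntegral.integral_zero_ae (Eventually.of_forall fun s hs => ?_)
  rw [uIoc_of_le ht.1] at hs
  exact (hP _).2 (hT s ⟨hs.1.le, hs.2.trans ht.2⟩)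

/-- The flow of the Moser field of `a`, `b`, `h` near a point `y₀`. -/
structure IsMoserFlow (a b : E → E →L[ℝ] ℝ) (h : E → ℝ) (y₀ : E) (ψ : E → ℝ → E) : Prop where
  fixed : ∀ t ∈ Icc (0 : ℝ) 1, ψ y₀ t = y₀
  smooth : ∀ᶠ y in 𝓝 y₀, ContDiffAt ℝ ∞ (fun z => ψ z 1) y
  stays : ∀ N ∈ 𝓝 y₀, ∀ᶠ y in 𝓝 y₀, ∀ t ∈ Icc (0 : ℝ) 1, ψ y t ∈ N
  start : ∀ᶠ y in 𝓝 y₀, ψ y 0 = y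
  solves : ∀ᶠ y in 𝓝 y₀, ∀ t ∈ Icc (0 : ℝ) 1,
    HasDerivWithinAt (ψ y) (moserField a b h (t, ψ y t)).1 (Icc 0 1) t
  conformal : ∀ᶠ y in 𝓝 y₀, ∃ c > 0, ∀ v,
    pathForm a b (1, ψ y 1) (fderiv ℝ (fun z => ψ z 1) y v) = c * a y v
  injective : ∀ v, fderiv ℝ (fun z => ψ z 1) y₀ v = 0 → v = 0
  shear : ∀ V T : Submodule ℝ E, (∀ w ∈ T, fderiv ℝ (addD b h) y₀ w = 0) →
    (∀ t ∈ Icc (0 : ℝ) 1, ∀ w ∈ V, ∀ u, pathForm a b (t, y₀) u = 0 →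
      (∀ v, pathForm a b (t, y₀) v = 0 →
        pathD a b (t, y₀) u v = -fderiv ℝ (addD b h) y₀ w v) → u ∈ T) →
    ∀ v ∈ V, fderiv ℝ (fun z => ψ z 1) y₀ v - v ∈ T

theorem moserField_eq_zero {p : ℝ × E} (hp : MoserGood a b h p) (hb : addD b h p.2 = 0)
    (hh : h p.2 = 0) : moserField a b h p = 0 := by
  rw [moserField_eq_iff hp.invertible, map_zero, moserRHS, hb, hh, neg_zero, Prod.mk_zero_zero]

/-- The linearisation of the Moser equation at a zero of its right-hand side. -/
theorem pathSystem_fderiv_moserField [CompleteSpace E] {t : ℝ} {y : E}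
    (hp : ∀ᶠ q in 𝓝 (t, y), MoserGood a b h q) (hb : addD b h y = 0) (hh : h y = 0) (w : E) :
    pathSystem a b (t, y) (spaceDeriv (moserField a b h) (t, y) w) =
      (-fderiv ℝ (addD b h) y w, fderiv ℝ h y w) := by
  have hg := hp.self_of_nhds
  have hm : HasFDerivAt (fun z => moserField a b h (t, z)) _ y := hasFDerivAt_slice
    ((contDiffAt_moserField hg.smooth_a hg.smooth_b hg.smooth_h hg.invertible).differentiableAt
      (by simp))
  have hs : HasFDerivAt (fun z => pathSystem a b (t, z)) _ y := hasFDerivAt_slice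
    ((contDiffAt_pathSystem hg.smooth_a hg.smooth_b).differentiableAt (by simp))
  have hr : HasFDerivAt (moserRHS b h) ((-fderiv ℝ (addD b h) y).prod (fderiv ℝ h y)) y :=
    (((contDiffAt_addD hg.smooth_b hg.smooth_h).differentiableAt (by simp)).hasFDerivAt.neg).prodMk
      (hg.smooth_h.differentiableAt (by simp)).hasFDerivAt
  have hev : (fun z => pathSystem a b (t, z) (moserField a b h (t, z))) =ᶠ[𝓝 y]
      moserRHS b h := by
    filter_upwards [(Continuous.prodMk_right t).continuousAt.eventually hp] with z hz
    exact moserField_spec hz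
  have h1 := congrArg (fun B : E →L[ℝ] _ => B w)
    ((hs.clm_apply hm).unique (hr.congr_of_eventuallyEq hev))
  -- The term in which the operator itself is differentiated is applied to the field, which is zero
  -- at `y`.
  simp only [ContinuousLinearMap.comp_apply,
    moserField_eq_zero hg hb hh, map_zero, add_zero] at h1
  exact h1

/-- Moser's method near a point where the field vanishes. -/
theorem exists_isMoserFlow [FiniteDimensional ℝ E]
    (hgood : ∀ t ∈ Icc (0 : ℝ) 1, ∀ᶠ q in 𝓝 (t, y₀), MoserGood a b h q)
    (hb : addD b h y₀ = 0) (hh : h y₀ = 0) (hdh : fderiv ℝ h y₀ = 0) :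
    ∃ ψ, IsMoserFlow a b h y₀ ψ := by
  have : CompleteSpace E := FiniteDimensional.complete ℝ E
  obtain ⟨f, hf, W, hW, hyW, hfW⟩ := exists_cutoff_moserField hgood
  have hX : ContDiff ℝ ∞ (fun p => (f p).1) := contDiff_fst.comp hf
  have hμ : Continuous (fun p => (f p).2) := (contDiff_snd.comp hf).continuous
  have h₀ : ∀ t ∈ Icc (0 : ℝ) 1, (f (t, y₀)).1 = 0 := fun t ht => by
    rw [(hfW _ (hyW t ht)).2, moserField_eq_zero (hfW _ (hyW t ht)).1 hb hh, Prod.fst_zero]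
  obtain ⟨Ψ, hΨ₀, hΨ⟩ := exists_flow_near_zero hX h₀
  have hΨc : ContinuousAt Ψ y₀ := hΨ.self_of_nhds.1.continuousAt
  have hstay : ∀ᶠ y in 𝓝 y₀, ∀ t ∈ Icc (0 : ℝ) 1, (t, extendPath (Ψ y) t) ∈ W :=
    eventually_forall_mem_of_continuousAt hΨc hΨ₀ hW hyW
  have hvar := eventually_fderiv_flow hX hΨ
  set ev : C(Icc (0 : ℝ) 1, E) →L[ℝ] E := ContinuousMap.evalCLM ℝ ⟨1, zero_le_one, le_rfl⟩
  have hev : (fun z => extendPath (Ψ z) 1) = fun z => ev (Ψ z) := by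
    funext z
    exact extendPath_of_mem _ _
  have hev' : ∀ δ, ev δ = extendPath δ 1 := fun δ => (extendPath_of_mem _ _).symm
  have hdev : ∀ᶠ y in 𝓝 y₀, ∀ v, fderiv ℝ (fun z => extendPath (Ψ z) 1) y v =
      extendPath (fderiv ℝ Ψ y v) 1 := by
    filter_upwards [hvar] with y hy v
    have h1 : HasFDerivAt (fun z => ev (Ψ z)) (ev.comp (fderiv ℝ Ψ y)) y :=
      ev.hasFDerivAt.comp y hy.1.hasFDerivAt
    rw [hev, h1.fderiv, ContinuousLinearMap.comp_apply, hev']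
  have hsol : ∀ᶠ y in 𝓝 y₀, ∀ t ∈ Icc (0 : ℝ) 1,
      HasDerivWithinAt (extendPath (Ψ y)) (f (t, extendPath (Ψ y) t)).1 (Icc 0 1) t := by
    filter_upwards [hΨ] with y hy t ht
    refine (hasDerivWithinAt_extendPath hy.2 ht).congr_deriv ?_
    rw [extendPath_of_mem _ ht, extendPath_of_mem _ ht]
    rfl
  have hlin : ∀ᶠ y in 𝓝 y₀, ∀ v, ∀ t ∈ Icc (0 : ℝ) 1, HasDerivWithinAt
      (extendPath (fderiv ℝ Ψ y v)) (spaceDeriv (fun p => (f p).1) (t, extendPath (Ψ y) t)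
        (extendPath (fderiv ℝ Ψ y v) t)) (Icc 0 1) t := by
    filter_upwards [hvar] with y hy v t ht
    refine (hasDerivWithinAt_extendPath (hy.2 v) ht).congr_deriv ?_
    rw [extendPath_of_mem _ ht, extendPath_of_mem _ ht, extendPath_of_mem _ ht]
    rfl
  have hone : (1 : ℝ) ∈ Icc (0 : ℝ) 1 := ⟨zero_le_one, le_rfl⟩
  refine ⟨fun y => extendPath (Ψ y), ?_, ?_, ?_, ?_, ?_, ?_, ?_, ?_⟩
  · intro t ht
    rw [hΨ₀, extendPath_of_mem _ ht, constPath_apply]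
  · filter_upwards [hΨ] with y hy
    rw [hev]
    exact ev.contDiff.contDiffAt.comp y hy.1
  · intro N hN
    filter_upwards [eventually_forall_mem_of_continuousAt hΨc hΨ₀
      (isOpen_univ.prod (isOpen_interior (s := N)))
      fun t _ => ⟨mem_univ _, mem_interior_iff_mem_nhds.2 hN⟩] with y hy t ht
    exact interior_subset (hy t ht).2
  · filter_upwards [hΨ] with y hy
    exact extendPath_zero hy.2
  · filter_upwards [hsol, hstay] with y hy hs t ht
    rw [← (hfW _ (hs t ht)).2]
    exact hy t ht
  · filter_upwards [hsol, hstay, hlin, hdev, hvar, hΨ] with y hy hs hl hd hv hΨy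
    obtain ⟨c, hc, hg⟩ := exists_pos_forall_eq_mul_of_hasDerivWithinAt
      (continuous_extendPath (superposition (fun p => (f p).2) hμ (Ψ y)))
    refine ⟨c, hc, fun v => ?_⟩
    have h1 := hg (fun t => pathForm a b (t, extendPath (Ψ y) t)
      (extendPath (fderiv ℝ Ψ y v) t)) fun t ht => by
        refine (hasDerivWithinAt_pathForm hf hW hfW (hs t ht) (hy t ht) (hl v t ht)).congr_deriv ?_
        rw [extendPath_of_mem (superposition _ _ _) ht, extendPath_of_mem _ ht]
        rfl
    rw [hd]
    refine h1.trans ?_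
    simp only [extendPath_zero (hv.2 v), extendPath_zero hΨy.2, pathForm, zero_smul, add_zero]
  · intro v hv
    rw [hdev.self_of_nhds] at hv
    set A := superposition (spaceDeriv fun p => (f p).1) (contDiff_spaceDeriv hX).continuous (Ψ y₀)
    -- The linearised solution with initial value `v` is zero at time one; uniqueness backwards in
    -- time makes it zero throughout.
    have hz := ODE_solution_unique_of_mem_Icc_left (a := 0) (b := 1)
      (v := fun t x => extendPath A t x) (s := fun _ => univ) (K := ‖A‖₊)
      (f := extendPath (fderiv ℝ Ψ y₀ v)) (g := fun _ => 0)
      (fun t _ => ((extendPath A t).lipschitz.weaken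
        (norm_extendPath_le A t)).lipschitzOnWith) (continuous_extendPath _).continuousOn
      (fun t ht => ?_) (fun _ _ => mem_univ _) continuousOn_const (fun t _ => ?_)
      (fun _ _ => mem_univ _) hv
    · have := hz (left_mem_Icc.2 zero_le_one)
      rwa [extendPath_zero (hvar.self_of_nhds.2 v)] at this
    · have ht' := Ioc_subset_Icc_self ht
      have h1 := (hlin.self_of_nhds v t ht').congr_deriv
        (g' := extendPath A t (extendPath (fderiv ℝ Ψ y₀ v) t))
        (by rw [extendPath_of_mem _ ht', extendPath_of_mem _ ht', extendPath_of_mem _ ht']; rfl)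
      exact h1.mono_of_mem_nhdsWithin (Icc_mem_nhdsLE_of_mem ht)
    · simpa using hasDerivWithinAt_const (x := t) (s := Iic t) (c := (0 : E))
  · intro V T hT hV v hv
    set A := superposition (spaceDeriv fun p => (f p).1) (contDiff_spaceDeriv hX).continuous (Ψ y₀)
      with hA
    -- The linearised field solves the contact system with the derivative of `addD b h` on the
    -- right. The hypotheses on `T` and `V` are read through this equation: `A t` kills `T` and maps
    -- `V` into `T`.
    have hAt : ∀ t : Icc (0 : ℝ) 1, ∀ w, pathSystem a b (t, y₀)
        (A t w, (spaceDeriv (moserField a b h) (t, y₀) w).2) =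
        (-fderiv ℝ (addD b h) y₀ w, 0) := by
      intro t w
      have h1 := pathSystem_fderiv_moserField (hgood t t.2) hb hh w
      rw [hdh] at h1
      have h2 : A t = (ContinuousLinearMap.fst ℝ E ℝ).comp
          (spaceDeriv (moserField a b h) (t, y₀)) := by
        have h3 : ((t : ℝ), y₀) ∈ W := hyW t t.2
        have h4 : (fun p => (f p).1) =ᶠ[𝓝 ((t : ℝ), y₀)] fun p => (moserField a b h p).1 := by
          filter_upwards [hW.mem_nhds h3] with p hp
          rw [(hfW p hp).2]
        have hg := (hfW _ h3).1
        have h5 : HasFDerivAt (moserField a b h) _ ((t : ℝ), y₀) := ((contDiffAt_moserField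
          hg.smooth_a hg.smooth_b hg.smooth_h hg.invertible).differentiableAt
            (by simp)).hasFDerivAt
        have h6 : A t = spaceDeriv (fun p => (f p).1) ((t : ℝ), y₀) := by
          rw [hA, hΨ₀]
          rfl
        rw [h6, spaceDeriv, h4.fderiv_eq, h5.fst.fderiv]
        rfl
      rw [h2]
      exact h1
    have hT0 : ∀ t, ∀ w ∈ T, A t w = 0 := by
      intro t w hw
      have h1 := hAt t w
      rw [hT w hw, neg_zero, Prod.mk_zero_zero] at h1
      have h2 := (hfW _ (hyW t t.2)).1.invertible.injective (h1.trans (map_zero _).symm)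
      exact (Prod.mk_eq_zero.1 h2).1
    have hVT : ∀ t, ∀ w ∈ V, A t w ∈ T := by
      intro t w hw
      have h1 := Prod.mk.inj (hAt t w)
      refine hV t t.2 w hw _ h1.2 fun v hv => ?_
      have h2 := congrArg (fun B : E →L[ℝ] ℝ => B v) h1.1
      simpa [hv] using h2
    have hmem : ∀ t ∈ Icc (0 : ℝ) 1,
        ∫ s in (0 : ℝ)..t, extendPath (applyPath A (constPath v)) s ∈ T := fun t ht =>
      intervalIntegral_mem_submodule T (continuous_extendPath _) (fun s hs => by
        rw [extendPath_of_mem _ hs]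
        exact hVT _ v hv) ht
    obtain ⟨u, hu⟩ := isUnit_one_sub_volterra A
    -- Since A_s v lies in T and A_t vanishes on T, the Volterra series for the linearised flow
    -- stops after one term: v + ∫ A_s v ds is the exact solution, and it differs from v by an
    -- element of T.
    have hsolv : (1 - volterra A) (constPath v + integratePath (applyPath A (constPath v))) =
        (1 - volterra A) (fderiv ℝ Ψ y₀ v) := by
      have h1 : (1 - volterra A) (fderiv ℝ Ψ y₀ v) = constPath v :=
        sub_eq_iff_eq_add.2 (hvar.self_of_nhds.2 v)
      have h2 : applyPath A (integratePath (applyPath A (constPath v))) = 0 := by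
        ext t
        rw [applyPath_apply, integratePath_apply]
        exact hT0 t _ (hmem t t.2)
      have h3 : volterra A (constPath v + integratePath (applyPath A (constPath v))) =
          integratePath (applyPath A (constPath v)) := by
        rw [volterra, ContinuousLinearMap.comp_apply, map_add, h2, add_zero]
      rw [h1]
      refine (sub_apply _ _ _).trans ?_
      rw [h3]
      exact add_sub_cancel_right _ _
    have hinj : Function.Injective
        (1 - volterra A : C(Icc (0 : ℝ) 1, E) →L[ℝ] C(Icc (0 : ℝ) 1, E)) := by
      rw [← hu]
      exact (ContinuousLinearEquiv.unitsEquiv ℝ _ u).injective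
    rw [hdev.self_of_nhds, ← hinj hsolv, extendPath_constPath_add_integratePath _ _ hone,
      add_sub_cancel_left]
    exact hmem 1 hone

end MoserFlow

/-! ### Maps, derivatives and 1-forms in the preferred charts of manifolds -/

section Coordinates

variable {k m l : ℕ}
  {L : Type*} [TopologicalSpace L] [ChartedSpace (EuclideanSpace ℝ (Fin k)) L]
  {M : Type*} [TopologicalSpace M] [ChartedSpace (EuclideanSpace ℝ (Fin m)) M]
  {N : Type*} [TopologicalSpace N] [ChartedSpace (EuclideanSpace ℝ (Fin l)) N]

/-- The map `f` in the preferred charts around `p` and `q`. -/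
def coord (k m : ℕ) {L M : Type*} [TopologicalSpace L] [ChartedSpace (EuclideanSpace ℝ (Fin k)) L]
    [TopologicalSpace M] [ChartedSpace (EuclideanSpace ℝ (Fin m)) M] (p : L) (q : M) (f : L → M) :
    EuclideanSpace ℝ (Fin k) → EuclideanSpace ℝ (Fin m) :=
  extChartAt (𝓡 m) q ∘ f ∘ (extChartAt (𝓡 k) p).symm

theorem coord_apply (p : L) (q : M) (f : L → M) (y : EuclideanSpace ℝ (Fin k)) :
    coord k m p q f y = extChartAt (𝓡 m) q (f ((extChartAt (𝓡 k) p).symm y)) := rfl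

theorem coord_extChartAt {p x : L} (hx : x ∈ (extChartAt (𝓡 k) p).source) (q : M) (f : L → M) :
    coord k m p q f (extChartAt (𝓡 k) p x) = extChartAt (𝓡 m) q (f x) := by
  rw [coord_apply, (extChartAt (𝓡 k) p).left_inv hx]

theorem continuousAt_extChartAt_symm_of_mem {p x : L} (hx : x ∈ (extChartAt (𝓡 k) p).source) :
    Tendsto (extChartAt (𝓡 k) p).symm (𝓝 (extChartAt (𝓡 k) p x)) (𝓝 x) := by
  have := continuousAt_extChartAt_symm' (I := 𝓡 k) hx
  rwa [ContinuousAt, (extChartAt (𝓡 k) p).left_inv hx] at this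

/-- A property holds near `x` if and only if it holds near `x` in a chart. -/
theorem eventually_extChartAt_symm_iff {p x : L} (hx : x ∈ (extChartAt (𝓡 k) p).source)
    {P : L → Prop} : (∀ᶠ y in 𝓝 (extChartAt (𝓡 k) p x), P ((extChartAt (𝓡 k) p).symm y)) ↔
      ∀ᶠ z in 𝓝 x, P z := by
  refine ⟨fun h => ?_, fun h => (continuousAt_extChartAt_symm_of_mem hx).eventually h⟩
  filter_upwards [(continuousAt_extChartAt' (I := 𝓡 k) hx).eventually h,
    extChartAt_source_mem_nhds' (I := 𝓡 k) hx] with z hz hzs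
  rwa [(extChartAt (𝓡 k) p).left_inv hzs] at hz

theorem eventually_extChartAt_iff {p x : L} (hx : x ∈ (extChartAt (𝓡 k) p).source)
    {P : EuclideanSpace ℝ (Fin k) → Prop} :
    (∀ᶠ y in 𝓝 (extChartAt (𝓡 k) p x), P y) ↔ ∀ᶠ z in 𝓝 x, P (extChartAt (𝓡 k) p z) := by
  rw [← eventually_extChartAt_symm_iff hx]
  refine eventually_congr ?_
  filter_upwards [extChartAt_target_mem_nhds' (I := 𝓡 k)
    ((extChartAt (𝓡 k) p).map_source hx)] with y hy
  rw [(extChartAt (𝓡 k) p).right_inv hy]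

theorem coord_comp_eventuallyEq {p x : L} (hx : x ∈ (extChartAt (𝓡 k) p).source) {q : M}
    {f : L → M} (hf : ContinuousAt f x) (hq : f x ∈ (extChartAt (𝓡 m) q).source) (r : N)
    (g : M → N) :
    coord k l p r (g ∘ f) =ᶠ[𝓝 (extChartAt (𝓡 k) p x)] coord m l q r g ∘ coord k m p q f := by
  have h1 : ∀ᶠ z in 𝓝 x, f z ∈ (extChartAt (𝓡 m) q).source :=
    hf.eventually (extChartAt_source_mem_nhds' hq)
  filter_upwards [(eventually_extChartAt_symm_iff hx).2 h1] with y hy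
  rw [Function.comp_apply, coord_apply, coord_apply, coord_apply, (extChartAt (𝓡 m) q).left_inv hy]
  rfl

variable [IsManifold (𝓡 k) ∞ L] [IsManifold (𝓡 m) ∞ M] [IsManifold (𝓡 l) ∞ N]

theorem contMDiffAt_iff_coord {p x : L} (hx : x ∈ (extChartAt (𝓡 k) p).source) {q : M} {f : L → M}
    (hq : f x ∈ (extChartAt (𝓡 m) q).source) : ContMDiffAt (𝓡 k) (𝓡 m) ∞ f x ↔
      ContinuousAt f x ∧ ContDiffAt ℝ ∞ (coord k m p q f) (extChartAt (𝓡 k) p x) := by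
  rw [extChartAt_source] at hx hq
  rw [contMDiffAt_iff_of_mem_source hx hq, ModelWithCorners.range_eq_univ, contDiffWithinAt_univ]
  rfl

theorem contDiffAt_coord {p x : L} (hx : x ∈ (extChartAt (𝓡 k) p).source) {q : M} {f : L → M}
    (hq : f x ∈ (extChartAt (𝓡 m) q).source) (hf : ContMDiffAt (𝓡 k) (𝓡 m) ∞ f x) :
    ContDiffAt ℝ ∞ (coord k m p q f) (extChartAt (𝓡 k) p x) :=
  ((contMDiffAt_iff_coord hx hq).1 hf).2

theorem fderiv_coord_comp {p x : L} (hx : x ∈ (extChartAt (𝓡 k) p).source) {q : M} {f : L → M}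
    (hq : f x ∈ (extChartAt (𝓡 m) q).source) {r : N} {g : M → N}
    (hr : g (f x) ∈ (extChartAt (𝓡 l) r).source) (hf : ContMDiffAt (𝓡 k) (𝓡 m) ∞ f x)
    (hg : ContMDiffAt (𝓡 m) (𝓡 l) ∞ g (f x)) :
    fderiv ℝ (coord k l p r (g ∘ f)) (extChartAt (𝓡 k) p x) =
      (fderiv ℝ (coord m l q r g) (extChartAt (𝓡 m) q (f x))).comp
        (fderiv ℝ (coord k m p q f) (extChartAt (𝓡 k) p x)) := by
  rw [(coord_comp_eventuallyEq hx hf.continuousAt hq r g).fderiv_eq]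
  have h1 := (contDiffAt_coord hx hq hf).differentiableAt (by simp)
  have h2 := (contDiffAt_coord hq hr hg).differentiableAt (by simp)
  rw [← coord_extChartAt hx q f] at h2 ⊢
  exact fderiv_comp _ h2 h1

/-- The derivative of the coordinate change between the preferred charts around `p` and `q`, at
`x`. -/
def tr (k : ℕ) {L : Type*} [TopologicalSpace L] [ChartedSpace (EuclideanSpace ℝ (Fin k)) L]
    (p q x : L) : EuclideanSpace ℝ (Fin k) →L[ℝ] EuclideanSpace ℝ (Fin k) :=
  fderiv ℝ (coord k k p q id) (extChartAt (𝓡 k) p x)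

theorem tr_comp {p q r x : L} (hp : x ∈ (extChartAt (𝓡 k) p).source)
    (hq : x ∈ (extChartAt (𝓡 k) q).source) (hr : x ∈ (extChartAt (𝓡 k) r).source) :
    (tr k q r x).comp (tr k p q x) = tr k p r x :=
  (fderiv_coord_comp (f := id) (g := id) hp hq hr contMDiffAt_id contMDiffAt_id).symm

theorem tr_self {p x : L} (hp : x ∈ (extChartAt (𝓡 k) p).source) :
    tr k p p x = ContinuousLinearMap.id ℝ _ := by
  have : coord k k p p (id : L → L) =ᶠ[𝓝 (extChartAt (𝓡 k) p x)] id := by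
    filter_upwards [extChartAt_target_mem_nhds' (I := 𝓡 k)
      ((extChartAt (𝓡 k) p).map_source hp)] with y hy
    exact (extChartAt (𝓡 k) p).right_inv hy
  rw [tr, this.fderiv_eq, fderiv_id]

theorem tr_tr {p q x : L} (hp : x ∈ (extChartAt (𝓡 k) p).source)
    (hq : x ∈ (extChartAt (𝓡 k) q).source) (v) : tr k q p x (tr k p q x v) = v := by
  have := congrArg (fun B => B v) ((tr_comp hp hq hp).trans (tr_self hp))
  exact this

/-- The derivative of a map, as a linear map between the model spaces. -/
def mfd (k m : ℕ) {L M : Type*} [TopologicalSpace L] [ChartedSpace (EuclideanSpace ℝ (Fin k)) L]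
    [TopologicalSpace M] [ChartedSpace (EuclideanSpace ℝ (Fin m)) M] (f : L → M) (x : L) :
    EuclideanSpace ℝ (Fin k) →L[ℝ] EuclideanSpace ℝ (Fin m) :=
  mfderiv (𝓡 k) (𝓡 m) f x

/-- The derivative of a map, in the preferred charts around `x` and `f x`. -/
theorem mfd_eq_fderiv_coord {f : L → M} {x : L} (hf : MDifferentiableAt (𝓡 k) (𝓡 m) f x) :
    mfd k m f x = fderiv ℝ (coord k m x (f x) f) (extChartAt (𝓡 k) x x) := by
  refine hf.mfderiv.trans ?_
  rw [ModelWithCorners.range_eq_univ, fderivWithin_univ]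
  rfl

/-- Chain rule for f = id ∘ f ∘ id. The manifold derivative is taken in the preferred charts at `x`
and `f x`; any other charts contribute transition derivatives `tr` on either side. -/
theorem fderiv_coord_eq {p x : L} (hx : x ∈ (extChartAt (𝓡 k) p).source) {q : M} {f : L → M}
    (hq : f x ∈ (extChartAt (𝓡 m) q).source) (hf : ContMDiffAt (𝓡 k) (𝓡 m) ∞ f x) :
    fderiv ℝ (coord k m p q f) (extChartAt (𝓡 k) p x) =
      (tr m (f x) q (f x)).comp ((mfd k m f x).comp (tr k p x x)) := by
  have hxx := mem_extChartAt_source (I := 𝓡 k) x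
  have hff := mem_extChartAt_source (I := 𝓡 m) (f x)
  rw [mfd_eq_fderiv_coord (hf.mdifferentiableAt (by simp))]
  have h1 := fderiv_coord_comp (f := id) (g := f) hx hxx hq contMDiffAt_id hf
  have h2 := fderiv_coord_comp (f := f) (g := id) hxx hff hq hf contMDiffAt_id
  rw [show f ∘ id = id ∘ f from rfl] at h1
  exact h1.trans (congrArg (fun B => B.comp (tr k p x x)) h2)

theorem mfd_comp {f : L → M} {g : M → N} {x : L} (hf : ContMDiffAt (𝓡 k) (𝓡 m) ∞ f x)
    (hg : ContMDiffAt (𝓡 m) (𝓡 l) ∞ g (f x)) :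
    mfd k l (g ∘ f) x = (mfd m l g (f x)).comp (mfd k m f x) :=
  mfderiv_comp x (hg.mdifferentiableAt (by simp)) (hf.mdifferentiableAt (by simp))

theorem mfd_congr {f g : L → M} {x : L} (h : f =ᶠ[𝓝 x] g) : mfd k m f x = mfd k m g x :=
  h.mfderiv_eq

theorem mfderiv_extChartAt_symm_eq {p x : L} (hx : x ∈ (extChartAt (𝓡 k) p).source) :
    mfderiv 𝓘(ℝ, EuclideanSpace ℝ (Fin k)) (𝓡 k) (extChartAt (𝓡 k) p).symm
      (extChartAt (𝓡 k) p x) = tr k p x x := by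
  have h1 : ContMDiffAt 𝓘(ℝ, EuclideanSpace ℝ (Fin k)) (𝓡 k) ∞ (extChartAt (𝓡 k) p).symm
      (extChartAt (𝓡 k) p x) :=
    (contMDiffOn_extChartAt_symm p).contMDiffAt
      (extChartAt_target_mem_nhds' ((extChartAt (𝓡 k) p).map_source hx))
  refine (h1.mdifferentiableAt (by simp)).mfderiv.trans ?_
  simp only [ModelWithCorners.range_eq_univ, fderivWithin_univ, writtenInExtChartAt,
    extChartAt_model_space_eq_id, PartialEquiv.refl_symm, PartialEquiv.refl_coe, id]
  rw [(extChartAt (𝓡 k) p).left_inv hx]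
  rfl

/-- A `1`-form as a map to the dual of the model space. -/
def OneForm.val (α : OneForm m M) (p : M) : EuclideanSpace ℝ (Fin m) →L[ℝ] ℝ := α p

theorem chartForm_eq {α : OneForm m M} {p x : M} (hx : x ∈ (extChartAt (𝓡 m) p).source) :
    chartForm α p (extChartAt (𝓡 m) p x) = (α.val x).comp (tr m p x x) := by
  rw [← mfderiv_extChartAt_symm_eq hx]
  change ((α.val ((extChartAt (𝓡 m) p).symm (extChartAt (𝓡 m) p x))).comp _) = _
  rw [(extChartAt (𝓡 m) p).left_inv hx]

theorem chartForm_self (α : OneForm m M) (x : M) :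
    chartForm α x (extChartAt (𝓡 m) x x) = α.val x := by
  rw [chartForm_eq (mem_extChartAt_source x), tr_self (mem_extChartAt_source x),
    ContinuousLinearMap.comp_id]

/-- Tangent vectors at `x` are identified with model vectors by the preferred chart at `x`, so the
derivative of that chart at `x` is the identity. -/
theorem extD_eq_dOne (α : OneForm m M) (x : M) (u v : EuclideanSpace ℝ (Fin m)) :
    extD α x u v = dOne (chartForm α x) (extChartAt (𝓡 m) x x) u v := by
  have h1 : (mfderiv (𝓡 m) 𝓘(ℝ, EuclideanSpace ℝ (Fin m)) (extChartAt (𝓡 m) x) x :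
      EuclideanSpace ℝ (Fin m) →L[ℝ] EuclideanSpace ℝ (Fin m)) = tr m x x x := by
    have h2 : ContMDiffAt (𝓡 m) 𝓘(ℝ, EuclideanSpace ℝ (Fin m)) ∞ (extChartAt (𝓡 m) x) x :=
      contMDiffAt_extChartAt
    refine (h2.mdifferentiableAt (by simp)).mfderiv.trans ?_
    simp only [ModelWithCorners.range_eq_univ, fderivWithin_univ, writtenInExtChartAt,
      extChartAt_model_space_eq_id]
    rfl
  rw [tr_self (mem_extChartAt_source x)] at h1
  have h3 : ∀ w : EuclideanSpace ℝ (Fin m), (mfderiv (𝓡 m) 𝓘(ℝ, EuclideanSpace ℝ (Fin m))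
      (extChartAt (𝓡 m) x) x : EuclideanSpace ℝ (Fin m) →L[ℝ] EuclideanSpace ℝ (Fin m)) w = w :=
    fun w => by rw [h1]; rfl
  rw [dOne_apply]
  conv_rhs => rw [← h3 u, ← h3 v]
  rfl

/-- The pullback of a `1`-form. -/
def pullback (f : L → M) (α : OneForm m M) : OneForm k L :=
  fun x => (α.val (f x)).comp (mfd k m f x)

theorem pullback_val (f : L → M) (α : OneForm m M) (x : L) :
    (pullback f α : OneForm k L).val x = (α.val (f x)).comp (mfd k m f x) := rfl

/-- Pullback in charts. -/
theorem chartForm_pullback {p x : L} (hx : x ∈ (extChartAt (𝓡 k) p).source) {q : M} {f : L → M}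
    (hq : f x ∈ (extChartAt (𝓡 m) q).source) (hf : ContMDiffAt (𝓡 k) (𝓡 m) ∞ f x)
    (α : OneForm m M) : chartForm (pullback f α : OneForm k L) p (extChartAt (𝓡 k) p x) =
      (chartForm α q (coord k m p q f (extChartAt (𝓡 k) p x))).comp
        (fderiv ℝ (coord k m p q f) (extChartAt (𝓡 k) p x)) := by
  rw [coord_extChartAt hx, chartForm_eq hx, chartForm_eq hq, fderiv_coord_eq hx hq hf, pullback_val]
  have h1 := tr_comp (mem_extChartAt_source (I := 𝓡 m) (f x)) hq
    (mem_extChartAt_source (I := 𝓡 m) (f x))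
  rw [tr_self (mem_extChartAt_source (f x))] at h1
  ext v
  have h2 := congrArg (fun B => B (mfd k m f x (tr k p x x v))) h1
  simp only [ContinuousLinearMap.comp_apply, ContinuousLinearMap.id_apply] at h2 ⊢
  rw [h2]

theorem pullback_id (α : OneForm m M) : (pullback id α : OneForm m M) = α := by
  funext x
  have : mfd m m (id : M → M) x = ContinuousLinearMap.id ℝ _ := mfderiv_id
  change (α.val x).comp (mfd m m (id : M → M) x) = α.val x
  rw [this, ContinuousLinearMap.comp_id]

/-- Smoothness of a `1`-form at a point, in a chart around the point. -/
def FormSmoothAt (α : OneForm m M) (x : M) : Prop :=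
  ∀ p, x ∈ (extChartAt (𝓡 m) p).source →
    ContDiffAt ℝ ∞ (chartForm α p) (extChartAt (𝓡 m) p x)

theorem contDiffAt_comp_fderiv {E F : Type} [NormedAddCommGroup E] [NormedSpace ℝ E]
    [NormedAddCommGroup F] [NormedSpace ℝ F] {a : F → F →L[ℝ] ℝ} {g : E → F} {y : E}
    (ha : ContDiffAt ℝ ∞ a (g y)) (hg : ContDiffAt ℝ ∞ g y) :
    ContDiffAt ℝ ∞ (fun z => (a (g z)).comp (fderiv ℝ g z)) y :=
  (ha.comp y hg).clm_comp (contDiffAt_fderiv hg)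

theorem formSmoothAt_pullback {f : L → M} {α : OneForm m M} {x : L}
    (hf : ∀ᶠ z in 𝓝 x, ContMDiffAt (𝓡 k) (𝓡 m) ∞ f z) {q : M}
    (hq : f x ∈ (extChartAt (𝓡 m) q).source)
    (hα : ContDiffAt ℝ ∞ (chartForm α q) (extChartAt (𝓡 m) q (f x))) :
    FormSmoothAt (pullback f α : OneForm k L) x := by
  intro p hp
  have h1 := contDiffAt_comp_fderiv (a := chartForm α q) (g := coord k m p q f)
    (y := extChartAt (𝓡 k) p x) (by rwa [coord_extChartAt hp])
    (contDiffAt_coord hp hq hf.self_of_nhds)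
  refine h1.congr_of_eventuallyEq ((eventually_extChartAt_iff hp).2 ?_)
  filter_upwards [hf, extChartAt_source_mem_nhds' (I := 𝓡 k) hp,
    hf.self_of_nhds.continuousAt.eventually (extChartAt_source_mem_nhds' (I := 𝓡 m) hq)]
    with z hz hzp hzq
  exact chartForm_pullback hzp hzq hz α

/-- Pullback along the identity is change of charts, so smoothness in one chart gives smoothness in
all. -/
theorem formSmoothAt_of_chart {α : OneForm m M} {q x : M} (hq : x ∈ (extChartAt (𝓡 m) q).source)
    (hα : ContDiffAt ℝ ∞ (chartForm α q) (extChartAt (𝓡 m) q x)) : FormSmoothAt α x := by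
  have := formSmoothAt_pullback (f := (id : M → M)) (α := α) (x := x)
    (Eventually.of_forall fun _ => contMDiffAt_id) hq hα
  rwa [pullback_id] at this

/-- In the trivialisation of the cotangent bundle around `x` the section is α composed with the
derivative of the inverse chart, which is precisely `chartForm`. -/
theorem IsSmoothOneForm.formSmoothAt {α : OneForm m M} (hα : IsSmoothOneForm α) (x : M) :
    FormSmoothAt α x := by
  refine formSmoothAt_of_chart (mem_extChartAt_source x) ?_
  have h1 := ((contMDiffAt_hom_bundle _).1 (hα x)).2
  have h2 := h1.comp_of_eq (I := 𝓘(ℝ, EuclideanSpace ℝ (Fin m))) (f := (extChartAt (𝓡 m) x).symm)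
    (x := extChartAt (𝓡 m) x x)
    ((contMDiffOn_extChartAt_symm x).contMDiffAt (extChartAt_target_mem_nhds x))
    (extChartAt_to_inv x)
  refine h2.contDiffAt.congr_of_eventuallyEq ?_
  rw [EventuallyEq, eventually_extChartAt_iff (mem_extChartAt_source x)]
  filter_upwards [extChartAt_source_mem_nhds (I := 𝓡 m) x] with z hz
  rw [Function.comp_apply, (extChartAt (𝓡 m) x).left_inv hz, chartForm_eq hz,
    ← mfderiv_extChartAt_symm_eq hz]
  have hz' := hz
  rw [extChartAt_source] at hz'
  have h3 := TangentBundle.symmL_trivializationAt (I := 𝓡 m) (𝕜 := ℝ) hz'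
  rw [ContinuousLinearMap.inCoordinates]
  have h4 : (Bundle.Trivialization.symmL ℝ (trivializationAt (EuclideanSpace ℝ (Fin m))
      (TangentSpace (𝓡 m)) x) z) = mfderiv 𝓘(ℝ, EuclideanSpace ℝ (Fin m)) (𝓡 m)
      (extChartAt (𝓡 m) x).symm (extChartAt (𝓡 m) x z) := by
    rw [h3, ModelWithCorners.range_eq_univ, mfderivWithin_univ]
  ext v
  rw [h4]
  have h5 : ((trivializationAt ℝ (Bundle.Trivial M ℝ) x).continuousLinearMapAt ℝ z) =
      ContinuousLinearMap.id ℝ ℝ := Bundle.Trivial.continuousLinearMapAt_trivialization ℝ M ℝ z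
  rw [h5]
  rfl

end Coordinates

/-! ### Naturality of the exterior derivative and of the Moser field under pullback -/

section Naturality

variable {E F : Type} [NormedAddCommGroup E] [NormedSpace ℝ E] [NormedAddCommGroup F]
  [NormedSpace ℝ F]

/-- The pullback of a `1`-form on a vector space. -/
def pull (g : E → F) (a : F → F →L[ℝ] ℝ) (y : E) : E →L[ℝ] ℝ := (a (g y)).comp (fderiv ℝ g y)

variable {g : E → F} {a b : E → E →L[ℝ] ℝ} {a' b' : F → F →L[ℝ] ℝ} {h : E → ℝ} {h' : F → ℝ} {y : E}

theorem fderiv_pull (hg : ContDiffAt ℝ ∞ g y) (ha : DifferentiableAt ℝ a' (g y)) (u v : E) :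
    fderiv ℝ (pull g a') y u v = fderiv ℝ a' (g y) (fderiv ℝ g y u) (fderiv ℝ g y v) +
      a' (g y) (fderiv ℝ (fderiv ℝ g) y u v) := by
  have h1 : HasFDerivAt (fun z => a' (g z)) _ y :=
    ha.hasFDerivAt.comp y (hg.differentiableAt (by simp)).hasFDerivAt
  have h2 := h1.clm_comp ((contDiffAt_fderiv hg).differentiableAt (by simp)).hasFDerivAt
  have h3 : fderiv ℝ (pull g a') y = _ := h2.fderiv
  rw [h3]
  simp [add_comm]

theorem two_le_infty : (2 : WithTop ℕ∞) ≤ ∞ :=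
  WithTop.coe_le_coe.2 (le_top : (2 : ℕ∞) ≤ ⊤)

/-- The term containing the second derivative of `g` is symmetric, so antisymmetrisation removes it.
-/
theorem dOne_pull (hg : ContDiffAt ℝ ∞ g y) (ha : DifferentiableAt ℝ a' (g y)) (u v : E) :
    dOne (pull g a') y u v = dOne a' (g y) (fderiv ℝ g y u) (fderiv ℝ g y v) := by
  have h1 : fderiv ℝ (fderiv ℝ g) y u v = fderiv ℝ (fderiv ℝ g) y v u :=
    hg.isSymmSndFDerivAt (by simpa using two_le_infty) u v
  rw [dOne_apply, dOne_apply, fderiv_pull hg ha, fderiv_pull hg ha, h1]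
  ring

theorem dOne_congr {a₂ : E → E →L[ℝ] ℝ} (h : a =ᶠ[𝓝 y] a₂) : dOne a y = dOne a₂ y := by
  rw [dOne, dOne, h.fderiv_eq]

theorem addD_pull (hg : DifferentiableAt ℝ g y) (hh : DifferentiableAt ℝ h' (g y)) :
    addD (pull g b') (h' ∘ g) y = pull g (addD b' h') y := by
  rw [addD, fderiv_comp y hh hg]
  rfl

/-- The Moser field is natural. -/
theorem moserField_pull {t : ℝ} (hg : ContDiffAt ℝ ∞ g y)
    (hsurj : Function.Surjective (fderiv ℝ g y)) (ha : a =ᶠ[𝓝 y] pull g a')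
    (hb : b =ᶠ[𝓝 y] pull g b') (hh : h =ᶠ[𝓝 y] h' ∘ g) (h1 : MoserGood a b h (t, y))
    (h2 : MoserGood a' b' h' (t, g y)) :
    (moserField a' b' h' (t, g y)).1 = fderiv ℝ g y (moserField a b h (t, y)).1 := by
  set z := moserField a b h (t, y) with hz
  -- By uniqueness for the linear system downstairs it suffices that the pushed-forward pair solves
  -- it; surjectivity of the derivative lets every test vector be lifted.
  suffices moserField a' b' h' (t, g y) = (fderiv ℝ g y z.1, z.2) by rw [this]
  rw [moserField_eq_iff h2.invertible]
  have da := h2.smooth_a.differentiableAt (n := ∞) (by simp)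
  have db := h2.smooth_b.differentiableAt (n := ∞) (by simp)
  have dh := h2.smooth_h.differentiableAt (n := ∞) (by simp)
  have pf : ∀ v, pathForm a b (t, y) v = pathForm a' b' (t, g y) (fderiv ℝ g y v) := fun v => by
    simp only [pathForm, ha.self_of_nhds, hb.self_of_nhds]
    rfl
  have pd : ∀ u v, pathD a b (t, y) u v =
      pathD a' b' (t, g y) (fderiv ℝ g y u) (fderiv ℝ g y v) := fun u v => by
    simp only [pathD, dOne_congr ha, dOne_congr hb, add_apply, smul_apply]
    rw [dOne_pull hg da, dOne_pull hg db]
  have pa : ∀ v, addD b h y v = addD b' h' (g y) (fderiv ℝ g y v) := fun v => by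
    have h3 : addD b h y = addD (pull g b') (h' ∘ g) y := by
      rw [addD, addD, hh.fderiv_eq, hb.self_of_nhds]
    rw [h3, addD_pull (hg.differentiableAt (by simp)) dh]
    rfl
  refine Prod.ext (ContinuousLinearMap.ext fun w => ?_) ?_
  · obtain ⟨v, rfl⟩ := hsurj w
    have h3 := pathD_moserField h1 v
    rw [← hz, pf, pd] at h3
    have h4 := pa v
    simp only [pathSystem, contactSystem_apply, moserRHS, sub_apply, smul_apply, neg_apply,
      smul_eq_mul]
    change _ + addD b h y v = _ at h3
    rw [h4] at h3
    linarith
  · have h3 := pathForm_moserField h1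
    rw [← hz, pf] at h3
    change _ = h' (g y)
    refine h3.trans ?_
    exact hh.self_of_nhds

end Naturality

/-! ### Change of charts for 1-forms and their exterior derivatives -/

section Charts

variable {k m : ℕ}
  {L : Type*} [TopologicalSpace L] [ChartedSpace (EuclideanSpace ℝ (Fin k)) L]
  {M : Type*} [TopologicalSpace M] [ChartedSpace (EuclideanSpace ℝ (Fin m)) M]
  [IsManifold (𝓡 k) ∞ L] [IsManifold (𝓡 m) ∞ M]

theorem chartForm_pullback_eventuallyEq {p x : L} (hx : x ∈ (extChartAt (𝓡 k) p).source) {q : M}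
    {f : L → M} (hq : f x ∈ (extChartAt (𝓡 m) q).source)
    (hf : ∀ᶠ z in 𝓝 x, ContMDiffAt (𝓡 k) (𝓡 m) ∞ f z) (α : OneForm m M) :
    chartForm (pullback f α : OneForm k L) p =ᶠ[𝓝 (extChartAt (𝓡 k) p x)]
      pull (coord k m p q f) (chartForm α q) := by
  refine (eventually_extChartAt_iff hx).2 ?_
  filter_upwards [hf, extChartAt_source_mem_nhds' (I := 𝓡 k) hx,
    hf.self_of_nhds.continuousAt.eventually (extChartAt_source_mem_nhds' (I := 𝓡 m) hq)]
    with z hz hzp hzq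
  exact chartForm_pullback hzp hzq hz α

theorem chartForm_eventuallyEq {p q x : M} (hp : x ∈ (extChartAt (𝓡 m) p).source)
    (hq : x ∈ (extChartAt (𝓡 m) q).source) (α : OneForm m M) :
    chartForm α p =ᶠ[𝓝 (extChartAt (𝓡 m) p x)] pull (coord m m p q id) (chartForm α q) := by
  have := chartForm_pullback_eventuallyEq (f := (id : M → M)) hp hq
    (Eventually.of_forall fun _ => contMDiffAt_id) α
  rwa [pullback_id] at this

theorem extD_pullback {f : L → M} {α : OneForm m M} {x : L}
    (hf : ∀ᶠ z in 𝓝 x, ContMDiffAt (𝓡 k) (𝓡 m) ∞ f z) (hα : FormSmoothAt α (f x))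
    (u v : EuclideanSpace ℝ (Fin k)) : extD (pullback f α : OneForm k L) x u v =
      extD α (f x) (mfd k m f x u) (mfd k m f x v) := by
  have hx := mem_extChartAt_source (I := 𝓡 k) x
  have hq := mem_extChartAt_source (I := 𝓡 m) (f x)
  have h1 := contDiffAt_coord hx hq hf.self_of_nhds
  refine (extD_eq_dOne _ x u v).trans ?_
  rw [dOne_congr (chartForm_pullback_eventuallyEq hx hq hf α), dOne_pull h1, coord_extChartAt hx,
    ← mfd_eq_fderiv_coord (hf.self_of_nhds.mdifferentiableAt (by simp))]
  · exact (extD_eq_dOne _ _ _ _).symm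
  · rw [coord_extChartAt hx]
    exact (hα _ hq).differentiableAt (by simp)

theorem tr_surjective {p q x : M} (hp : x ∈ (extChartAt (𝓡 m) p).source)
    (hq : x ∈ (extChartAt (𝓡 m) q).source) : Function.Surjective (tr m p q x) :=
  fun v => ⟨tr m q p x v, tr_tr hq hp v⟩

end Charts

/-! ### Moser's method on a manifold: local flows and their agreement -/

section MoserMap

variable {m : ℕ} {M : Type*} [TopologicalSpace M] [ChartedSpace (EuclideanSpace ℝ (Fin m)) M]
  [IsManifold (𝓡 m) ∞ M]

/-- A function in the preferred chart around `p`. -/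
def chartFun (m : ℕ) {M : Type*} [TopologicalSpace M] [ChartedSpace (EuclideanSpace ℝ (Fin m)) M]
    (H : M → ℝ) (p : M) (y : EuclideanSpace ℝ (Fin m)) : ℝ := H ((extChartAt (𝓡 m) p).symm y)

theorem chartFun_eventuallyEq {p q x : M} (hp : x ∈ (extChartAt (𝓡 m) p).source)
    (hq : x ∈ (extChartAt (𝓡 m) q).source) (H : M → ℝ) :
    chartFun m H p =ᶠ[𝓝 (extChartAt (𝓡 m) p x)] chartFun m H q ∘ coord m m p q id := by
  refine (eventually_extChartAt_iff hp).2 ?_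
  filter_upwards [extChartAt_source_mem_nhds' (I := 𝓡 m) hp,
    extChartAt_source_mem_nhds' (I := 𝓡 m) hq] with z hzp hzq
  rw [Function.comp_apply, coord_extChartAt hzp, chartFun, chartFun,
    (extChartAt (𝓡 m) p).left_inv hzp, id, (extChartAt (𝓡 m) q).left_inv hzq]

variable (α β : OneForm m M) (H : M → ℝ)

/-- The data of Moser's method are good at `(t, y)` in the preferred chart around `p`. -/
def ChartGood (p : M) (z : ℝ × EuclideanSpace ℝ (Fin m)) : Prop :=
  z.2 ∈ (extChartAt (𝓡 m) p).target ∧ MoserGood (chartForm α p) (chartForm β p) (chartFun m H p) z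

/-- The Moser field in the preferred chart around `p`. -/
def chartField (p : M) (z : ℝ × EuclideanSpace ℝ (Fin m)) : EuclideanSpace ℝ (Fin m) :=
  (moserField (chartForm α p) (chartForm β p) (chartFun m H p) z).1

variable {α β H}

/-- Naturality of the Moser field for the transition map. This lets integral curves found in
different charts be compared. -/
theorem chartField_change {p q x : M} {t : ℝ} (hp : x ∈ (extChartAt (𝓡 m) p).source)
    (hq : x ∈ (extChartAt (𝓡 m) q).source)
    (h1 : ChartGood α β H p (t, extChartAt (𝓡 m) p x))
    (h2 : ChartGood α β H q (t, extChartAt (𝓡 m) q x)) :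
    chartField α β H q (t, extChartAt (𝓡 m) q x) =
      tr m p q x (chartField α β H p (t, extChartAt (𝓡 m) p x)) := by
  have h3 := moserField_pull (t := t) (contDiffAt_coord (f := id) hp hq contMDiffAt_id)
    (tr_surjective hp hq) (chartForm_eventuallyEq hp hq α) (chartForm_eventuallyEq hp hq β)
    (chartFun_eventuallyEq hp hq H) h1.2 (by rw [coord_extChartAt hp]; exact h2.2)
  rw [coord_extChartAt hp] at h3
  exact h3

/-- `γ` is an integral curve of the Moser field which stays in the chart around `p`. -/
structure IsChartCurve (α β : OneForm m M) (H : M → ℝ) (p : M)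
    (γ : ℝ → EuclideanSpace ℝ (Fin m)) : Prop where
  good : ∀ t ∈ Icc (0 : ℝ) 1, ∀ᶠ z in 𝓝 (t, γ t), ChartGood α β H p z
  deriv : ∀ t ∈ Icc (0 : ℝ) 1, HasDerivWithinAt γ (chartField α β H p (t, γ t)) (Icc 0 1) t

theorem IsChartCurve.continuousOn {p : M} {γ : ℝ → EuclideanSpace ℝ (Fin m)}
    (hγ : IsChartCurve α β H p γ) : ContinuousOn γ (Icc 0 1) :=
  fun t ht => (hγ.deriv t ht).continuousWithinAt

theorem IsChartCurve.mem_target {p : M} {γ : ℝ → EuclideanSpace ℝ (Fin m)}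
    (hγ : IsChartCurve α β H p γ) {t : ℝ} (ht : t ∈ Icc (0 : ℝ) 1) :
    γ t ∈ (extChartAt (𝓡 m) p).target := (hγ.good t ht).self_of_nhds.1

theorem IsChartCurve.symm_continuousOn {p : M} {γ : ℝ → EuclideanSpace ℝ (Fin m)}
    (hγ : IsChartCurve α β H p γ) :
    ContinuousOn (fun t => (extChartAt (𝓡 m) p).symm (γ t)) (Icc 0 1) :=
  (continuousOn_extChartAt_symm p).comp hγ.continuousOn fun _ ht => hγ.mem_target ht

/-- The second curve is transported to the chart around `p`, where it solves the same equation for a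
short time. Both curves stay near a point where the field is Lipschitz, and uniqueness for ordinary
differential equations applies. -/
theorem IsChartCurve.eqOn_right {p q : M} {γ δ : ℝ → EuclideanSpace ℝ (Fin m)}
    (hγ : IsChartCurve α β H p γ) (hδ : IsChartCurve α β H q δ) {t : ℝ} (ht : t ∈ Ico (0 : ℝ) 1)
    (h : (extChartAt (𝓡 m) p).symm (γ t) = (extChartAt (𝓡 m) q).symm (δ t)) :
    ∃ s ∈ Ioc t 1, ∀ r ∈ Icc t s,
      (extChartAt (𝓡 m) p).symm (γ r) = (extChartAt (𝓡 m) q).symm (δ r) := by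
  have ht' : t ∈ Icc (0 : ℝ) 1 := ⟨ht.1, ht.2.le⟩
  set χp := extChartAt (𝓡 m) p
  set χq := extChartAt (𝓡 m) q
  set x := χp.symm (γ t) with hx
  have hxp : x ∈ χp.source := χp.map_target (hγ.mem_target ht')
  have hxq : x ∈ χq.source := by rw [h]; exact χq.map_target (hδ.mem_target ht')
  have hγx : γ t = χp x := (χp.right_inv (hγ.mem_target ht')).symm
  -- the field is locally Lipschitz in the chart around `p`
  have hcd : ContDiffAt ℝ ∞ (chartField α β H p) (t, γ t) := by
    have hg := (hγ.good t ht').self_of_nhds.2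
    exact contDiffAt_fst.comp _
      (contDiffAt_moserField hg.smooth_a hg.smooth_b hg.smooth_h hg.invertible)
  obtain ⟨K, U, hU, hK⟩ := ContDiffAt.exists_lipschitzOnWith (hcd.of_le (by simp))
  have hIcc : Icc (0 : ℝ) 1 ∈ 𝓝[≥] t := by
    filter_upwards [Icc_mem_nhdsGE ht.2] with r hr
    exact ⟨ht.1.trans hr.1, hr.2⟩
  have hcγ : Tendsto γ (𝓝[≥] t) (𝓝 (γ t)) :=
    ((hγ.continuousOn t ht').mono_of_mem_nhdsWithin hIcc)
  have hcδ : Tendsto (fun r => χq.symm (δ r)) (𝓝[≥] t) (𝓝 x) := by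
    have := ((hδ.symm_continuousOn t ht').mono_of_mem_nhdsWithin hIcc)
    rw [h]
    exact this
  have hcε : Tendsto (fun r => χp (χq.symm (δ r))) (𝓝[≥] t) (𝓝 (γ t)) := by
    rw [hγx]
    exact (continuousAt_extChartAt' (I := 𝓡 m) hxp).tendsto.comp hcδ
  have hid : Tendsto (fun r : ℝ => r) (𝓝[≥] t) (𝓝 t) := nhdsWithin_le_nhds
  have hall : ∀ᶠ r in 𝓝[≥] t, r ∈ Icc (0 : ℝ) 1 ∧ (r, γ r) ∈ U ∧ (r, χp (χq.symm (δ r))) ∈ U ∧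
      ChartGood α β H p (r, χp (χq.symm (δ r))) ∧ χq.symm (δ r) ∈ χp.source := by
    have h1 := (hid.prodMk_nhds hcγ).eventually hU
    have h2 := (hid.prodMk_nhds hcε).eventually hU
    have h3 := (hid.prodMk_nhds hcε).eventually (hγ.good t ht')
    have h4 := hcδ.eventually (extChartAt_source_mem_nhds' (I := 𝓡 m) hxp)
    filter_upwards [hIcc, h1, h2, h3, h4] with r h0 h1 h2 h3 h4
    exact ⟨h0, h1, h2, h3, h4⟩
  obtain ⟨s, hs, hsall⟩ := (mem_nhdsGE_iff_exists_Icc_subset).1 hall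
  have hs1 : s ≤ 1 := (hsall ⟨(mem_Ioi.1 hs).le, le_rfl⟩).1.2
  refine ⟨s, ⟨hs, hs1⟩, ?_⟩
  have hder : ∀ r ∈ Ico t s, HasDerivWithinAt (fun r => χp (χq.symm (δ r)))
      (chartField α β H p (r, χp (χq.symm (δ r)))) (Ici r) r := by
    intro r hr
    obtain ⟨h0, -, -, h3, h4⟩ := hsall ⟨hr.1, hr.2.le⟩
    have hrq : χq.symm (δ r) ∈ χq.source := χq.map_target (hδ.mem_target h0)
    have hδr : χq (χq.symm (δ r)) = δ r := χq.right_inv (hδ.mem_target h0)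
    have h5 := chartField_change (t := r) (α := α) (β := β) (H := H) hrq h4
      (by rw [hδr]; exact (hδ.good r h0).self_of_nhds) h3
    rw [hδr] at h5
    rw [h5]
    have h6 := (contDiffAt_coord (f := id) hrq h4 contMDiffAt_id).differentiableAt
      (by simp)
    have h7 : HasFDerivAt (coord m m q p id) (tr m q p (χq.symm (δ r))) (δ r) := by
      have := h6.hasFDerivAt
      rw [tr, hδr]
      rwa [hδr] at this
    have h8 := h7.comp_hasDerivWithinAt r (hδ.deriv r h0)
    refine h8.mono_of_mem_nhdsWithin ?_
    filter_upwards [Icc_mem_nhdsGE (hr.2.trans_le hs1)] with r' hr'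
    exact ⟨h0.1.trans hr'.1, hr'.2⟩
  have hEq := ODE_solution_unique_of_mem_Icc_right
    (v := fun r z => chartField α β H p (r, z)) (s := fun r => {z | (r, z) ∈ U}) (K := K)
    (f := γ) (g := fun r => χp (χq.symm (δ r))) (a := t) (b := s)
    (fun r _ => fun z hz w hw => by
      have := hK hz hw
      rwa [Prod.edist_eq, edist_self, max_eq_right (zero_le)] at this)
    (hγ.continuousOn.mono fun r hr => ⟨ht.1.trans hr.1, hr.2.trans hs1⟩)
    (fun r hr => by
      have h0 : r ∈ Icc (0 : ℝ) 1 := ⟨ht.1.trans hr.1, hr.2.le.trans hs1⟩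
      refine (hγ.deriv r h0).mono_of_mem_nhdsWithin ?_
      filter_upwards [Icc_mem_nhdsGE (hr.2.trans_le hs1)] with r' hr'
      exact ⟨h0.1.trans hr'.1, hr'.2⟩)
    (fun r hr => (hsall ⟨hr.1, hr.2.le⟩).2.1)
    (fun r hr => by
      obtain ⟨h0, -, -, -, h4⟩ := hsall hr
      have h5 : ContinuousWithinAt (fun r => χq.symm (δ r)) (Icc t s) r :=
        (hδ.symm_continuousOn r h0).mono fun r hr => ⟨ht.1.trans hr.1, hr.2.trans hs1⟩
      exact ContinuousAt.comp_continuousWithinAt (f := fun r => χq.symm (δ r))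
        (continuousAt_extChartAt' (I := 𝓡 m) h4) h5)
    hder (fun r hr => (hsall ⟨hr.1, hr.2.le⟩).2.2.1)
    (by rw [hγx, ← h])
  intro r hr
  rw [hEq hr, χp.left_inv (hsall hr).2.2.2.2]

/-- Integral curves of the Moser field are unique. -/
theorem IsChartCurve.eqOn [T2Space M] {p q : M} {γ δ : ℝ → EuclideanSpace ℝ (Fin m)}
    (hγ : IsChartCurve α β H p γ) (hδ : IsChartCurve α β H q δ)
    (h : (extChartAt (𝓡 m) p).symm (γ 0) = (extChartAt (𝓡 m) q).symm (δ 0)) :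
    (extChartAt (𝓡 m) p).symm (γ 1) = (extChartAt (𝓡 m) q).symm (δ 1) := by
  have hcl : IsClosed ({t | (extChartAt (𝓡 m) p).symm (γ t) = (extChartAt (𝓡 m) q).symm (δ t)} ∩
      Icc (0 : ℝ) 1) := by
    rw [inter_comm]
    exact (hγ.symm_continuousOn.prodMk hδ.symm_continuousOn).preimage_isClosed_of_isClosed
      isClosed_Icc isClosed_diagonal
  -- The set of times of agreement is closed, contains 0, and can be extended to the right from each
  -- of its points before time one; hence it is all of the unit interval.
  refine hcl.Icc_subset_of_forall_exists_gt h (fun t ht y hy => ?_) (right_mem_Icc.2 zero_le_one)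
  obtain ⟨s, hs, hall⟩ := hγ.eqOn_right hδ ht.2 ht.1
  exact ⟨min s y, hall _ ⟨le_min hs.1.le (mem_Ioi.1 hy).le, min_le_left _ _⟩,
    lt_min hs.1 hy, min_le_right _ _⟩

/-- The hypotheses of Moser's method at a point `p`. -/
structure MoserHyp (α β : OneForm m M) (H : M → ℝ) (p : M) : Prop where
  smooth_a : SmoothNear (chartForm α p) (extChartAt (𝓡 m) p p)
  smooth_b : SmoothNear (chartForm β p) (extChartAt (𝓡 m) p p)
  smooth_h : SmoothNear (chartFun m H p) (extChartAt (𝓡 m) p p)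
  invertible : ∀ t ∈ Icc (0 : ℝ) 1,
    (pathSystem (chartForm α p) (chartForm β p) (t, extChartAt (𝓡 m) p p)).IsInvertible
  addD_eq : addD (chartForm β p) (chartFun m H p) (extChartAt (𝓡 m) p p) = 0
  fun_eq : H p = 0
  fderiv_eq : fderiv ℝ (chartFun m H p) (extChartAt (𝓡 m) p p) = 0

theorem MoserHyp.exists_flow {p : M} (hp : MoserHyp α β H p) :
    (∀ t ∈ Icc (0 : ℝ) 1, ∀ᶠ z in 𝓝 (t, extChartAt (𝓡 m) p p), ChartGood α β H p z) ∧
    ∃ ψ, IsMoserFlow (chartForm α p) (chartForm β p) (chartFun m H p) (extChartAt (𝓡 m) p p) ψ := by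
  have hg : ∀ t ∈ Icc (0 : ℝ) 1, ∀ᶠ z in 𝓝 (t, extChartAt (𝓡 m) p p),
      MoserGood (chartForm α p) (chartForm β p) (chartFun m H p) z := fun t ht =>
    MoserGood.eventually hp.smooth_a hp.smooth_b hp.smooth_h (hp.invertible t ht)
  refine ⟨fun t ht => ?_, exists_isMoserFlow hg hp.addD_eq ?_ hp.fderiv_eq⟩
  · filter_upwards [hg t ht, continuous_snd.continuousAt.eventually
      (extChartAt_target_mem_nhds (I := 𝓡 m) p)] with z h1 h2
    exact ⟨h2, h1⟩
  · rw [chartFun, extChartAt_to_inv]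
    exact hp.fun_eq

/-- Near `p`, the flow of the Moser field in the chart around `p` gives integral curves. -/
theorem IsMoserFlow.eventually_isChartCurve {p : M}
    (hg : ∀ t ∈ Icc (0 : ℝ) 1, ∀ᶠ z in 𝓝 (t, extChartAt (𝓡 m) p p), ChartGood α β H p z)
    {ψ : EuclideanSpace ℝ (Fin m) → ℝ → EuclideanSpace ℝ (Fin m)}
    (hψ : IsMoserFlow (chartForm α p) (chartForm β p) (chartFun m H p) (extChartAt (𝓡 m) p p) ψ) :
    ∀ᶠ y in 𝓝 (extChartAt (𝓡 m) p p), IsChartCurve α β H p (ψ y) := by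
  -- Compactness of the time interval gives one neighbourhood of the base point which is good at all
  -- times.
  have hN : ∀ᶠ y in 𝓝 (extChartAt (𝓡 m) p p), ∀ t ∈ Icc (0 : ℝ) 1,
      ∀ᶠ z in 𝓝 (t, y), ChartGood α β H p z := by
    refine isCompact_Icc.eventually_forall_of_forall_eventually fun t ht => ?_
    have h1 : Tendsto (Prod.swap : EuclideanSpace ℝ (Fin m) × ℝ → _)
        (𝓝 (extChartAt (𝓡 m) p p, t)) (𝓝 (t, extChartAt (𝓡 m) p p)) :=
      continuous_swap.tendsto _
    exact h1.eventually (hg t ht).eventually_nhds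
  filter_upwards [hψ.stays _ hN, hψ.solves] with y h1 h2
  exact ⟨fun t ht => h1 t ht t ht, fun t ht => h2 t ht⟩

/-- The time-one map of Moser's method, near `p`, in terms of the preferred chart around `p`. -/
structure IsMoserMapAt (α β : OneForm m M) (H : M → ℝ) (F : M → M) (p : M) : Prop where
  fixed : F p = p
  smooth : ∀ᶠ q in 𝓝 p, ContMDiffAt (𝓡 m) (𝓡 m) ∞ F q
  conformal : ∀ᶠ q in 𝓝 p, ∃ c > 0, ∀ v,
    (α.val (F q) + β.val (F q)) (mfd m m F q v) = c * α.val q v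
  injective : ∀ v, mfd m m F p v = 0 → v = 0
  shear : ∀ V T : Submodule ℝ (EuclideanSpace ℝ (Fin m)),
    (∀ w ∈ T, fderiv ℝ (addD (chartForm β p) (chartFun m H p)) (extChartAt (𝓡 m) p p) w = 0) →
    (∀ t ∈ Icc (0 : ℝ) 1, ∀ w ∈ V, ∀ u,
      pathForm (chartForm α p) (chartForm β p) (t, extChartAt (𝓡 m) p p) u = 0 →
      (∀ v, pathForm (chartForm α p) (chartForm β p) (t, extChartAt (𝓡 m) p p) v = 0 →
        pathD (chartForm α p) (chartForm β p) (t, extChartAt (𝓡 m) p p) u v =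
          -fderiv ℝ (addD (chartForm β p) (chartFun m H p)) (extChartAt (𝓡 m) p p) w v) → u ∈ T) →
    ∀ v ∈ V, mfd m m F p v - v ∈ T

/-- Since `p` is fixed, one chart serves as source and target, and there `F` is the time-one flow.
The conformal relation at nearby points is moved to their own preferred frames by the invertible
`tr`. -/
theorem IsMoserFlow.isMoserMapAt {p : M}
    {ψ : EuclideanSpace ℝ (Fin m) → ℝ → EuclideanSpace ℝ (Fin m)}
    (hψ : IsMoserFlow (chartForm α p) (chartForm β p) (chartFun m H p) (extChartAt (𝓡 m) p p) ψ)
    {F : M → M} (hF : ∀ᶠ q in 𝓝 p,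
      F q = (extChartAt (𝓡 m) p).symm (ψ (extChartAt (𝓡 m) p q) 1)) : IsMoserMapAt α β H F p := by
  have hp := mem_extChartAt_source (I := 𝓡 m) p
  set χ := extChartAt (𝓡 m) p with hχ
  have h1 : (1 : ℝ) ∈ Icc (0 : ℝ) 1 := right_mem_Icc.2 zero_le_one
  have hfix : F p = p := by rw [hF.self_of_nhds, hψ.fixed 1 h1, extChartAt_to_inv]
  have htgt : ∀ᶠ y in 𝓝 (χ p), ψ y 1 ∈ χ.target := by
    filter_upwards [hψ.stays _ (extChartAt_target_mem_nhds (I := 𝓡 m) p)] with y hy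
    exact hy 1 h1
  have hcoord : ∀ᶠ y in 𝓝 (χ p), coord m m p p F y = ψ y 1 := by
    filter_upwards [htgt, extChartAt_target_mem_nhds (I := 𝓡 m) p,
      (eventually_extChartAt_symm_iff hp).2 hF] with y h2 h3 h4
    rw [coord_apply, h4, χ.right_inv h3, χ.right_inv h2]
  have hsm : ∀ᶠ q in 𝓝 p, ContMDiffAt (𝓡 m) (𝓡 m) ∞ F q := by
    filter_upwards [hF.eventually_nhds, extChartAt_source_mem_nhds (I := 𝓡 m) p,
      (eventually_extChartAt_iff hp).1 hψ.smooth, (eventually_extChartAt_iff hp).1 htgt]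
      with q h2 h3 h4 h5
    have h6 : ContMDiffAt (𝓡 m) 𝓘(ℝ, EuclideanSpace ℝ (Fin m)) ∞ χ q :=
      contMDiffAt_extChartAt' (by rwa [extChartAt_source] at h3)
    have h7 : ContMDiffAt 𝓘(ℝ, EuclideanSpace ℝ (Fin m)) (𝓡 m) ∞ χ.symm (ψ (χ q) 1) :=
      (contMDiffOn_extChartAt_symm p).contMDiffAt (extChartAt_target_mem_nhds' h5)
    exact (h7.comp q (h4.contMDiffAt.comp q h6)).congr_of_eventuallyEq h2
  have hmfd : ∀ v, mfd m m F p v = fderiv ℝ (fun z => ψ z 1) (χ p) v := fun v => by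
    have h2 := fderiv_coord_eq (q := p) hp (by rw [hfix]; exact hp) hsm.self_of_nhds
    rw [hfix, tr_self hp, ContinuousLinearMap.id_comp, ContinuousLinearMap.comp_id] at h2
    rw [← h2, Filter.EventuallyEq.fderiv_eq hcoord]
  refine ⟨hfix, hsm, ?_, fun v hv => hψ.injective v ((hmfd v).symm.trans hv),
    fun V T h2 h3 v hv => ?_⟩
  · filter_upwards [hF, hsm, extChartAt_source_mem_nhds (I := 𝓡 m) p,
      (eventually_extChartAt_iff hp).1 hψ.conformal, (eventually_extChartAt_iff hp).1 htgt,
      (eventually_extChartAt_iff hp).1 hcoord.eventually_nhds]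
      with q h2 h3 h4 ⟨c, hc, h5⟩ h6 h7
    refine ⟨c, hc, fun w => ?_⟩
    have hFq : F q ∈ χ.source := by rw [h2]; exact χ.map_target h6
    have h8 : χ (F q) = ψ (χ q) 1 := by rw [h2, χ.right_inv h6]
    have h9 := fderiv_coord_eq h4 hFq h3
    rw [Filter.EventuallyEq.fderiv_eq h7] at h9
    have hqq := mem_extChartAt_source (I := 𝓡 m) q
    have hFF := mem_extChartAt_source (I := 𝓡 m) (F q)
    have h10 := h5 (tr m q p q w)
    rw [← hχ, h9, pathForm, ← h8, chartForm_eq h4, chartForm_eq hFq, chartForm_eq hFq] at h10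
    simp only [one_smul, add_apply, ContinuousLinearMap.comp_apply, tr_tr hqq h4,
      tr_tr hFF hFq] at h10
    exact h10
  · rw [hmfd]
    exact hψ.shear V T h2 h3 v hv

/-- Every `q` near `K` lies on an integral curve in the chart of some `p` in `K`. Uniqueness of
integral curves makes the endpoint independent of the chosen `p`, so an arbitrary choice gives a map
which near each `p` is the flow in its chart. No partition of unity is involved. -/
theorem exists_moser_map [T2Space M] {K : Set M} (hK : ∀ p ∈ K, MoserHyp α β H p) :
    ∃ F : M → M, ∀ p ∈ K, IsMoserMapAt α β H F p := by
  classical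
  choose! hg ψ hψ using fun p hp => (hK p hp).exists_flow
  have hU : ∀ p ∈ K, ∀ᶠ q in 𝓝 p, q ∈ (extChartAt (𝓡 m) p).source ∧
      IsChartCurve α β H p (ψ p (extChartAt (𝓡 m) p q)) ∧
      ψ p (extChartAt (𝓡 m) p q) 0 = extChartAt (𝓡 m) p q := by
    intro p hp
    filter_upwards [extChartAt_source_mem_nhds (I := 𝓡 m) p,
      (eventually_extChartAt_iff (mem_extChartAt_source p)).1
        ((hψ p hp).eventually_isChartCurve (hg p hp)),
      (eventually_extChartAt_iff (mem_extChartAt_source p)).1 (hψ p hp).start] with q h1 h2 h3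
    exact ⟨h1, h2, h3⟩
  refine ⟨fun q => if h : ∃ p ∈ K, q ∈ (extChartAt (𝓡 m) p).source ∧
      IsChartCurve α β H p (ψ p (extChartAt (𝓡 m) p q)) ∧
      ψ p (extChartAt (𝓡 m) p q) 0 = extChartAt (𝓡 m) p q then
      (extChartAt (𝓡 m) h.choose).symm (ψ h.choose (extChartAt (𝓡 m) h.choose q) 1) else q,
    fun p hp => (hψ p hp).isMoserMapAt ?_⟩
  filter_upwards [hU p hp] with q hq
  have h : ∃ p ∈ K, q ∈ (extChartAt (𝓡 m) p).source ∧
      IsChartCurve α β H p (ψ p (extChartAt (𝓡 m) p q)) ∧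
      ψ p (extChartAt (𝓡 m) p q) 0 = extChartAt (𝓡 m) p q := ⟨p, hp, hq⟩
  rw [dif_pos h]
  obtain ⟨-, h1, h2, h3⟩ := h.choose_spec
  refine h2.eqOn hq.2.1 ?_
  rw [h3, hq.2.2, PartialEquiv.left_inv _ h1, PartialEquiv.left_inv _ hq.1]

end MoserMap

/-! ### The inverse function theorem near a point and near a compact set -/

section LocalInverse

variable {m : ℕ}
  {M : Type*} [TopologicalSpace M] [ChartedSpace (EuclideanSpace ℝ (Fin m)) M]
  [IsManifold (𝓡 m) ∞ M]
  {N : Type*} [TopologicalSpace N] [ChartedSpace (EuclideanSpace ℝ (Fin m)) N]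
  [IsManifold (𝓡 m) ∞ N] {f : M → N} {p : M}

theorem fderiv_coord_self (hf : ContMDiffAt (𝓡 m) (𝓡 m) ∞ f p) :
    fderiv ℝ (coord m m p (f p) f) (extChartAt (𝓡 m) p p) = mfd m m f p :=
  (mfd_eq_fderiv_coord (hf.mdifferentiableAt (by simp))).symm

/-- An injective endomorphism-like map between model spaces of the same dimension is invertible. -/
theorem exists_equiv_of_injective {A : EuclideanSpace ℝ (Fin m) →L[ℝ] EuclideanSpace ℝ (Fin m)}
    (hA : ∀ v, A v = 0 → v = 0) :
    ∃ e : EuclideanSpace ℝ (Fin m) ≃L[ℝ] EuclideanSpace ℝ (Fin m),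
      (e : EuclideanSpace ℝ (Fin m) →L[ℝ] EuclideanSpace ℝ (Fin m)) = A := by
  have hinj : Function.Injective A.toLinearMap := by
    rw [← LinearMap.ker_eq_bot, LinearMap.ker_eq_bot']
    exact hA
  exact ⟨(LinearEquiv.ofInjectiveEndo A.toLinearMap hinj).toContinuousLinearEquiv,
    by ext; rfl⟩

/-- The inverse function theorem on a manifold. -/
theorem exists_local_inverse (hf : ContMDiffAt (𝓡 m) (𝓡 m) ∞ f p)
    (hinj : ∀ v, mfd m m f p v = 0 → v = 0) :
    ∃ g : N → M, ContMDiffAt (𝓡 m) (𝓡 m) ∞ g (f p) ∧ g (f p) = p ∧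
      (∀ᶠ z in 𝓝 p, g (f z) = z) ∧ ∀ᶠ y in 𝓝 (f p), f (g y) = y := by
  have hp := mem_extChartAt_source (I := 𝓡 m) p
  have hq := mem_extChartAt_source (I := 𝓡 m) (f p)
  obtain ⟨e, he⟩ := exists_equiv_of_injective hinj
  set F := coord m m p (f p) f with hF
  set χ := extChartAt (𝓡 m) p
  set κ := extChartAt (𝓡 m) (f p)
  have hFs : ContDiffAt ℝ ∞ F (χ p) := contDiffAt_coord hp hq hf
  have hFd : HasFDerivAt F (e : _ →L[ℝ] _) (χ p) := by
    rw [he, ← fderiv_coord_self hf]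
    exact (hFs.differentiableAt (by simp)).hasFDerivAt
  have hFp : F (χ p) = κ (f p) := coord_extChartAt hp _ _
  have hst := hFs.hasStrictFDerivAt' hFd (by simp)
  set G := hFs.localInverse hFd (by simp) with hG
  have hGs : ContDiffAt ℝ ∞ G (κ (f p)) := hFp ▸ hFs.to_localInverse hFd (by simp)
  have hGp : G (κ (f p)) = χ p := hFp ▸ hFs.localInverse_apply_image hFd (by simp)
  have hl : ∀ᶠ y in 𝓝 (χ p), G (F y) = y := hst.eventually_left_inverse
  have hr : ∀ᶠ y in 𝓝 (κ (f p)), F (G y) = y := hFp ▸ hst.eventually_right_inverse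
  have hgs : ContMDiffAt (𝓡 m) (𝓡 m) ∞ (χ.symm ∘ G ∘ κ) (f p) := by
    have h1 : ContMDiffAt (𝓡 m) 𝓘(ℝ, EuclideanSpace ℝ (Fin m)) ∞ κ (f p) := contMDiffAt_extChartAt
    have h2 : ContMDiffAt 𝓘(ℝ, EuclideanSpace ℝ (Fin m)) (𝓡 m) ∞ χ.symm (G (κ (f p))) := by
      rw [hGp]
      exact (contMDiffOn_extChartAt_symm p).contMDiffAt (extChartAt_target_mem_nhds p)
    exact h2.comp (f p) (hGs.contMDiffAt.comp (f p) h1)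
  have hgp : (χ.symm ∘ G ∘ κ) (f p) = p := by
    simp only [Function.comp_apply, hGp]
    exact extChartAt_to_inv p
  refine ⟨χ.symm ∘ G ∘ κ, hgs, hgp, ?_, ?_⟩
  · filter_upwards [extChartAt_source_mem_nhds (I := 𝓡 m) p, (eventually_extChartAt_iff hp).1 hl]
      with z h1 h2
    rw [hF, coord_extChartAt h1] at h2
    simp only [Function.comp_apply]
    rw [h2, χ.left_inv h1]
  · have h1 : Tendsto (χ.symm ∘ G ∘ κ) (𝓝 (f p)) (𝓝 p) := by
      have := hgs.continuousAt.tendsto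
      rwa [hgp] at this
    filter_upwards [extChartAt_source_mem_nhds (I := 𝓡 m) (f p),
      (eventually_extChartAt_iff hq).1 hr,
      (h1.eventually (hf.continuousAt.eventually (extChartAt_source_mem_nhds' (I := 𝓡 m) hq)))]
      with y h2 h3 h4
    have h5 : κ (f (χ.symm (G (κ y)))) = κ y := h3
    exact κ.injOn h4 h2 h5

/-- In fixed charts the derivative depends continuously on the point and invertible operators form
an open set; returning to the preferred frames costs only invertible factors. -/
theorem eventually_mfd_injective (hf : ∀ᶠ q in 𝓝 p, ContMDiffAt (𝓡 m) (𝓡 m) ∞ f q)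
    (hinj : ∀ v, mfd m m f p v = 0 → v = 0) :
    ∀ᶠ q in 𝓝 p, ∀ v, mfd m m f q v = 0 → v = 0 := by
  have hp := mem_extChartAt_source (I := 𝓡 m) p
  have hq := mem_extChartAt_source (I := 𝓡 m) (f p)
  obtain ⟨e, he⟩ := exists_equiv_of_injective hinj
  have h1 : ContinuousAt (fderiv ℝ (coord m m p (f p) f)) (extChartAt (𝓡 m) p p) :=
    (contDiffAt_fderiv (contDiffAt_coord hp hq hf.self_of_nhds)).continuousAt
  rw [ContinuousAt, fderiv_coord_self hf.self_of_nhds, ← he] at h1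
  filter_upwards [hf, extChartAt_source_mem_nhds (I := 𝓡 m) p,
    hf.self_of_nhds.continuousAt.eventually (extChartAt_source_mem_nhds (I := 𝓡 m) (f p)),
    (eventually_extChartAt_iff hp).1 (h1.eventually e.nhds)] with q h2 h3 h4 ⟨e', h5⟩ v hv
  have hqq := mem_extChartAt_source (I := 𝓡 m) q
  rw [fderiv_coord_eq h3 h4 h2] at h5
  have h6 : e' (tr m q p q v) = 0 := by
    have := congrArg (fun B => B (tr m q p q v)) h5
    simp only [ContinuousLinearMap.comp_apply, tr_tr hqq h3, hv, map_zero] at this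
    exact this
  have h7 := e'.map_eq_zero_iff.1 h6
  rw [← tr_tr hqq h3 v, h7, map_zero]

/-- A map which is injective on a compact set, and a local diffeomorphism there, is a
diffeomorphism between neighbourhoods. -/
theorem exists_partialDiffeomorph [T2Space N] [Nonempty M] {K : Set M} (hK : IsCompact K)
    (hf : ∀ p ∈ K, ∀ᶠ q in 𝓝 p, ContMDiffAt (𝓡 m) (𝓡 m) ∞ f q)
    (hinj : ∀ p ∈ K, ∀ v, mfd m m f p v = 0 → v = 0) (hfK : InjOn f K)
    {P : M → Prop} (hP : ∀ p ∈ K, ∀ᶠ q in 𝓝 p, P q) :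
    ∃ ψ : PartialDiffeomorph (𝓡 m) (𝓡 m) M N ∞, K ⊆ ψ.source ∧ (∀ q ∈ ψ.source, P q) ∧
      (ψ.toPartialEquiv : M → N) = f := by
  -- Injectivity on a compact set together with local injectivity at each of its points gives
  -- injectivity on a neighbourhood.
  obtain ⟨T, hT, hTinj⟩ := hfK.exists_mem_nhdsSet hK
    (fun p hp => (hf p hp).self_of_nhds.continuousAt) fun p hp => by
      obtain ⟨g, -, -, h1, -⟩ := exists_local_inverse (hf p hp).self_of_nhds (hinj p hp)
      exact ⟨_, h1, fun x hx y hy hxy => by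
        have hx' : g (f x) = x := hx
        have hy' : g (f y) = y := hy
        rw [← hx', ← hy', hxy]⟩
  have hall : ∀ᶠ q in 𝓝ˢ K, q ∈ T ∧ P q ∧ ContMDiffAt (𝓡 m) (𝓡 m) ∞ f q ∧
      ∀ v, mfd m m f q v = 0 → v = 0 := by
    refine (show ∀ᶠ q in 𝓝ˢ K, q ∈ T from hT).and (eventually_nhdsSet_iff_forall.2 fun p hp => ?_)
    filter_upwards [hP p hp, hf p hp, eventually_mfd_injective (hf p hp) (hinj p hp)]
      with q h1 h2 h3
    exact ⟨h1, h2, h3⟩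
  obtain ⟨O, hO, hKO, hOall⟩ := mem_nhdsSet_iff_exists.1 hall
  have hOinj : InjOn f O := hTinj.mono fun q hq => (hOall hq).1
  -- By injectivity on `O` the set-theoretic inverse coincides near `f q` with the smooth local
  -- inverse, which also shows that the image is open.
  have hloc : ∀ q ∈ O, f '' O ∈ 𝓝 (f q) ∧
      ContMDiffAt (𝓡 m) (𝓡 m) ∞ (Function.invFunOn f O) (f q) := by
    intro q hq
    obtain ⟨g, hg, hgq, h1, h2⟩ := exists_local_inverse (hOall hq).2.2.1 (hOall hq).2.2.2
    have h3 : ∀ᶠ y in 𝓝 (f q), g y ∈ O := by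
      refine hg.continuousAt.eventually ?_
      rw [hgq]
      exact hO.mem_nhds hq
    refine ⟨?_, hg.congr_of_eventuallyEq ?_⟩
    · filter_upwards [h2, h3] with y h4 h5
      exact ⟨g y, h5, h4⟩
    · filter_upwards [h2, h3] with y h4 h5
      have h6 : y ∈ f '' O := ⟨g y, h5, h4⟩
      exact hOinj (Function.invFunOn_mem h6) h5 ((Function.invFunOn_eq h6).trans h4.symm)
  refine ⟨{ toPartialEquiv := hOinj.toPartialEquiv f O, open_source := hO, open_target := ?_,
            contMDiffOn_toFun := fun q hq => (hOall hq).2.2.1.contMDiffWithinAt,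
            contMDiffOn_invFun := ?_ }, hKO, fun q hq => (hOall hq).2.1, rfl⟩
  · refine isOpen_iff_mem_nhds.2 ?_
    rintro _ ⟨q, hq, rfl⟩
    exact (hloc q hq).1
  · rintro _ ⟨q, hq, rfl⟩
    exact (hloc q hq).2.contMDiffWithinAt

end LocalInverse

/-! ### An abstract gluing principle with cut-off functions -/

section Gluing

/-- Local solutions of a local problem near a compact set, which can be averaged by means of
cut-off functions, give rise to a global solution. -/
theorem exists_of_locally_averaging {m : ℕ} {M : Type*} [TopologicalSpace M] [T2Space M]
    [ChartedSpace (EuclideanSpace ℝ (Fin m)) M] [IsManifold (𝓡 m) ∞ M] {Y : Type*} [Nonempty Y]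
    {K : Set M} (hK : IsCompact K) (Q : (M → Y) → M → Prop)
    (hcongr : ∀ f g : M → Y, ∀ p, f =ᶠ[𝓝 p] g → Q f p → Q g p)
    (hloc : ∀ p ∈ K, ∃ O ∈ 𝓝 p, ∃ g : M → Y, ∃ avg : ℝ → Y → Y → Y,
      (∀ y z, avg 0 y z = y) ∧ (∀ y z, avg 1 y z = z) ∧ ∀ x ∈ K, x ∈ O → Q g x ∧
        ∀ f χ, Q f x → ContMDiff (𝓡 m) 𝓘(ℝ, ℝ) ∞ χ → (∀ y, χ y ∈ Icc (0 : ℝ) 1) →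
          Q (fun y => avg (χ y) (f y) (g y)) x) :
    ∃ f, ∀ p ∈ K, Q f p := by
  classical
  choose! O hO g avg havg0 havg1 havg using hloc
  have hbump : ∀ p ∈ K, ∃ χ : M → ℝ, ContMDiff (𝓡 m) 𝓘(ℝ, ℝ) ∞ χ ∧ (∀ y, χ y ∈ Icc (0 : ℝ) 1) ∧
      tsupport χ ⊆ O p ∧ ∀ᶠ y in 𝓝 p, χ y = 1 := by
    intro p hp
    obtain ⟨χ, -, hχ⟩ := (SmoothBumpFunction.nhds_basis_tsupport (I := 𝓡 m) p).mem_iff.1 (hO p hp)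
    exact ⟨χ, χ.contMDiff, fun y => χ.mem_Icc, hχ, χ.eventuallyEq_one⟩
  choose! χ hχs hχI hχO hχ1 using hbump
  obtain ⟨s, hsK, hs⟩ := hK.elim_nhds_subcover (fun p => {y | ∀ᶠ z in 𝓝 y, χ p z = 1})
    fun p hp => (hχ1 p hp).eventually_nhds
  -- Induction over the finite cover. The solution is only claimed at points near which some cut-off
  -- of a treated index is identically one; averaging with the next local solution preserves this
  -- and enlarges the set.
  suffices H : ∀ s : Finset M, (∀ p ∈ s, p ∈ K) → ∃ f : M → Y, ∀ x ∈ K,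
      (∃ p ∈ s, ∀ᶠ z in 𝓝 x, χ p z = 1) → Q f x by
    obtain ⟨f, hf⟩ := H s hsK
    refine ⟨f, fun x hx => hf x hx ?_⟩
    obtain ⟨p, hp, hxp⟩ := mem_iUnion₂.1 (hs hx)
    exact ⟨p, hp, hxp⟩
  intro s
  induction s using Finset.induction_on with
  | empty => exact fun _ => ⟨fun _ => Classical.arbitrary Y, fun x _ ⟨p, hp, _⟩ => by simp at hp⟩
  | insert p s hps ih =>
    intro hsK
    obtain ⟨f, hf⟩ := ih fun q hq => hsK q (Finset.mem_insert_of_mem hq)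
    have hpK := hsK p (Finset.mem_insert_self p s)
    refine ⟨fun y => avg p (χ p y) (f y) (g p y), ?_⟩
    rintro x hx ⟨q, hq, hxq⟩
    -- Where the new cut-off is one the function is `g p`; on the rest of its support two solutions
    -- are averaged; off the support nothing changes. The first and third cases use that `avg` is
    -- exact at 1 and at 0.
    by_cases hx1 : ∀ᶠ z in 𝓝 x, χ p z = 1
    · have hxO : x ∈ O p := hχO p hpK (subset_tsupport _ (by
        rw [Function.mem_support, hx1.self_of_nhds]; exact one_ne_zero))
      refine hcongr _ _ x ?_ (havg p hpK x hx hxO).1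
      filter_upwards [hx1] with z hz
      rw [hz, havg1 p hpK]
    · have hqs : q ∈ s := by
        rcases Finset.mem_insert.1 hq with rfl | h
        · exact absurd hxq hx1
        · exact h
      have hQ := hf x hx ⟨q, hqs, hxq⟩
      by_cases hxs : x ∈ tsupport (χ p)
      · exact (havg p hpK x hx (hχO p hpK hxs)).2 f (χ p) hQ (hχs p hpK) (hχI p hpK)
      · refine hcongr _ _ x ?_ hQ
        filter_upwards [(isClosed_tsupport (χ p)).isOpen_compl.mem_nhds hxs] with z hz
        rw [image_eq_zero_of_notMem_tsupport hz, havg0 p hpK]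

end Gluing

/-! ### Smooth families of linear maps, one-sided inverses and local retractions -/

section Families

variable {E F G : Type} [NormedAddCommGroup E] [NormedSpace ℝ E] [NormedAddCommGroup F]
  [NormedSpace ℝ F] [NormedAddCommGroup G] [NormedSpace ℝ G]

theorem SmoothNear.comp {g : F → G} {f : E → F} {y : E} (hg : SmoothNear g (f y))
    (hf : SmoothNear f y) : SmoothNear (g ∘ f) y := by
  filter_upwards [hf, hf.self_of_nhds.continuousAt.eventually hg] with z h1 h2
  exact h2.comp z h1

theorem SmoothNear.clm_comp {g : E → F →L[ℝ] G} {E' : Type} [NormedAddCommGroup E']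
    [NormedSpace ℝ E'] {f : E → E' →L[ℝ] F} {y : E} (hg : SmoothNear g y) (hf : SmoothNear f y) :
    SmoothNear (fun z => (g z).comp (f z)) y := by
  filter_upwards [hf, hg] with z h1 h2
  exact h2.clm_comp h1

theorem SmoothNear.clm_apply {g : E → F →L[ℝ] G} {f : E → F} {y : E} (hg : SmoothNear g y)
    (hf : SmoothNear f y) : SmoothNear (fun z => g z (f z)) y := by
  filter_upwards [hf, hg] with z h1 h2
  exact h2.clm_apply h1

theorem SmoothNear.add {g f : E → F} {y : E} (hg : SmoothNear g y)
    (hf : SmoothNear f y) : SmoothNear (fun z => g z + f z) y := by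
  filter_upwards [hf, hg] with z h1 h2
  exact h2.add h1

theorem SmoothNear.sub {g f : E → F} {y : E} (hg : SmoothNear g y)
    (hf : SmoothNear f y) : SmoothNear (fun z => g z - f z) y := by
  filter_upwards [hf, hg] with z h1 h2
  exact h2.sub h1

theorem SmoothNear.smul {g : E → ℝ} {f : E → F} {y : E} (hg : SmoothNear g y)
    (hf : SmoothNear f y) : SmoothNear (fun z => g z • f z) y := by
  filter_upwards [hf, hg] with z h1 h2
  exact h2.smul h1

theorem SmoothNear.fderiv {f : E → F} {y : E} (hf : SmoothNear f y) :
    SmoothNear (fderiv ℝ f) y := by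
  filter_upwards [hf] with z h1
  exact contDiffAt_fderiv h1

theorem SmoothNear.flip {E' : Type} [NormedAddCommGroup E'] [NormedSpace ℝ E']
    {f : E' → E →L[ℝ] F →L[ℝ] G} {y : E'} (hf : SmoothNear f y) :
    SmoothNear (fun z => (f z).flip) y := by
  filter_upwards [hf] with z h1
  have h2 : ContDiff ℝ ∞ (ContinuousLinearMap.flipₗᵢ ℝ E F G) := by
    apply LinearIsometryEquiv.contDiff
  exact h2.contDiffAt.comp z h1

theorem SmoothNear.dOne {a : E → E →L[ℝ] ℝ} {y : E} (ha : SmoothNear a y) :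
    SmoothNear (dOne a) y := by
  filter_upwards [ha] with z h1
  exact contDiffAt_dOne h1

theorem smoothNear_const (c : F) (y : E) : SmoothNear (fun _ : E => c) y :=
  Eventually.of_forall fun _ => contDiffAt_const

theorem smoothNear_id (y : E) : SmoothNear (fun z : E => z) y :=
  Eventually.of_forall fun _ => contDiffAt_id

theorem SmoothNear.clm_prod {a : E → F →L[ℝ] ℝ} {b : E → F →L[ℝ] G} {y : E} (ha : SmoothNear a y)
    (hb : SmoothNear b y) : SmoothNear (fun z => (a z).prod (b z)) y := by
  have h := ((smoothNear_const (ContinuousLinearMap.inl ℝ ℝ G) y).clm_comp ha).add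
    ((smoothNear_const (ContinuousLinearMap.inr ℝ ℝ G) y).clm_comp hb)
  filter_upwards [h] with z hz
  refine hz.congr_of_eventuallyEq (Eventually.of_forall fun w => ?_)
  ext v <;> simp

theorem SmoothNear.inverse [CompleteSpace E] {f : G → E →L[ℝ] E} {y : G} (hf : SmoothNear f y)
    (hy : f y = ContinuousLinearMap.id ℝ E) :
    SmoothNear (fun z => (f z).inverse) y ∧ ∀ᶠ z in 𝓝 y, (f z).IsInvertible := by
  have h1 : ∀ᶠ z in 𝓝 y, (f z).IsInvertible := by
    have h2 := (ContinuousLinearEquiv.refl ℝ E).nhds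
    have h3 : Tendsto f (𝓝 y) (𝓝 ((ContinuousLinearEquiv.refl ℝ E : E ≃L[ℝ] E) : E →L[ℝ] E)) := by
      have := hf.self_of_nhds.continuousAt.tendsto
      rwa [hy] at this
    filter_upwards [h3.eventually h2] with z hz
    exact hz
  refine ⟨?_, h1⟩
  filter_upwards [hf, h1] with z h2 h3
  exact (h3.contDiffAt_map_inverse (n := ∞)).comp z h2

/-- A smooth family of injective linear maps has a smooth family of left inverses. -/
theorem exists_leftInverse_family [FiniteDimensional ℝ E] [FiniteDimensional ℝ F]
    {J : G → E →L[ℝ] F} {y : G} (hJ : SmoothNear J y) (hinj : ∀ v, J y v = 0 → v = 0) :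
    ∃ K : G → F →L[ℝ] E, SmoothNear K y ∧
      ∀ᶠ z in 𝓝 y, (K z).comp (J z) = ContinuousLinearMap.id ℝ E := by
  have : CompleteSpace E := FiniteDimensional.complete ℝ E
  obtain ⟨K₀, hK₀⟩ := LinearMap.exists_leftInverse_of_injective (J y).toLinearMap
    (LinearMap.ker_eq_bot'.2 hinj)
  set K := LinearMap.toContinuousLinearMap K₀
  have hK : K.comp (J y) = ContinuousLinearMap.id ℝ E :=
    ContinuousLinearMap.ext fun v => congrArg (fun B : E →ₗ[ℝ] E => B v) hK₀
  obtain ⟨h1, h2⟩ := ((smoothNear_const K y).clm_comp hJ).inverse hK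
  -- The left inverse at the base point is kept fixed and renormalised: K ∘ J z is close to the
  -- identity, hence invertible.
  refine ⟨fun z => (K.comp (J z)).inverse.comp K, h1.clm_comp (smoothNear_const K y), ?_⟩
  filter_upwards [h2] with z hz
  rw [ContinuousLinearMap.comp_assoc]
  exact hz.inverse_comp_self

/-- A smooth family of surjective linear maps has a smooth family of right inverses. -/
theorem exists_rightInverse_family [FiniteDimensional ℝ E] [FiniteDimensional ℝ F]
    {S : G → E →L[ℝ] F} {y : G} (hS : SmoothNear S y) (hsurj : Function.Surjective (S y)) :
    ∃ Q : G → F →L[ℝ] E, SmoothNear Q y ∧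
      ∀ᶠ z in 𝓝 y, (S z).comp (Q z) = ContinuousLinearMap.id ℝ F := by
  have : CompleteSpace F := FiniteDimensional.complete ℝ F
  obtain ⟨Q₀, hQ₀⟩ := LinearMap.exists_rightInverse_of_surjective (S y).toLinearMap
    (LinearMap.range_eq_top.2 hsurj)
  set Q := LinearMap.toContinuousLinearMap Q₀
  have hQ : (S y).comp Q = ContinuousLinearMap.id ℝ F :=
    ContinuousLinearMap.ext fun v => congrArg (fun B : F →ₗ[ℝ] F => B v) hQ₀
  obtain ⟨h1, h2⟩ := (hS.clm_comp (smoothNear_const Q y)).inverse hQ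
  refine ⟨fun z => Q.comp ((S z).comp Q).inverse, (smoothNear_const Q y).clm_comp h1, ?_⟩
  filter_upwards [h2] with z hz
  rw [← ContinuousLinearMap.comp_assoc]
  exact hz.self_comp_inverse

/-- The inverse function theorem at a point where the derivative is the identity. -/
theorem exists_smoothNear_inverse [CompleteSpace E] {f : E → E} {y : E} (hf : SmoothNear f y)
    (hy : fderiv ℝ f y = ContinuousLinearMap.id ℝ E) :
    ∃ g : E → E, SmoothNear g (f y) ∧ ∀ᶠ z in 𝓝 y, g (f z) = z := by
  have hd : HasFDerivAt f ((ContinuousLinearEquiv.refl ℝ E : E ≃L[ℝ] E) : E →L[ℝ] E) y := by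
    have := (hf.self_of_nhds.differentiableAt (by simp)).hasFDerivAt
    rwa [hy] at this
  set e := hf.self_of_nhds.toOpenPartialHomeomorph f hd (by simp) with he
  have hys : y ∈ e.source := hf.self_of_nhds.mem_toOpenPartialHomeomorph_source hd (by simp)
  obtain ⟨-, hinv⟩ := hf.fderiv.inverse hy
  refine ⟨e.symm, ?_, ?_⟩
  · have h1 : Tendsto e.symm (𝓝 (f y)) (𝓝 y) := by
      have := e.tendsto_symm hys
      exact this
    filter_upwards [e.open_target.mem_nhds (e.map_source hys), h1.eventually hf,
      h1.eventually hinv] with z h2 h3 ⟨e', h4⟩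
    refine e.contDiffAt_symm (f₀' := e') h2 ?_ h3
    rw [h4]
    exact (h3.differentiableAt (by simp)).hasFDerivAt
  · filter_upwards [e.open_source.mem_nhds hys] with z hz
    exact e.left_inv hz

/-- An immersion has a local retraction. -/
theorem exists_local_retraction [FiniteDimensional ℝ E] [FiniteDimensional ℝ F] {j : E → F} {y : E}
    (hj : SmoothNear j y) (hinj : ∀ v, fderiv ℝ j y v = 0 → v = 0) :
    ∃ r : F → E, SmoothNear r (j y) ∧ ∀ᶠ z in 𝓝 y, r (j z) = z := by
  have : CompleteSpace E := FiniteDimensional.complete ℝ E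
  obtain ⟨K₀, hK₀⟩ := LinearMap.exists_leftInverse_of_injective (fderiv ℝ j y).toLinearMap
    (LinearMap.ker_eq_bot'.2 hinj)
  set K := LinearMap.toContinuousLinearMap K₀
  have hK : K.comp (fderiv ℝ j y) = ContinuousLinearMap.id ℝ E :=
    ContinuousLinearMap.ext fun v => congrArg (fun B : E →ₗ[ℝ] E => B v) hK₀
  have hKs : ∀ z, SmoothNear K z := fun z => Eventually.of_forall fun _ => K.contDiff.contDiffAt
  -- With K a left inverse of the derivative, K ∘ j has derivative the identity; its local inverse
  -- after K is the retraction.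
  obtain ⟨g, hg, hgl⟩ := exists_smoothNear_inverse (f := K ∘ j) ((hKs _).comp hj) (by
    rw [fderiv_comp y K.differentiableAt (hj.self_of_nhds.differentiableAt (by simp)), K.fderiv,
      hK])
  exact ⟨g ∘ K, SmoothNear.comp (f := K) hg (hKs _), hgl⟩

end Families

/-! ### Linear algebra of maps compatible with the forms and the tangent spaces -/

section Adjust

variable {E E' U : Type} [NormedAddCommGroup E] [NormedSpace ℝ E] [NormedAddCommGroup E']
  [NormedSpace ℝ E'] [NormedAddCommGroup U] [NormedSpace ℝ U]

/-- The linear map `v ↦ (A v, u ↦ Ω (J u, v))`; its kernel is the symplectic orthogonal complement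
of the image of `J` in `ker A`. -/
def orthMap (A : E →L[ℝ] ℝ) (Ω : E →L[ℝ] E →L[ℝ] ℝ) (J : U →L[ℝ] E) : E →L[ℝ] ℝ × (U →L[ℝ] ℝ) :=
  A.prod (Ω.comp J).flip

@[simp] theorem orthMap_apply (A : E →L[ℝ] ℝ) (Ω : E →L[ℝ] E →L[ℝ] ℝ) (J : U →L[ℝ] E) (v : E) :
    orthMap A Ω J v = (A v, (Ω.comp J).flip v) := rfl

theorem orthMap_eq_zero_iff {A : E →L[ℝ] ℝ} {Ω : E →L[ℝ] E →L[ℝ] ℝ} {J : U →L[ℝ] E} {v : E} :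
    orthMap A Ω J v = 0 ↔ A v = 0 ∧ ∀ u, Ω (J u) v = 0 := by
  rw [orthMap_apply, Prod.mk_eq_zero, ContinuousLinearMap.ext_iff]
  rfl

/-- A functional killing the range has the form (r, g) ↦ r s + g u, which gives s A + Ω(J u, ·) = 0.
On ker A, nondegeneracy forces J u = 0 and so u = 0; then A ≠ 0 forces s = 0. -/
theorem orthMap_surjective [FiniteDimensional ℝ U] {A : E →L[ℝ] ℝ} {Ω : E →L[ℝ] E →L[ℝ] ℝ}
    {J : U →L[ℝ] E} (hA : A ≠ 0) (hJ : ∀ u, J u = 0 → u = 0) (hJA : ∀ u, A (J u) = 0)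
    (hΩ : ∀ u, A u = 0 → (∀ v, A v = 0 → Ω u v = 0) → u = 0) :
    Function.Surjective (orthMap A Ω J) := by
  refine (LinearMap.range_eq_top (f := (orthMap A Ω J).toLinearMap)).1 ?_
  by_contra hne
  obtain ⟨f, hf, hle⟩ := Submodule.exists_le_ker_of_lt_top _ (lt_top_iff_ne_top.2 hne)
  have hf0 : ∀ v, f (A v, (Ω.comp J).flip v) = 0 := fun v => hle ⟨v, rfl⟩
  -- the restriction of `f` to the second factor is the evaluation at a vector
  set ev : U →ₗ[ℝ] Module.Dual ℝ (U →L[ℝ] ℝ) :=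
    { toFun := fun u => { toFun := fun g => g u, map_add' := fun _ _ => rfl,
                          map_smul' := fun _ _ => rfl }
      map_add' := fun u v => by ext g; exact g.map_add u v
      map_smul' := fun c u => by ext g; exact g.map_smul c u }
  have hev : Function.Injective ev := by
    rw [← LinearMap.ker_eq_bot, LinearMap.ker_eq_bot']
    intro u hu
    refine SeparatingDual.eq_zero_of_forall_dual_eq_zero (R := ℝ) fun g => ?_
    exact congrArg (fun B : Module.Dual ℝ (U →L[ℝ] ℝ) => B g) hu
  have hfin : Module.finrank ℝ U = Module.finrank ℝ (Module.Dual ℝ (U →L[ℝ] ℝ)) := by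
    rw [Subspace.dual_finrank_eq,
      ← (LinearMap.toContinuousLinearMap (𝕜 := ℝ) (E := U) (F' := ℝ)).finrank_eq]
    exact (Subspace.dual_finrank_eq (K := ℝ) (V := U)).symm
  have : FiniteDimensional ℝ (U →L[ℝ] ℝ) :=
    (LinearMap.toContinuousLinearMap (𝕜 := ℝ) (E := U) (F' := ℝ)).finiteDimensional
  obtain ⟨u, hu⟩ := (LinearMap.injective_iff_surjective_of_finrank_eq_finrank hfin).1 hev
    (f.comp (LinearMap.inr ℝ ℝ (U →L[ℝ] ℝ)))
  have hfs : ∀ r g, f (r, g) = r * f (1, 0) + g u := fun r g => by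
    have h1 : (r, g) = r • ((1 : ℝ), (0 : U →L[ℝ] ℝ)) + (0, g) := by simp
    have h2 : f (0, g) = g u := (congrArg (fun B : Module.Dual ℝ (U →L[ℝ] ℝ) => B g) hu).symm
    rw [h1, map_add, map_smul, h2, smul_eq_mul]
  have h3 : ∀ v, A v * f (1, 0) + Ω (J u) v = 0 := fun v => by
    have := hf0 v
    rw [hfs] at this
    exact this
  have h4 : u = 0 := hJ u (hΩ _ (hJA u) fun v hv => by
    have := h3 v
    rwa [hv, zero_mul, zero_add] at this)
  have h5 : f (1, 0) = 0 := by
    by_contra h6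
    refine hA (ContinuousLinearMap.ext fun v => ?_)
    have := h3 v
    rw [h4, map_zero, map_zero] at this
    simpa [h6] using this
  refine hf (LinearMap.ext fun q => ?_)
  rw [← Prod.mk.eta (p := q), hfs, h5, h4]
  simp

/-- The modification of the linear map `B` used to arrange that it is compatible with forms and
embeddings. -/
def adjust (B : E →L[ℝ] E') (c : ℝ) (J₀ : U →L[ℝ] E) (J₁ : U →L[ℝ] E') (K : E →L[ℝ] U)
    (S₀ : E →L[ℝ] ℝ × (U →L[ℝ] ℝ)) (Q₀ : ℝ × (U →L[ℝ] ℝ) →L[ℝ] E)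
    (Q₁ : ℝ × (U →L[ℝ] ℝ) →L[ℝ] E') : E →L[ℝ] E' :=
  (B + (J₁ - B.comp J₀).comp K).comp (ContinuousLinearMap.id ℝ E - Q₀.comp S₀) +
    c • Q₁.comp S₀

/-- `A` is compatible with the embeddings, with the `1`-forms, and with the `2`-forms up to the
factor `c`. -/
structure IsAdjusted (A₀ : E →L[ℝ] ℝ) (Ω₀ : E →L[ℝ] E →L[ℝ] ℝ) (J₀ : U →L[ℝ] E)
    (A₁ : E' →L[ℝ] ℝ) (Ω₁ : E' →L[ℝ] E' →L[ℝ] ℝ) (J₁ : U →L[ℝ] E') (c : ℝ)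
    (A : E →L[ℝ] E') : Prop where
  comp_eq : ∀ u, A (J₀ u) = J₁ u
  form_eq : ∀ v, A₁ (A v) = c * A₀ v
  two_form_eq : ∀ u v, Ω₁ (J₁ u) (A v) = c * Ω₀ (J₀ u) v

variable {A₀ : E →L[ℝ] ℝ} {Ω₀ : E →L[ℝ] E →L[ℝ] ℝ} {J₀ : U →L[ℝ] E}
    {A₁ : E' →L[ℝ] ℝ} {Ω₁ : E' →L[ℝ] E' →L[ℝ] ℝ} {J₁ : U →L[ℝ] E'} {c : ℝ} {B : E →L[ℝ] E'}
    {K : E →L[ℝ] U} {Q₀ : ℝ × (U →L[ℝ] ℝ) →L[ℝ] E} {Q₁ : ℝ × (U →L[ℝ] ℝ) →L[ℝ] E'}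

theorem adjust_of_orthMap_eq_zero {v : E} (hv : orthMap A₀ Ω₀ J₀ v = 0) :
    adjust B c J₀ J₁ K (orthMap A₀ Ω₀ J₀) Q₀ Q₁ v = B v + (J₁ (K v) - B (J₀ (K v))) := by
  simp only [adjust, add_apply, sub_apply, smul_apply, ContinuousLinearMap.comp_apply, hv,
    ContinuousLinearMap.id_apply, map_zero, smul_zero, add_zero, sub_zero]

/-- The operator id - Q₀ S₀ projects onto V = ker S₀. There `B` is corrected by (J₁ - B J₀) K, which
stays in the target orthogonal complement and makes J₀ u go to J₁ u. On the complement, c Q₁ S₀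
forces S₁ ∘ A = c S₀, which encodes both form conditions. -/
theorem isAdjusted_adjust (hK : K.comp J₀ = ContinuousLinearMap.id ℝ U)
    (hQ₀ : (orthMap A₀ Ω₀ J₀).comp Q₀ = ContinuousLinearMap.id ℝ _)
    (hQ₁ : (orthMap A₁ Ω₁ J₁).comp Q₁ = ContinuousLinearMap.id ℝ _)
    (hJ₀ : ∀ u, orthMap A₀ Ω₀ J₀ (J₀ u) = 0) (hJ₁ : ∀ u, orthMap A₁ Ω₁ J₁ (J₁ u) = 0)
    (hB : ∀ v, orthMap A₀ Ω₀ J₀ v = 0 → orthMap A₁ Ω₁ J₁ (B v) = 0) :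
    IsAdjusted A₀ Ω₀ J₀ A₁ Ω₁ J₁ c (adjust B c J₀ J₁ K (orthMap A₀ Ω₀ J₀) Q₀ Q₁) := by
  have h1 : ∀ v, orthMap A₁ Ω₁ J₁ (adjust B c J₀ J₁ K (orthMap A₀ Ω₀ J₀) Q₀ Q₁ v) =
      c • orthMap A₀ Ω₀ J₀ v := by
    intro v
    set w := v - Q₀ (orthMap A₀ Ω₀ J₀ v) with hw
    have hw0 : orthMap A₀ Ω₀ J₀ w = 0 := by
      have := congrArg (fun C => C (orthMap A₀ Ω₀ J₀ v)) hQ₀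
      simp only [ContinuousLinearMap.comp_apply, ContinuousLinearMap.id_apply] at this
      rw [hw, map_sub, this, sub_self]
    have h2 : adjust B c J₀ J₁ K (orthMap A₀ Ω₀ J₀) Q₀ Q₁ v =
        (B w + (J₁ (K w) - B (J₀ (K w)))) + c • Q₁ (orthMap A₀ Ω₀ J₀ v) := rfl
    have h3 := congrArg (fun C => C (orthMap A₀ Ω₀ J₀ v)) hQ₁
    simp only [ContinuousLinearMap.comp_apply, ContinuousLinearMap.id_apply] at h3
    clear_value w
    rw [h2, map_add, map_add, map_sub, map_smul, h3, hB _ hw0, hJ₁, hB _ (hJ₀ _)]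
    simp
  refine ⟨fun u => ?_, fun v => congrArg Prod.fst (h1 v), fun u v =>
    congrArg (fun g : U →L[ℝ] ℝ => g u) (congrArg Prod.snd (h1 v))⟩
  have h2 : K (J₀ u) = u := congrArg (fun C => C u) hK
  rw [adjust_of_orthMap_eq_zero (hJ₀ u), h2]
  abel

/-- The map with the prescribed values `j₁` and derivatives `A` along an embedding `j₀`. -/
theorem hasFDerivAt_extension {U E E' : Type} [NormedAddCommGroup U] [NormedSpace ℝ U]
    [NormedAddCommGroup E] [NormedSpace ℝ E] [NormedAddCommGroup E'] [NormedSpace ℝ E']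
    {j₀ : U → E} {j₁ : U → E'} {r : E → U} {A : U → E →L[ℝ] E'} {z : U}
    (hj₀ : DifferentiableAt ℝ j₀ z) (hj₁ : DifferentiableAt ℝ j₁ z)
    (hr : DifferentiableAt ℝ r (j₀ z)) (hA : DifferentiableAt ℝ A z) (hrz : r (j₀ z) = z)
    (hcomp : ∀ u, A z (fderiv ℝ j₀ z u) = fderiv ℝ j₁ z u) :
    HasFDerivAt (fun y => j₁ (r y) + A (r y) (y - j₀ (r y))) (A z) (j₀ z) := by
  have h1 : HasFDerivAt (fun y => j₁ (r y)) _ (j₀ z) :=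
    (show HasFDerivAt j₁ (fderiv ℝ j₁ z) (r (j₀ z)) by rw [hrz]; exact hj₁.hasFDerivAt).comp _
      hr.hasFDerivAt
  have h2 : HasFDerivAt (fun y => j₀ (r y)) _ (j₀ z) :=
    (show HasFDerivAt j₀ (fderiv ℝ j₀ z) (r (j₀ z)) by rw [hrz]; exact hj₀.hasFDerivAt).comp _
      hr.hasFDerivAt
  have h3 : HasFDerivAt (fun y => A (r y)) _ (j₀ z) :=
    (show HasFDerivAt A (fderiv ℝ A z) (r (j₀ z)) by rw [hrz]; exact hA.hasFDerivAt).comp _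
      hr.hasFDerivAt
  -- The derivative of `A ∘ r` is applied to zero, and the two terms passing through the derivative
  -- of `r` cancel by `hcomp`.
  refine (h1.add (h3.clm_apply ((hasFDerivAt_id (j₀ z)).sub h2))).congr_fderiv ?_
  ext v
  simp [hrz, hcomp]

end Adjust

/-! ### Injectivity of the derivative of an immersion -/

section Immersion

variable {k m : ℕ}
  {L : Type*} [TopologicalSpace L] [ChartedSpace (EuclideanSpace ℝ (Fin k)) L]
  [IsManifold (𝓡 k) ∞ L]
  {M : Type*} [TopologicalSpace M] [ChartedSpace (EuclideanSpace ℝ (Fin m)) M]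
  [IsManifold (𝓡 m) ∞ M]

/-- The normal form of an immersion gives a smooth local left inverse: pass to the codomain chart,
project to the first factor, and return by the domain chart. The chain rule does the rest. -/
theorem mfd_injective_of_isImmersionAt {f : L → M} {x : L}
    (hf : Manifold.IsImmersionAt (𝓡 k) (𝓡 m) ∞ f x) (v : EuclideanSpace ℝ (Fin k))
    (hv : mfd k m f x v = 0) : v = 0 := by
  have : hf.domChart ∈ IsManifold.maximalAtlas (𝓡 k) ∞ L := hf.domChart_mem_maximalAtlas
  set φ := hf.domChart.extend (𝓡 k) with hφ
  set κ := hf.codChart.extend (𝓡 m) with hκ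
  have hx : x ∈ hf.domChart.source := hf.mem_domChart_source
  have hxφ : φ x ∈ φ.target :=
    φ.map_source (by rw [hφ, OpenPartialHomeomorph.extend_source]; exact hx)
  set ρ : M → L := fun q => φ.symm (hf.equiv.symm (κ q)).1 with hρ
  have h1 : ∀ᶠ y in 𝓝 x, (ρ ∘ f) y = y := by
    filter_upwards [hf.domChart.open_source.mem_nhds hx] with y hy
    have hy' : y ∈ φ.source := by rwa [hφ, OpenPartialHomeomorph.extend_source]
    have h2 : κ (f (φ.symm (φ y))) = hf.equiv (φ y, 0) := hf.writtenInCharts (φ.map_source hy')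
    rw [φ.left_inv hy'] at h2
    rw [Function.comp_apply, hρ]
    simp only [h2, ContinuousLinearEquiv.symm_apply_apply]
    exact φ.left_inv hy'
  have h3 : κ (f x) = hf.equiv (φ x, 0) := by
    have h2 : κ (f (φ.symm (φ x))) = hf.equiv (φ x, 0) := hf.writtenInCharts hxφ
    rwa [φ.left_inv (by rw [hφ, OpenPartialHomeomorph.extend_source]; exact hx)] at h2
  have h4 : ContMDiffAt (𝓡 m) (𝓡 k) ∞ ρ (f x) := by
    have h5 : ContMDiffAt (𝓡 m) 𝓘(ℝ, EuclideanSpace ℝ (Fin m)) ∞ κ (f x) :=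
      OpenPartialHomeomorph.contMDiffAt_extend hf.codChart_mem_maximalAtlas hf.mem_codChart_source
    have h6 : ContMDiffAt 𝓘(ℝ, EuclideanSpace ℝ (Fin m)) 𝓘(ℝ, EuclideanSpace ℝ (Fin k)) ∞
        (fun y => (hf.equiv.symm y).1) (κ (f x)) :=
      (contDiff_fst.comp hf.equiv.symm.contDiff).contDiffAt.contMDiffAt
    have h7 : ContMDiffAt 𝓘(ℝ, EuclideanSpace ℝ (Fin k)) (𝓡 k) ∞ φ.symm
        (hf.equiv.symm (κ (f x))).1 := by
      rw [h3, ContinuousLinearEquiv.symm_apply_apply]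
      refine (contMDiffOn_extend_symm hf.domChart_mem_maximalAtlas).contMDiffAt ?_
      exact ((𝓡 k).toHomeomorph.isOpenMap _ hf.domChart.open_target).mem_nhds
        ⟨hf.domChart x, hf.domChart.map_source hx, rfl⟩
    exact h7.comp (f x) (h6.comp (f x) h5)
  have h8 := mfd_comp hf.contMDiffAt h4
  have h9 : mfd k k (ρ ∘ f) x = ContinuousLinearMap.id ℝ _ :=
    (mfd_congr (g := id) h1).trans mfderiv_id
  have h10 := congrArg (fun B => B v) (h8.symm.trans h9)
  simp only [ContinuousLinearMap.comp_apply, hv, map_zero, ContinuousLinearMap.id_apply] at h10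
  exact h10.symm

end Immersion

/-! ### Gluing maps with prescribed values and convex conditions on the derivative -/

section GlueMaps

variable {l m : ℕ}
  {M : Type*} [TopologicalSpace M] [ChartedSpace (EuclideanSpace ℝ (Fin m)) M]
  [IsManifold (𝓡 m) ∞ M]
  {N : Type*} [TopologicalSpace N] [ChartedSpace (EuclideanSpace ℝ (Fin l)) N]
  [IsManifold (𝓡 l) ∞ N]

/-- The average of two points in a chart. -/
def chartAverage (l : ℕ) {N : Type*} [TopologicalSpace N]
    [ChartedSpace (EuclideanSpace ℝ (Fin l)) N] (q : N) (c : ℝ) (y z : N) : N :=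
  open Classical in if c = 0 then y else if c = 1 then z else
    (extChartAt (𝓡 l) q).symm ((1 - c) • extChartAt (𝓡 l) q y + c • extChartAt (𝓡 l) q z)

/-- For points in the chart the case split in `chartAverage` is invisible; it makes the endpoint
values 0 and 1 exact for points outside the chart too, as the gluing principle needs. -/
theorem chartAverage_eq {q y z : N} (c : ℝ) (hy : y ∈ (extChartAt (𝓡 l) q).source)
    (hz : z ∈ (extChartAt (𝓡 l) q).source) : chartAverage l q c y z =
    (extChartAt (𝓡 l) q).symm ((1 - c) • extChartAt (𝓡 l) q y + c • extChartAt (𝓡 l) q z) := by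
  unfold chartAverage
  split_ifs with h0 h1
  · rw [h0, sub_zero, one_smul, zero_smul, add_zero, (extChartAt (𝓡 l) q).left_inv hy]
  · rw [h1, sub_self, one_smul, zero_smul, zero_add, (extChartAt (𝓡 l) q).left_inv hz]
  · rfl

/-- `f` is a smooth map near `x`, with the value `v x` and a derivative in `𝒜 x`. -/
structure HasOneJetIn (v : M → N)
    (𝒜 : M → Set (EuclideanSpace ℝ (Fin m) →L[ℝ] EuclideanSpace ℝ (Fin l))) (f : M → N)
    (x : M) : Prop where
  smooth : ∀ᶠ z in 𝓝 x, ContMDiffAt (𝓡 m) (𝓡 l) ∞ f z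
  apply_eq : f x = v x
  mfd_mem : mfd m l f x ∈ 𝒜 x

theorem HasOneJetIn.congr {v : M → N}
    {𝒜 : M → Set (EuclideanSpace ℝ (Fin m) →L[ℝ] EuclideanSpace ℝ (Fin l))} {f g : M → N} {x : M}
    (hf : HasOneJetIn v 𝒜 f x) (h : f =ᶠ[𝓝 x] g) : HasOneJetIn v 𝒜 g x := by
  refine ⟨?_, h.self_of_nhds ▸ hf.apply_eq, ?_⟩
  swap
  · have h1 : mfd m l f x = mfd m l g x := h.mfderiv_eq
    exact h1 ▸ hf.mfd_mem
  filter_upwards [h.eventually_nhds, hf.smooth] with z h1 h2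
  exact h2.congr_of_eventuallyEq (EventuallyEq.symm h1)

/-- The derivative of the weight multiplies g - f, which vanishes at `y`. So averaging maps with the
same value averages their derivatives, and convex conditions survive. -/
theorem hasFDerivAt_average {E F : Type} [NormedAddCommGroup E] [NormedSpace ℝ E]
    [NormedAddCommGroup F] [NormedSpace ℝ F] {c : E → ℝ} {f g : E → F} {f' g' : E →L[ℝ] F} {y : E}
    (hc : DifferentiableAt ℝ c y) (hf : HasFDerivAt f f' y) (hg : HasFDerivAt g g' y)
    (hfg : f y = g y) :
    HasFDerivAt (fun z => (1 - c z) • f z + c z • g z) ((1 - c y) • f' + c y • g') y := by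
  refine (((hc.hasFDerivAt.const_sub 1).smul hf).add (hc.hasFDerivAt.smul hg)).congr_fderiv ?_
  ext v
  simp [hfg]
  abel

theorem HasOneJetIn.average {v : M → N}
    {𝒜 : M → Set (EuclideanSpace ℝ (Fin m) →L[ℝ] EuclideanSpace ℝ (Fin l))} {f g : M → N} {x : M}
    (hf : HasOneJetIn v 𝒜 f x) (hg : HasOneJetIn v 𝒜 g x) (h𝒜 : Convex ℝ (𝒜 x)) {q : N}
    (hq : v x ∈ (extChartAt (𝓡 l) q).source) {c : M → ℝ} (hc : ContMDiff (𝓡 m) 𝓘(ℝ, ℝ) ∞ c)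
    (hcI : ∀ y, c y ∈ Icc (0 : ℝ) 1) :
    HasOneJetIn v 𝒜 (fun y => chartAverage l q (c y) (f y) (g y)) x := by
  set κ := extChartAt (𝓡 l) q with hκ
  set w : M → EuclideanSpace ℝ (Fin l) := fun z => (1 - c z) • κ (f z) + c z • κ (g z) with hw
  have hfq : f x ∈ κ.source := hf.apply_eq ▸ hq
  have hgq : g x ∈ κ.source := hg.apply_eq ▸ hq
  have hfs : ∀ᶠ z in 𝓝 x, f z ∈ κ.source :=
    hf.smooth.self_of_nhds.continuousAt.eventually (extChartAt_source_mem_nhds' hfq)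
  have hgs : ∀ᶠ z in 𝓝 x, g z ∈ κ.source :=
    hg.smooth.self_of_nhds.continuousAt.eventually (extChartAt_source_mem_nhds' hgq)
  have hwx : w x = κ (v x) := by
    simp only [hw, hf.apply_eq, hg.apply_eq]
    rw [← add_smul, sub_add_cancel, one_smul]
  have hws : ∀ᶠ z in 𝓝 x, ContMDiffAt (𝓡 m) 𝓘(ℝ, EuclideanSpace ℝ (Fin l)) ∞ w z := by
    filter_upwards [hfs, hgs, hf.smooth, hg.smooth] with z h1 h2 h3 h4
    have h5 : ContMDiffAt (𝓡 m) 𝓘(ℝ, EuclideanSpace ℝ (Fin l)) ∞ (fun z => κ (f z)) z :=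
      (contMDiffAt_extChartAt' (by rwa [hκ, extChartAt_source] at h1)).comp z h3
    have h6 : ContMDiffAt (𝓡 m) 𝓘(ℝ, EuclideanSpace ℝ (Fin l)) ∞ (fun z => κ (g z)) z :=
      (contMDiffAt_extChartAt' (by rwa [hκ, extChartAt_source] at h2)).comp z h4
    exact ((contMDiffAt_const.sub hc.contMDiffAt).smul h5).add (hc.contMDiffAt.smul h6)
  have hwt : ∀ᶠ z in 𝓝 x, w z ∈ κ.target :=
    hws.self_of_nhds.continuousAt.eventually
      (extChartAt_target_mem_nhds' (by rw [hwx]; exact κ.map_source hq))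
  have havg : ∀ᶠ z in 𝓝 x, chartAverage l q (c z) (f z) (g z) = κ.symm (w z) := by
    filter_upwards [hfs, hgs] with z h1 h2
    exact chartAverage_eq (c z) h1 h2
  refine HasOneJetIn.congr (f := fun z => κ.symm (w z)) ?_ (EventuallyEq.symm havg)
  have hval : κ.symm (w x) = v x := by rw [hwx, κ.left_inv hq]
  have hsm : ∀ᶠ z in 𝓝 x, ContMDiffAt (𝓡 m) (𝓡 l) ∞ (fun z => κ.symm (w z)) z := by
    filter_upwards [hws, hwt] with z h1 h2
    exact ((contMDiffOn_extChartAt_symm q).contMDiffAt (extChartAt_target_mem_nhds' h2)).comp z h1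
  refine ⟨hsm, hval, ?_⟩
  have hx := mem_extChartAt_source (I := 𝓡 m) x
  have hD : ∀ {h : M → N}, (∀ᶠ z in 𝓝 x, ContMDiffAt (𝓡 m) (𝓡 l) ∞ h z) → h x = v x →
      fderiv ℝ (coord m l x q h) (extChartAt (𝓡 m) x x) =
        (tr l (v x) q (v x)).comp (mfd m l h x) := fun {h} h1 h2 => by
    have := fderiv_coord_eq (f := h) hx (by rw [h2]; exact hq) h1.self_of_nhds
    rw [tr_self hx, ContinuousLinearMap.comp_id, h2] at this
    exact this
  have h3 : coord m l x q (fun z => κ.symm (w z)) =ᶠ[𝓝 (extChartAt (𝓡 m) x x)]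
      fun y => (1 - c ((extChartAt (𝓡 m) x).symm y)) • coord m l x q f y +
        c ((extChartAt (𝓡 m) x).symm y) • coord m l x q g y := by
    filter_upwards [(eventually_extChartAt_symm_iff hx).2 hwt] with y hy
    rw [coord_apply, κ.right_inv hy]
    rfl
  have hcd : DifferentiableAt ℝ (fun y => c ((extChartAt (𝓡 m) x).symm y))
      (extChartAt (𝓡 m) x x) := by
    have h4 : ContMDiffAt 𝓘(ℝ, EuclideanSpace ℝ (Fin m)) 𝓘(ℝ, ℝ) ∞
        (fun y => c ((extChartAt (𝓡 m) x).symm y)) (extChartAt (𝓡 m) x x) :=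
      hc.contMDiffAt.comp _
        ((contMDiffOn_extChartAt_symm x).contMDiffAt (extChartAt_target_mem_nhds x))
    exact h4.contDiffAt.differentiableAt (by simp)
  have h5 := hasFDerivAt_average hcd
    ((contDiffAt_coord hx hfq hf.smooth.self_of_nhds).differentiableAt (by simp)).hasFDerivAt
    ((contDiffAt_coord hx hgq hg.smooth.self_of_nhds).differentiableAt (by simp)).hasFDerivAt
    (by rw [coord_extChartAt hx, coord_extChartAt hx, hf.apply_eq, hg.apply_eq])
  have h6 := h3.fderiv_eq.trans h5.fderiv
  rw [hD hsm hval, hD hf.smooth hf.apply_eq, hD hg.smooth hg.apply_eq, extChartAt_to_inv] at h6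
  have h7 : mfd m l (fun z => κ.symm (w z)) x = (1 - c x) • mfd m l f x + c x • mfd m l g x := by
    ext1 u
    have hv := mem_extChartAt_source (I := 𝓡 l) (v x)
    have h8 := congrArg (fun B => tr l q (v x) (v x) (B u)) h6
    simp only [ContinuousLinearMap.comp_apply, add_apply, smul_apply, map_add, map_smul,
      tr_tr hv hq] at h8
    exact h8
  rw [h7]
  exact h𝒜 hf.mfd_mem hg.mfd_mem (by linarith [(hcI x).2]) (hcI x).1 (by ring)

/-- A smooth map near a compact set with prescribed values and with derivatives in prescribed
convex sets exists if it exists locally. -/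
theorem exists_hasOneJetIn [T2Space M] [Nonempty N] {K : Set M} (hK : IsCompact K) (v : M → N)
    (𝒜 : M → Set (EuclideanSpace ℝ (Fin m) →L[ℝ] EuclideanSpace ℝ (Fin l)))
    (h𝒜 : ∀ p ∈ K, Convex ℝ (𝒜 p))
    (hloc : ∀ p ∈ K, ∃ g : M → N, ContinuousAt g p ∧ g p = v p ∧
      ∀ᶠ x in 𝓝 p, x ∈ K → HasOneJetIn v 𝒜 g x) :
    ∃ f, ∀ p ∈ K, HasOneJetIn v 𝒜 f p := by
  refine exists_of_locally_averaging (m := m) hK (HasOneJetIn v 𝒜) (fun f g p h hf => hf.congr h)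
    fun p hp => ?_
  obtain ⟨g, hgc, hgp, hg⟩ := hloc p hp
  refine ⟨_, hg.and (hgc.eventually (extChartAt_source_mem_nhds (I := 𝓡 l) (g p))), g,
    chartAverage l (g p), by simp [chartAverage], by simp [chartAverage], ?_⟩
  rintro x hxK ⟨h1, h2⟩
  refine ⟨h1 hxK, fun f χ hf hχ hχI => hf.average (h1 hxK) (h𝒜 x hxK) ?_ hχ hχI⟩
  rw [← (h1 hxK).apply_eq]
  exact h2

end GlueMaps

/-! ### Gluing functions with prescribed values -/

section GlueFunctions

variable {m : ℕ} {M : Type*} [TopologicalSpace M] [ChartedSpace (EuclideanSpace ℝ (Fin m)) M]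
  [IsManifold (𝓡 m) ∞ M]

/-- A smooth function near a compact set with prescribed values exists if it exists locally. -/
theorem exists_smooth_function [T2Space M] {K : Set M} (hK : IsCompact K) (v : M → ℝ)
    (hloc : ∀ p ∈ K, ∃ g : M → ℝ, (∀ᶠ x in 𝓝 p, ContMDiffAt (𝓡 m) 𝓘(ℝ, ℝ) ∞ g x) ∧
      ∀ᶠ x in 𝓝 p, x ∈ K → g x = v x) :
    ∃ f : M → ℝ, ∀ p ∈ K, (∀ᶠ x in 𝓝 p, ContMDiffAt (𝓡 m) 𝓘(ℝ, ℝ) ∞ f x) ∧ f p = v p := by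
  refine exists_of_locally_averaging (m := m) hK
    (fun f p => (∀ᶠ x in 𝓝 p, ContMDiffAt (𝓡 m) 𝓘(ℝ, ℝ) ∞ f x) ∧ f p = v p)
    (fun f g p h hf => ⟨?_, h.self_of_nhds ▸ hf.2⟩) fun p hp => ?_
  · filter_upwards [h.eventually_nhds, hf.1] with z h1 h2
    exact h2.congr_of_eventuallyEq (EventuallyEq.symm h1)
  obtain ⟨g, hgs, hg⟩ := hloc p hp
  refine ⟨_, hgs.eventually_nhds.and hg, g, fun c y z => (1 - c) * y + c * z, by simp, by simp, ?_⟩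
  rintro x hxK ⟨h1, h2⟩
  refine ⟨⟨h1, h2 hxK⟩, fun f χ hf hχ _ => ⟨?_, ?_⟩⟩
  · filter_upwards [h1, hf.1] with z h3 h4
    exact ((contMDiffAt_const.sub hχ.contMDiffAt).mul h4).add (hχ.contMDiffAt.mul h3)
  · change (1 - χ x) * f x + χ x * g x = v x
    rw [hf.2, h2 hxK]
    ring

end GlueFunctions

/-! ### Local extension of a map of parametrised submanifolds, compatible with the forms -/

section LocalExtension

variable {U E E' : Type} [NormedAddCommGroup U] [NormedSpace ℝ U] [FiniteDimensional ℝ U]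
  [NormedAddCommGroup E] [NormedSpace ℝ E] [FiniteDimensional ℝ E]
  [NormedAddCommGroup E'] [NormedSpace ℝ E'] [FiniteDimensional ℝ E']

/-- The map defining the symplectic orthogonal complement of the tangent space of a parametrised
submanifold. -/
def orthAlong (a : E → E →L[ℝ] ℝ) (j : U → E) (z : U) : E →L[ℝ] ℝ × (U →L[ℝ] ℝ) :=
  orthMap (a (j z)) (dOne a (j z)) (fderiv ℝ j z)

theorem SmoothNear.orthAlong {a : E → E →L[ℝ] ℝ} {j : U → E} {z : U} (ha : SmoothNear a (j z))
    (hj : SmoothNear j z) : SmoothNear (orthAlong a j) z :=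
  (ha.comp hj).clm_prod ((ha.dOne.comp hj).clm_comp hj.fderiv).flip

/-- The extension of a map between parametrised submanifolds, which is compatible with contact
forms and a given bundle map along the submanifold. -/
theorem exists_local_extension {j₀ : U → E} {j₁ : U → E'} {a₀ : E → E →L[ℝ] ℝ}
    {a₁ : E' → E' →L[ℝ] ℝ} {c : U → ℝ} {B : U → E →L[ℝ] E'} {z₀ : U}
    (hj₀ : SmoothNear j₀ z₀) (hj₁ : SmoothNear j₁ z₀) (ha₀ : SmoothNear a₀ (j₀ z₀))
    (ha₁ : SmoothNear a₁ (j₁ z₀)) (hc : SmoothNear c z₀) (hB : SmoothNear B z₀)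
    (hinj : ∀ v, fderiv ℝ j₀ z₀ v = 0 → v = 0)
    (hs₀ : Function.Surjective (orthAlong a₀ j₀ z₀))
    (hs₁ : Function.Surjective (orthAlong a₁ j₁ z₀))
    (hT₀ : ∀ᶠ z in 𝓝 z₀, ∀ u, orthAlong a₀ j₀ z (fderiv ℝ j₀ z u) = 0)
    (hT₁ : ∀ᶠ z in 𝓝 z₀, ∀ u, orthAlong a₁ j₁ z (fderiv ℝ j₁ z u) = 0)
    (hBV : ∀ᶠ z in 𝓝 z₀, ∀ v, orthAlong a₀ j₀ z v = 0 → orthAlong a₁ j₁ z (B z v) = 0) :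
    ∃ (ψ : E → E') (A : U → E →L[ℝ] E'), SmoothNear ψ (j₀ z₀) ∧ ∀ᶠ z in 𝓝 z₀,
      ψ (j₀ z) = j₁ z ∧ HasFDerivAt ψ (A z) (j₀ z) ∧
      IsAdjusted (a₀ (j₀ z)) (dOne a₀ (j₀ z)) (fderiv ℝ j₀ z) (a₁ (j₁ z)) (dOne a₁ (j₁ z))
        (fderiv ℝ j₁ z) (c z) (A z) ∧
      ∀ v, orthAlong a₀ j₀ z v = 0 →
        ∃ u, A z v = B z v + (fderiv ℝ j₁ z u - B z (fderiv ℝ j₀ z u)) := by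
  have : FiniteDimensional ℝ (U →L[ℝ] ℝ) :=
    (LinearMap.toContinuousLinearMap (𝕜 := ℝ) (E := U) (F' := ℝ)).finiteDimensional
  obtain ⟨r, hr, hrj⟩ := exists_local_retraction hj₀ hinj
  obtain ⟨K, hK, hKJ⟩ := exists_leftInverse_family hj₀.fderiv hinj
  obtain ⟨Q₀, hQ₀, hSQ₀⟩ := exists_rightInverse_family (ha₀.orthAlong hj₀) hs₀
  obtain ⟨Q₁, hQ₁, hSQ₁⟩ := exists_rightInverse_family (ha₁.orthAlong hj₁) hs₁
  set A : U → E →L[ℝ] E' := fun z => adjust (B z) (c z) (fderiv ℝ j₀ z) (fderiv ℝ j₁ z) (K z)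
    (orthAlong a₀ j₀ z) (Q₀ z) (Q₁ z) with hA
  have hAs : SmoothNear A z₀ :=
    ((hB.add ((hj₁.fderiv.sub (hB.clm_comp hj₀.fderiv)).clm_comp hK)).clm_comp
      ((smoothNear_const _ _).sub (hQ₀.clm_comp (ha₀.orthAlong hj₀)))).add
      (hc.smul (hQ₁.clm_comp (ha₀.orthAlong hj₀)))
  have hrz : r (j₀ z₀) = z₀ := hrj.self_of_nhds
  refine ⟨fun y => j₁ (r y) + A (r y) (y - j₀ (r y)), A, ?_, ?_⟩
  · have h1 : SmoothNear (fun y => j₁ (r y)) (j₀ z₀) := SmoothNear.comp (by rwa [hrz]) hr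
    have h2 : SmoothNear (fun y => j₀ (r y)) (j₀ z₀) := SmoothNear.comp (by rwa [hrz]) hr
    have h3 : SmoothNear (fun y => A (r y)) (j₀ z₀) :=
      SmoothNear.comp (g := A) (f := r) (by rwa [hrz]) hr
    exact h1.add (h3.clm_apply ((smoothNear_id _).sub h2))
  filter_upwards [hj₀, hj₁, hAs, hrj, hKJ, hSQ₀, hSQ₁, hT₀, hT₁, hBV,
    hj₀.self_of_nhds.continuousAt.eventually hr] with z h1 h2 h3 h4 h5 h6 h7 h8 h9 h10 h11
  have hadj := isAdjusted_adjust (c := c z) h5 h6 h7 h8 h9 h10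
  refine ⟨by simp [h4], hasFDerivAt_extension (h1.differentiableAt (by simp))
    (h2.differentiableAt (by simp)) (h11.differentiableAt (by simp))
    (h3.differentiableAt (by simp)) h4 hadj.comp_eq, hadj, fun v hv =>
    ⟨K z v, adjust_of_orthMap_eq_zero hv⟩⟩

/-- Independence of frames: compatibility found in coordinates around a base point is carried to the
preferred frames at nearby points. -/
theorem IsAdjusted.transfer {U E E' : Type} [NormedAddCommGroup U] [NormedSpace ℝ U]
    [NormedAddCommGroup E] [NormedSpace ℝ E] [NormedAddCommGroup E'] [NormedSpace ℝ E']
    {A₀ B₀ : E →L[ℝ] ℝ} {Ω₀ Ψ₀ : E →L[ℝ] E →L[ℝ] ℝ} {J₀ I₀ : U →L[ℝ] E}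
    {A₁ B₁ : E' →L[ℝ] ℝ} {Ω₁ Ψ₁ : E' →L[ℝ] E' →L[ℝ] ℝ} {J₁ I₁ : U →L[ℝ] E'} {c : ℝ}
    {A B : E →L[ℝ] E'} (h : IsAdjusted B₀ Ψ₀ I₀ B₁ Ψ₁ I₁ c B)
    {σ : U →L[ℝ] U} {τ₀ : E →L[ℝ] E} {τ₁ : E' →L[ℝ] E'} (hτ : Function.Injective τ₁)
    (hA₀ : ∀ v, B₀ (τ₀ v) = A₀ v) (hΩ₀ : ∀ u v, Ψ₀ (τ₀ u) (τ₀ v) = Ω₀ u v)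
    (hA₁ : ∀ v, B₁ (τ₁ v) = A₁ v) (hΩ₁ : ∀ u v, Ψ₁ (τ₁ u) (τ₁ v) = Ω₁ u v)
    (hJ₀ : ∀ u, I₀ (σ u) = τ₀ (J₀ u)) (hJ₁ : ∀ u, I₁ (σ u) = τ₁ (J₁ u))
    (hB : ∀ v, B (τ₀ v) = τ₁ (A v)) : IsAdjusted A₀ Ω₀ J₀ A₁ Ω₁ J₁ c A := by
  refine ⟨fun u => hτ ?_, fun v => ?_, fun u v => ?_⟩
  · rw [← hB, ← hJ₀, h.comp_eq, hJ₁]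
  · rw [← hA₁, ← hB, h.form_eq, hA₀]
  · rw [← hΩ₁, ← hB, ← hJ₁, h.two_form_eq, hJ₀, hΩ₀]

end LocalExtension

/-! ### The symplectic orthogonal complement in charts -/

section Frames

variable {k m : ℕ}
  {L : Type*} [TopologicalSpace L] [ChartedSpace (EuclideanSpace ℝ (Fin k)) L]
  [IsManifold (𝓡 k) ∞ L]
  {M : Type*} [TopologicalSpace M] [ChartedSpace (EuclideanSpace ℝ (Fin m)) M]
  [IsManifold (𝓡 m) ∞ M]

/-- The exterior derivative of a `1`-form at a point, as a bilinear form on the model space. -/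
def OneForm.dval (α : OneForm m M) (p : M) :
    EuclideanSpace ℝ (Fin m) →L[ℝ] EuclideanSpace ℝ (Fin m) →L[ℝ] ℝ :=
  dOne (chartForm α p) (extChartAt (𝓡 m) p p)

theorem OneForm.extD_apply (α : OneForm m M) (p : M) (u v : EuclideanSpace ℝ (Fin m)) :
    extD α p u v = α.dval p u v := extD_eq_dOne α p u v

theorem OneForm.dval_swap (α : OneForm m M) (p : M) (u v : EuclideanSpace ℝ (Fin m)) :
    α.dval p u v = -α.dval p v u := by
  rw [OneForm.dval, dOne_apply, dOne_apply]
  ring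

theorem chartForm_tr {α : OneForm m M} {p q : M} (hq : p ∈ (extChartAt (𝓡 m) q).source)
    (v : EuclideanSpace ℝ (Fin m)) :
    chartForm α q (extChartAt (𝓡 m) q p) (tr m p q p v) = α.val p v := by
  rw [chartForm_eq hq, ContinuousLinearMap.comp_apply, tr_tr (mem_extChartAt_source p) hq]

theorem dOne_chartForm_tr {α : OneForm m M} {p q : M} (hα : FormSmoothAt α p)
    (hq : p ∈ (extChartAt (𝓡 m) q).source) (u v : EuclideanSpace ℝ (Fin m)) :
    dOne (chartForm α q) (extChartAt (𝓡 m) q p) (tr m p q p u) (tr m p q p v) = α.dval p u v := by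
  have hp := mem_extChartAt_source (I := 𝓡 m) p
  have h := contDiffAt_coord (f := id) hp hq contMDiffAt_id
  rw [OneForm.dval, dOne_congr (chartForm_eventuallyEq hp hq α), dOne_pull h, coord_extChartAt hp]
  · rfl
  · rw [coord_extChartAt hp]
    exact (hα q hq).differentiableAt (by simp)

theorem fderiv_coord_tr {p x : L} (hx : x ∈ (extChartAt (𝓡 k) p).source) {q : M} {f : L → M}
    (hq : f x ∈ (extChartAt (𝓡 m) q).source) (hf : ContMDiffAt (𝓡 k) (𝓡 m) ∞ f x)
    (u : EuclideanSpace ℝ (Fin k)) :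
    fderiv ℝ (coord k m p q f) (extChartAt (𝓡 k) p x) (tr k x p x u) =
      tr m (f x) q (f x) (mfd k m f x u) := by
  rw [fderiv_coord_eq hx hq hf]
  simp only [ContinuousLinearMap.comp_apply, tr_tr (mem_extChartAt_source x) hx]

theorem tr_injective {p q x : M} (hp : x ∈ (extChartAt (𝓡 m) p).source)
    (hq : x ∈ (extChartAt (𝓡 m) q).source) : Function.Injective (tr m p q x) :=
  Function.LeftInverse.injective (g := tr m q p x) (tr_tr hp hq)

/-- The map defining the symplectic orthogonal complement of the tangent space of `L` at `x`. -/
def orthAt (k : ℕ) {m : ℕ} {L M : Type*} [TopologicalSpace L]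
    [ChartedSpace (EuclideanSpace ℝ (Fin k)) L] [TopologicalSpace M]
    [ChartedSpace (EuclideanSpace ℝ (Fin m)) M] (α : OneForm m M) (ι : L → M) (x : L) :
    EuclideanSpace ℝ (Fin m) →L[ℝ] ℝ × (EuclideanSpace ℝ (Fin k) →L[ℝ] ℝ) :=
  orthMap (α.val (ι x)) (α.dval (ι x)) (mfd k m ι x)

theorem orthAt_eq_zero_iff {α : OneForm m M} {ι : L → M} {x : L} {v : EuclideanSpace ℝ (Fin m)} :
    orthAt k α ι x v = 0 ↔ v ∈ symplOrth k α ι x := by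
  rw [orthAt, orthMap_eq_zero_iff]
  refine and_congr Iff.rfl ⟨fun h => ?_, fun h u => ?_⟩
  · rintro _ ⟨u, rfl⟩
    have h1 := h u
    rw [α.dval_swap] at h1
    exact (OneForm.extD_apply α _ _ _).trans (neg_eq_zero.1 h1)
  · rw [α.dval_swap, neg_eq_zero]
    exact (OneForm.extD_apply α _ _ _).symm.trans (h _ ⟨u, rfl⟩)

/-- The kernels of `orthAt` and of its version in charts correspond to each other. -/
theorem orthAlong_tr_iff {α : OneForm m M} {ι : L → M} {x₀ x : L} {p : M}
    (hx : x ∈ (extChartAt (𝓡 k) x₀).source) (hp : ι x ∈ (extChartAt (𝓡 m) p).source)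
    (hα : FormSmoothAt α (ι x)) (hι : ContMDiffAt (𝓡 k) (𝓡 m) ∞ ι x)
    (v : EuclideanSpace ℝ (Fin m)) :
    orthAlong (chartForm α p) (coord k m x₀ p ι) (extChartAt (𝓡 k) x₀ x)
      (tr m (ι x) p (ι x) v) = 0 ↔ orthAt k α ι x v = 0 := by
  rw [orthAlong, orthAt, orthMap_eq_zero_iff, orthMap_eq_zero_iff, coord_extChartAt hx,
    chartForm_tr hp]
  refine and_congr Iff.rfl ⟨fun h u => ?_, fun h u => ?_⟩
  · have := h (tr k x x₀ x u)
    rwa [fderiv_coord_tr hx hp hι, dOne_chartForm_tr hα hp] at this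
  · obtain ⟨u, rfl⟩ := tr_surjective (m := k) (mem_extChartAt_source (I := 𝓡 k) x) hx u
    rw [fderiv_coord_tr hx hp hι, dOne_chartForm_tr hα hp]
    exact h u

end Frames

/-! ### Smoothness of families of maps of tangent spaces in a fixed trivialisation -/

section TangentCoordinates

variable {k m l : ℕ}
  {L : Type*} [TopologicalSpace L] [ChartedSpace (EuclideanSpace ℝ (Fin k)) L]
  [IsManifold (𝓡 k) ∞ L]
  {M : Type*} [TopologicalSpace M] [ChartedSpace (EuclideanSpace ℝ (Fin m)) M]
  [IsManifold (𝓡 m) ∞ M]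
  {N : Type*} [TopologicalSpace N] [ChartedSpace (EuclideanSpace ℝ (Fin l)) N]
  [IsManifold (𝓡 l) ∞ N]

theorem coordChange_eq_tr (p q x : M) :
    (tangentBundleCore (𝓡 m) M).coordChange (achart (EuclideanSpace ℝ (Fin m)) p)
      (achart (EuclideanSpace ℝ (Fin m)) q) x = tr m p q x := by
  rw [tangentBundleCore_coordChange, ModelWithCorners.range_eq_univ, fderivWithin_univ]
  rfl

theorem inTangentCoordinates_eq_tr {f : L → M} {g : L → N}
    {A : L → EuclideanSpace ℝ (Fin m) →L[ℝ] EuclideanSpace ℝ (Fin l)} {x₀ x : L}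
    (hx : f x ∈ (extChartAt (𝓡 m) (f x₀)).source) (hy : g x ∈ (extChartAt (𝓡 l) (g x₀)).source) :
    inTangentCoordinates (𝓡 m) (𝓡 l) f g A x₀ x =
      (tr l (g x) (g x₀) (g x)).comp ((A x).comp (tr m (f x₀) (f x) (f x))) := by
  rw [extChartAt_source] at hx hy
  rw [inTangentCoordinates_eq f g A hx hy, coordChange_eq_tr, coordChange_eq_tr]

theorem contMDiffAt_tr {f : L → M} {x : L} {p q : M} (hf : ContMDiffAt (𝓡 k) (𝓡 m) ∞ f x)
    (hp : f x ∈ (extChartAt (𝓡 m) p).source) (hq : f x ∈ (extChartAt (𝓡 m) q).source) :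
    ContMDiffAt (𝓡 k) 𝓘(ℝ, EuclideanSpace ℝ (Fin m) →L[ℝ] EuclideanSpace ℝ (Fin m)) ∞
      (fun y => tr m p q (f y)) x := by
  have h1 := contDiffAt_fderiv (contDiffAt_coord (f := id) hp hq contMDiffAt_id)
  have h2 : ContMDiffAt (𝓡 k) 𝓘(ℝ, EuclideanSpace ℝ (Fin m)) ∞
      (fun y => extChartAt (𝓡 m) p (f y)) x :=
    (contMDiffAt_extChartAt' (by rwa [extChartAt_source] at hp)).comp x hf
  exact h1.contMDiffAt.comp x h2

/-- Smoothness in the trivialisations around all points implies smoothness in the trivialisation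
around one point. -/
theorem smoothNear_inTangentCoordinates {f : L → M} {g : L → N}
    {A : L → EuclideanSpace ℝ (Fin m) →L[ℝ] EuclideanSpace ℝ (Fin l)} {x₀ : L}
    (hf : ContMDiff (𝓡 k) (𝓡 m) ∞ f) (hg : ContMDiff (𝓡 k) (𝓡 l) ∞ g)
    (hA : ∀ᶠ x in 𝓝 x₀, ContMDiffAt (𝓡 k)
      𝓘(ℝ, EuclideanSpace ℝ (Fin m) →L[ℝ] EuclideanSpace ℝ (Fin l)) ∞
      (inTangentCoordinates (𝓡 m) (𝓡 l) f g A x) x) :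
    SmoothNear (fun y => inTangentCoordinates (𝓡 m) (𝓡 l) f g A x₀
      ((extChartAt (𝓡 k) x₀).symm y)) (extChartAt (𝓡 k) x₀ x₀) := by
  refine (eventually_extChartAt_iff (mem_extChartAt_source x₀)).2 ?_
  have hfs : ∀ x, ∀ᶠ y in 𝓝 x, f y ∈ (extChartAt (𝓡 m) (f x)).source := fun x =>
    hf.continuous.continuousAt.eventually (extChartAt_source_mem_nhds (I := 𝓡 m) (f x))
  have hgs : ∀ x, ∀ᶠ y in 𝓝 x, g y ∈ (extChartAt (𝓡 l) (g x)).source := fun x =>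
    hg.continuous.continuousAt.eventually (extChartAt_source_mem_nhds (I := 𝓡 l) (g x))
  filter_upwards [hA, (hfs x₀).eventually_nhds, (hgs x₀).eventually_nhds,
    extChartAt_source_mem_nhds (I := 𝓡 k) x₀] with x h1 h2 h3 h4
  have h5 : ContMDiffAt (𝓡 k) 𝓘(ℝ, EuclideanSpace ℝ (Fin m) →L[ℝ] EuclideanSpace ℝ (Fin l)) ∞
      (inTangentCoordinates (𝓡 m) (𝓡 l) f g A x₀) x := by
    -- The hypothesis speaks, at each `x`, of the trivialisation centred at `x` itself; composing
    -- with smooth transition derivatives moves it to the one centred at `x₀`.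
    have h6 := (contMDiffAt_tr (hg x) (mem_extChartAt_source (I := 𝓡 l) (g x))
      h3.self_of_nhds).clm_comp (h1.clm_comp (contMDiffAt_tr (hf x) h2.self_of_nhds
        (mem_extChartAt_source (I := 𝓡 m) (f x))))
    refine h6.congr_of_eventuallyEq ?_
    filter_upwards [h2, h3, hfs x, hgs x] with y h7 h8 h9 h10
    rw [inTangentCoordinates_eq_tr h7 h8, inTangentCoordinates_eq_tr h9 h10]
    have h11 := tr_comp (k := l) (mem_extChartAt_source (I := 𝓡 l) (g y)) h10 h8
    have h12 := tr_comp (k := m) h7 h9 (mem_extChartAt_source (I := 𝓡 m) (f y))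
    rw [← h11, ← h12]
    rfl
  have h6 : ContMDiffAt 𝓘(ℝ, EuclideanSpace ℝ (Fin k)) (𝓡 k) ∞ (extChartAt (𝓡 k) x₀).symm
      (extChartAt (𝓡 k) x₀ x) :=
    (contMDiffOn_extChartAt_symm x₀).contMDiffAt
      (extChartAt_target_mem_nhds' ((extChartAt (𝓡 k) x₀).map_source h4))
  have h7 := ContMDiffAt.comp_of_eq h5 h6 ((extChartAt (𝓡 k) x₀).left_inv h4)
  exact h7.contDiffAt

end TangentCoordinates

/-! ### Isotropic immersions and contact forms -/

section Isotropic

variable {k m : ℕ}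
  {L : Type*} [TopologicalSpace L] [ChartedSpace (EuclideanSpace ℝ (Fin k)) L]
  [IsManifold (𝓡 k) ∞ L]
  {L' : Type*} [TopologicalSpace L'] [ChartedSpace (EuclideanSpace ℝ (Fin k)) L']
  [IsManifold (𝓡 k) ∞ L']
  {M : Type*} [TopologicalSpace M] [ChartedSpace (EuclideanSpace ℝ (Fin m)) M]
  [IsManifold (𝓡 m) ∞ M]

/-- `ι` is an isotropic immersion into `(M, ker α)`. -/
structure IsIsotropicImmersion (k : ℕ) {m : ℕ} {L M : Type*} [TopologicalSpace L]
    [ChartedSpace (EuclideanSpace ℝ (Fin k)) L] [TopologicalSpace M]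
    [ChartedSpace (EuclideanSpace ℝ (Fin m)) M] (α : OneForm m M) (ι : L → M) : Prop where
  smooth : ContMDiff (𝓡 k) (𝓡 m) ∞ ι
  injective : ∀ x v, mfd k m ι x v = 0 → v = 0
  isotropic : ∀ x v, α.val (ι x) (mfd k m ι x v) = 0

variable {α : OneForm m M} {ι : L → M}

theorem IsIsotropicEmbedding.isIsotropicImmersion (hι : IsIsotropicEmbedding k α ι) :
    IsIsotropicImmersion k α ι where
  smooth := hι.embedding.contMDiff
  injective x v := mfd_injective_of_isImmersionAt (hι.embedding.isImmersion.isImmersionAt x) v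
  isotropic x v := hι.isotropic x ⟨v, rfl⟩

theorem mfd_diffeomorph_symm (φ : L ≃ₘ⟮𝓡 k, 𝓡 k⟯ L') (x : L) (v : EuclideanSpace ℝ (Fin k)) :
    mfd k k φ.symm (φ x) (mfd k k φ x v) = v := by
  have h1 := mfd_comp (φ.contMDiff x) (φ.symm.contMDiff (φ x))
  have h2 : mfd k k (φ.symm ∘ φ) x = ContinuousLinearMap.id ℝ _ := by
    rw [show (φ.symm ∘ φ : L → L) = id from funext φ.symm_apply_apply]
    exact mfderiv_id
  exact congrArg (fun B => B v) (h1.symm.trans h2)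

theorem mfd_diffeomorph (φ : L ≃ₘ⟮𝓡 k, 𝓡 k⟯ L') (x : L) (v : EuclideanSpace ℝ (Fin k)) :
    mfd k k φ x (mfd k k φ.symm (φ x) v) = v := by
  have := mfd_diffeomorph_symm φ.symm (φ x) v
  rwa [φ.symm_apply_apply] at this

theorem IsIsotropicImmersion.comp {ι : L' → M} (hι : IsIsotropicImmersion k α ι)
    (φ : L ≃ₘ⟮𝓡 k, 𝓡 k⟯ L') : IsIsotropicImmersion k α (ι ∘ φ) := by
  have h1 : ∀ x, mfd k m (ι ∘ φ) x = (mfd k m ι (φ x)).comp (mfd k k φ x) := fun x =>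
    mfd_comp (φ.contMDiff x) (hι.smooth (φ x))
  refine ⟨hι.smooth.comp φ.contMDiff, fun x v hv => ?_, fun x v => ?_⟩
  · rw [h1] at hv
    have h2 : mfd k k φ x v = 0 := hι.injective _ _ hv
    rw [← mfd_diffeomorph_symm φ x v, h2, map_zero]
  · rw [h1]
    exact hι.isotropic _ _

theorem orthAt_comp_eq_zero_iff {ι : L' → M} (hι : ContMDiff (𝓡 k) (𝓡 m) ∞ ι)
    (φ : L ≃ₘ⟮𝓡 k, 𝓡 k⟯ L') {x : L} {v : EuclideanSpace ℝ (Fin m)} :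
    orthAt k α (ι ∘ φ) x v = 0 ↔ v ∈ symplOrth k α ι (φ x) := by
  rw [← orthAt_eq_zero_iff, orthAt, orthAt, orthMap_eq_zero_iff, orthMap_eq_zero_iff,
    mfd_comp (φ.contMDiff x) (hι (φ x))]
  refine and_congr Iff.rfl ⟨fun h u => ?_, fun h u => h _⟩
  have := h (mfd k k φ.symm (φ x) u)
  rwa [ContinuousLinearMap.comp_apply, mfd_diffeomorph] at this

/-- The pullback of α vanishes identically, hence so does its exterior derivative, which is the
pullback of dα. This gives T ⊆ T^⊥. -/
theorem IsIsotropicImmersion.dval_eq_zero (hι : IsIsotropicImmersion k α ι)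
    (hα : ∀ p, FormSmoothAt α p) (x : L) (u v : EuclideanSpace ℝ (Fin k)) :
    α.dval (ι x) (mfd k m ι x u) (mfd k m ι x v) = 0 := by
  rw [← OneForm.extD_apply]
  refine (extD_pullback (Eventually.of_forall hι.smooth) (hα (ι x)) u v).symm.trans ?_
  refine (extD_eq_dOne _ x u v).trans ?_
  have h1 : chartForm (pullback ι α : OneForm k L) x =
      fun _ => (0 : EuclideanSpace ℝ (Fin k) →L[ℝ] ℝ) := by
    funext y
    refine ContinuousLinearMap.ext fun w => ?_
    exact hι.isotropic _ _
  rw [h1, dOne_apply]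
  simp

theorem IsIsotropicImmersion.orthAt_mfd (hι : IsIsotropicImmersion k α ι)
    (hα : ∀ p, FormSmoothAt α p) (x : L) (u : EuclideanSpace ℝ (Fin k)) :
    orthAt k α ι x (mfd k m ι x u) = 0 :=
  orthMap_eq_zero_iff.2 ⟨hι.isotropic x u, fun w => hι.dval_eq_zero hα x w u⟩

theorem IsContactForm.formSmoothAt (hα : IsContactForm α) (p : M) : FormSmoothAt α p :=
  hα.smooth.formSmoothAt p

theorem IsContactForm.val_ne_zero (hα : IsContactForm α) (p : M) : α.val p ≠ 0 := hα.ne_zero p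

theorem IsContactForm.eq_zero (hα : IsContactForm α) {p : M} {u : EuclideanSpace ℝ (Fin m)}
    (hu : α.val p u = 0) (h : ∀ v, α.val p v = 0 → α.dval p u v = 0) : u = 0 :=
  hα.nondegenerate p u hu fun v hv => (α.extD_apply p u v).trans (h v hv)

theorem IsIsotropicImmersion.orthAt_surjective (hι : IsIsotropicImmersion k α ι)
    (hα : IsContactForm α) (x : L) : Function.Surjective (orthAt k α ι x) :=
  orthMap_surjective (hα.val_ne_zero _) (hι.injective x) (hι.isotropic x) fun _ => hα.eq_zero

theorem orthAlong_self (hι : ContMDiff (𝓡 k) (𝓡 m) ∞ ι) (x : L) :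
    orthAlong (chartForm α (ι x)) (coord k m x (ι x) ι) (extChartAt (𝓡 k) x x) =
      orthAt k α ι x := by
  rw [orthAlong, orthAt, coord_extChartAt (mem_extChartAt_source x), chartForm_self,
    mfd_eq_fderiv_coord ((hι x).mdifferentiableAt (by simp))]
  rfl

theorem smoothNear_coord (hι : ContMDiff (𝓡 k) (𝓡 m) ∞ ι) (x : L) :
    SmoothNear (coord k m x (ι x) ι) (extChartAt (𝓡 k) x x) := by
  refine (eventually_extChartAt_iff (mem_extChartAt_source x)).2 ?_
  filter_upwards [extChartAt_source_mem_nhds (I := 𝓡 k) x,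
    hι.continuous.continuousAt.eventually (extChartAt_source_mem_nhds (I := 𝓡 m) (ι x))]
    with y h1 h2
  exact contDiffAt_coord h1 h2 (hι y)

theorem smoothNear_chartForm (hα : ∀ p, FormSmoothAt α p) (p : M) :
    SmoothNear (chartForm α p) (extChartAt (𝓡 m) p p) := by
  refine (eventually_extChartAt_iff (mem_extChartAt_source p)).2 ?_
  filter_upwards [extChartAt_source_mem_nhds (I := 𝓡 m) p] with q hq
  exact hα q p hq

theorem smoothNear_chartFun {H : M → ℝ} {p : M}
    (hH : ∀ᶠ q in 𝓝 p, ContMDiffAt (𝓡 m) 𝓘(ℝ, ℝ) ∞ H q) :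
    SmoothNear (chartFun m H p) (extChartAt (𝓡 m) p p) := by
  refine (eventually_extChartAt_iff (mem_extChartAt_source p)).2 ?_
  filter_upwards [hH, extChartAt_source_mem_nhds (I := 𝓡 m) p] with q h1 h2
  have h3 : ContMDiffAt 𝓘(ℝ, EuclideanSpace ℝ (Fin m)) (𝓡 m) ∞ (extChartAt (𝓡 m) p).symm
      (extChartAt (𝓡 m) p q) :=
    (contMDiffOn_extChartAt_symm p).contMDiffAt
      (extChartAt_target_mem_nhds' ((extChartAt (𝓡 m) p).map_source h2))
  exact (ContMDiffAt.comp_of_eq h1 h3 ((extChartAt (𝓡 m) p).left_inv h2)).contDiffAt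

end Isotropic

/-! ### Admissible derivatives along the submanifold -/

section Admissible

variable {k m : ℕ}
  {L₀ : Type*} [TopologicalSpace L₀] [ChartedSpace (EuclideanSpace ℝ (Fin k)) L₀]
  [IsManifold (𝓡 k) ∞ L₀]
  {L₁ : Type*} [TopologicalSpace L₁] [ChartedSpace (EuclideanSpace ℝ (Fin k)) L₁]
  [IsManifold (𝓡 k) ∞ L₁]
  {M₀ : Type*} [TopologicalSpace M₀] [ChartedSpace (EuclideanSpace ℝ (Fin m)) M₀]
  [IsManifold (𝓡 m) ∞ M₀]
  {M₁ : Type*} [TopologicalSpace M₁] [ChartedSpace (EuclideanSpace ℝ (Fin m)) M₁]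
  [IsManifold (𝓡 m) ∞ M₁]
  {α₀ : OneForm m M₀} {α₁ : OneForm m M₁} {ι₀ : L₀ → M₀} {ι₁ : L₁ → M₁} {c : L₀ → ℝ}

/-- The linear map `A : T_{ι₀ x} M₀ → T_{ι₁ (φ x)} M₁` is the derivative, to first order, of a map
with the required properties: it extends the derivative of `φ`, is compatible with the contact forms
and their derivatives, and induces the given map of conformal symplectic normal bundles. -/
structure IsAdmissible (α₀ : OneForm m M₀) (α₁ : OneForm m M₁) (ι₀ : L₀ → M₀) (ι₁ : L₁ → M₁)
    (φ : L₀ → L₁) (c : L₀ → ℝ) (x : L₀) (F : CSN k α₀ ι₀ x →ₗ[ℝ] CSN k α₁ ι₁ (φ x))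
    (A : EuclideanSpace ℝ (Fin m) →L[ℝ] EuclideanSpace ℝ (Fin m)) : Prop where
  adjusted : IsAdjusted (α₀.val (ι₀ x)) (α₀.dval (ι₀ x)) (mfd k m ι₀ x) (α₁.val (ι₁ (φ x)))
    (α₁.dval (ι₁ (φ x))) (mfd k m (ι₁ ∘ φ) x) (c x) A
  induces : InducesOnCSN α₀ α₁ ι₀ ι₁ x (φ x) A F

theorem InducesOnCSN.mem {x : L₀} {y : L₁} {F : CSN k α₀ ι₀ x →ₗ[ℝ] CSN k α₁ ι₁ y}
    {A : EuclideanSpace ℝ (Fin m) →L[ℝ] EuclideanSpace ℝ (Fin m)}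
    (hA : InducesOnCSN α₀ α₁ ι₀ ι₁ x y A F) {v : EuclideanSpace ℝ (Fin m)}
    (hv : v ∈ symplOrth k α₀ ι₀ x) : A v ∈ symplOrth k α₁ ι₁ y :=
  (hA ⟨v, hv⟩).1

theorem InducesOnCSN.apply_eq {x : L₀} {y : L₁} {F : CSN k α₀ ι₀ x →ₗ[ℝ] CSN k α₁ ι₁ y}
    {A : EuclideanSpace ℝ (Fin m) →L[ℝ] EuclideanSpace ℝ (Fin m)}
    (hA : InducesOnCSN α₀ α₁ ι₀ ι₁ x y A F) {v : EuclideanSpace ℝ (Fin m)}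
    (hv : v ∈ symplOrth k α₀ ι₀ x) : F (CSN.mk ⟨v, hv⟩) = CSN.mk ⟨A v, hA.mem hv⟩ :=
  (hA ⟨v, hv⟩).2

theorem CSN.mk_eq_mk_iff {m : ℕ} {M : Type*} [TopologicalSpace M]
    [ChartedSpace (EuclideanSpace ℝ (Fin m)) M] {α : OneForm m M} {ι : L₀ → M} {x : L₀}
    {u v : EuclideanSpace ℝ (Fin m)}
    {hu : u ∈ symplOrth k α ι x} {hv : v ∈ symplOrth k α ι x} :
    (CSN.mk ⟨u, hu⟩ : CSN k α ι x) = CSN.mk ⟨v, hv⟩ ↔ ∃ w, mfd k m ι x w = u - v := by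
  rw [CSN.mk, CSN.mk, Submodule.Quotient.eq]
  exact Iff.rfl

theorem CSN.mk_eq_zero_iff {m : ℕ} {M : Type*} [TopologicalSpace M]
    [ChartedSpace (EuclideanSpace ℝ (Fin m)) M] {α : OneForm m M} {ι : L₀ → M} {x : L₀}
    {u : EuclideanSpace ℝ (Fin m)} {hu : u ∈ symplOrth k α ι x} :
    (CSN.mk ⟨u, hu⟩ : CSN k α ι x) = 0 ↔ ∃ w, mfd k m ι x w = u := by
  rw [CSN.mk, Submodule.Quotient.mk_eq_zero]
  exact Iff.rfl

/-- A linear map which differs from one which induces `F` by vectors tangent to `L₁` also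
induces `F`. -/
theorem InducesOnCSN.congr {x : L₀} {y : L₁} {F : CSN k α₀ ι₀ x →ₗ[ℝ] CSN k α₁ ι₁ y}
    {A B : EuclideanSpace ℝ (Fin m) →L[ℝ] EuclideanSpace ℝ (Fin m)}
    (hA : InducesOnCSN α₀ α₁ ι₀ ι₁ x y A F) (hι₁ : IsIsotropicImmersion k α₁ ι₁)
    (hα₁ : ∀ p, FormSmoothAt α₁ p)
    (h : ∀ v ∈ symplOrth k α₀ ι₀ x, ∃ u, B v = A v + mfd k m ι₁ y u) :
    InducesOnCSN α₀ α₁ ι₀ ι₁ x y B F := by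
  rintro ⟨v, hv⟩
  obtain ⟨u, hu⟩ := h v hv
  have h1 : mfd k m ι₁ y u ∈ symplOrth k α₁ ι₁ y :=
    orthAt_eq_zero_iff.1 (hι₁.orthAt_mfd hα₁ y u)
  have h2 : B v ∈ symplOrth k α₁ ι₁ y := by
    rw [hu]
    exact Submodule.add_mem _ (hA.mem hv) h1
  refine ⟨h2, (hA.apply_eq hv).trans (CSN.mk_eq_mk_iff.2 ⟨-u, ?_⟩)⟩
  have h3 : mfd k m ι₁ y (-u) = A v - B v := by
    rw [hu, map_neg]
    abel
  exact h3

/-- For `v` in the kernel, the form conditions and c ≠ 0 put `v` in V; injectivity on the normal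
bundle then puts it in T, where the map is the derivative of ι₁ ∘ φ. -/
theorem IsAdmissible.injective (φ : L₀ → L₁) {x : L₀}
    {F : CSN k α₀ ι₀ x ≃ₗ[ℝ] CSN k α₁ ι₁ (φ x)}
    {A : EuclideanSpace ℝ (Fin m) →L[ℝ] EuclideanSpace ℝ (Fin m)}
    (hA : IsAdmissible α₀ α₁ ι₀ ι₁ φ c x F.toLinearMap A) (hc : c x ≠ 0)
    (hι : ∀ v, mfd k m (ι₁ ∘ φ) x v = 0 → v = 0) (v : EuclideanSpace ℝ (Fin m)) (hv : A v = 0) :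
    v = 0 := by
  have h1 : orthAt k α₀ ι₀ x v = 0 := by
    refine orthMap_eq_zero_iff.2 ⟨?_, fun u => ?_⟩
    · have := hA.adjusted.form_eq v
      rw [hv, map_zero] at this
      exact (mul_eq_zero.1 this.symm).resolve_left hc
    · have := hA.adjusted.two_form_eq u v
      rw [hv, map_zero] at this
      exact (mul_eq_zero.1 this.symm).resolve_left hc
  have h2 := orthAt_eq_zero_iff.1 h1
  have h3 : F (CSN.mk ⟨v, h2⟩) = 0 :=
    (hA.induces.apply_eq h2).trans (CSN.mk_eq_zero_iff.2 ⟨0, by rw [map_zero, hv]⟩)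
  obtain ⟨w, rfl⟩ := CSN.mk_eq_zero_iff.1 ((LinearEquiv.map_eq_zero_iff F).1 h3)
  rw [hA.adjusted.comp_eq] at hv
  rw [hι w hv, map_zero]

/-- Each condition is affine in `A`; in the one on 2-forms, one argument is the fixed tangent vector
of L₁ rather than an image under `A`. This is what makes gluing possible. -/
theorem convex_isAdmissible (φ : L₀ → L₁) (x : L₀) (F : CSN k α₀ ι₀ x →ₗ[ℝ] CSN k α₁ ι₁ (φ x)) :
    Convex ℝ {A | IsAdmissible α₀ α₁ ι₀ ι₁ φ c x F A} := by
  intro A hA B hB a b _ _ hab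
  refine ⟨⟨fun u => ?_, fun v => ?_, fun u v => ?_⟩, ?_⟩
  · rw [add_apply, smul_apply, smul_apply, hA.adjusted.comp_eq, hB.adjusted.comp_eq, ← add_smul,
      hab, one_smul]
  · rw [add_apply, smul_apply, smul_apply, map_add, map_smul, map_smul, hA.adjusted.form_eq,
      hB.adjusted.form_eq, ← add_smul, hab, one_smul]
  · rw [add_apply, smul_apply, smul_apply, map_add, map_smul, map_smul, hA.adjusted.two_form_eq,
      hB.adjusted.two_form_eq, ← add_smul, hab, one_smul]
  · rintro ⟨v, hv⟩
    have h1 := hA.induces.mem hv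
    have h2 := hB.induces.mem hv
    refine ⟨Submodule.add_mem _ (Submodule.smul_mem _ a h1) (Submodule.smul_mem _ b h2), ?_⟩
    have h3 : (CSN.mk ⟨v, hv⟩ : CSN k α₀ ι₀ x) = a • CSN.mk ⟨v, hv⟩ + b • CSN.mk ⟨v, hv⟩ := by
      rw [← add_smul, hab, one_smul]
    rw [h3, map_add, map_smul, map_smul]
    exact (congrArg₂ (fun p q => a • p + b • q) (hA.induces.apply_eq hv) (hB.induces.apply_eq hv))

/-- A smooth family of linear maps of conformal symplectic normal bundles is induced, in charts, by a
smooth family of linear maps. -/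
theorem IsSmoothCSNFamily.exists_smoothNear {φ : L₀ → L₁}
    {Φ : ∀ x, CSN k α₀ ι₀ x →ₗ[ℝ] CSN k α₁ ι₁ (φ x)}
    (hΦ : IsSmoothCSNFamily (𝓡 k) α₀ α₁ ι₀ ι₁ id φ univ Φ) (hι₀ : ContMDiff (𝓡 k) (𝓡 m) ∞ ι₀)
    (hι₁ : ContMDiff (𝓡 k) (𝓡 m) ∞ (ι₁ ∘ φ)) (x₀ : L₀) :
    ∃ (A : L₀ → EuclideanSpace ℝ (Fin m) →L[ℝ] EuclideanSpace ℝ (Fin m))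
      (B : EuclideanSpace ℝ (Fin k) → EuclideanSpace ℝ (Fin m) →L[ℝ] EuclideanSpace ℝ (Fin m)),
      SmoothNear B (extChartAt (𝓡 k) x₀ x₀) ∧
      (∀ᶠ x in 𝓝 x₀, InducesOnCSN α₀ α₁ ι₀ ι₁ x (φ x) (A x) (Φ x)) ∧
      ∀ᶠ x in 𝓝 x₀, ∀ v, B (extChartAt (𝓡 k) x₀ x) (tr m (ι₀ x) (ι₀ x₀) (ι₀ x) v) =
        tr m (ι₁ (φ x)) (ι₁ (φ x₀)) (ι₁ (φ x)) (A x v) := by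
  obtain ⟨W, hW, A, hAs, hAi⟩ := hΦ x₀ (mem_univ x₀)
  have hA : ∀ᶠ x in 𝓝 x₀, ContMDiffAt (𝓡 k)
      𝓘(ℝ, EuclideanSpace ℝ (Fin m) →L[ℝ] EuclideanSpace ℝ (Fin m)) ∞
      (inTangentCoordinates (𝓡 m) (𝓡 m) ι₀ (ι₁ ∘ φ) A x) x := by
    filter_upwards [eventually_mem_nhds_iff.2 hW] with x hx
    have h1 := hAs x ⟨mem_univ x, mem_of_mem_nhds hx⟩
    exact h1.contMDiffAt (by rwa [univ_inter])
  have h1 := hι₀.continuous.continuousAt.eventually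
    (extChartAt_source_mem_nhds (I := 𝓡 m) (ι₀ x₀))
  have h2 := hι₁.continuous.continuousAt.eventually
    (extChartAt_source_mem_nhds (I := 𝓡 m) ((ι₁ ∘ φ) x₀))
  refine ⟨A, _, smoothNear_inTangentCoordinates hι₀ hι₁ hA, ?_, ?_⟩
  · filter_upwards [hW] with x hx
    exact hAi x ⟨mem_univ x, hx⟩
  · filter_upwards [h1, h2, extChartAt_source_mem_nhds (I := 𝓡 k) x₀] with x h1 h2 h3 v
    have h4 := inTangentCoordinates_eq_tr (A := A) h1 h2
    rw [(extChartAt (𝓡 k) x₀).left_inv h3, h4]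
    have h5 := tr_tr (mem_extChartAt_source (I := 𝓡 m) (ι₀ x)) h1 v
    exact congrArg (fun w => tr m (ι₁ (φ x)) (ι₁ (φ x₀)) (ι₁ (φ x)) (A x w)) h5

/-- The local existence of a map with admissible derivatives. -/
theorem exists_local_admissible (hα₀ : IsContactForm α₀) (hα₁ : IsContactForm α₁)
    (hι₀ : IsIsotropicImmersion k α₀ ι₀) (hι₁ : IsIsotropicImmersion k α₁ ι₁)
    (φ : L₀ ≃ₘ⟮𝓡 k, 𝓡 k⟯ L₁) {Φ : ∀ x, CSN k α₀ ι₀ x →ₗ[ℝ] CSN k α₁ ι₁ (φ x)}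
    (hΦ : IsSmoothCSNFamily (𝓡 k) α₀ α₁ ι₀ ι₁ id φ univ Φ) (hc : ContMDiff (𝓡 k) 𝓘(ℝ, ℝ) ∞ c)
    (x₀ : L₀) : ∃ g : M₀ → M₁, (∀ᶠ q in 𝓝 (ι₀ x₀), ContMDiffAt (𝓡 m) (𝓡 m) ∞ g q) ∧
      ∀ᶠ x in 𝓝 x₀, g (ι₀ x) = ι₁ (φ x) ∧
        IsAdmissible α₀ α₁ ι₀ ι₁ φ c x (Φ x) (mfd m m g (ι₀ x)) := by
  set ι' : L₀ → M₁ := ι₁ ∘ φ with hι'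
  have hι'i : IsIsotropicImmersion k α₁ ι' := hι₁.comp φ
  obtain ⟨A, B, hBs, hAi', hBeq⟩ := hΦ.exists_smoothNear hι₀.smooth hι'i.smooth x₀
  have hx₀ := mem_extChartAt_source (I := 𝓡 k) x₀
  set p₀ := ι₀ x₀
  set p₁ := ι' x₀
  have hs₀ : ∀ᶠ x in 𝓝 x₀, ι₀ x ∈ (extChartAt (𝓡 m) p₀).source :=
    hι₀.smooth.continuous.continuousAt.eventually (extChartAt_source_mem_nhds (I := 𝓡 m) p₀)
  have hs₁ : ∀ᶠ x in 𝓝 x₀, ι' x ∈ (extChartAt (𝓡 m) p₁).source :=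
    hι'i.smooth.continuous.continuousAt.eventually (extChartAt_source_mem_nhds (I := 𝓡 m) p₁)
  have hsx := extChartAt_source_mem_nhds (I := 𝓡 k) x₀
  obtain ⟨ψ, D, hψ, hD⟩ := exists_local_extension (j₀ := coord k m x₀ p₀ ι₀)
    (j₁ := coord k m x₀ p₁ ι') (a₀ := chartForm α₀ p₀) (a₁ := chartForm α₁ p₁)
    (c := chartFun k c x₀) (B := B) (z₀ := extChartAt (𝓡 k) x₀ x₀)
    (smoothNear_coord hι₀.smooth x₀) (smoothNear_coord hι'i.smooth x₀)
    (by rw [coord_extChartAt hx₀]; exact smoothNear_chartForm hα₀.formSmoothAt p₀)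
    (by rw [coord_extChartAt hx₀]; exact smoothNear_chartForm hα₁.formSmoothAt p₁)
    (smoothNear_chartFun (Eventually.of_forall hc)) hBs
    (fun v hv => hι₀.injective x₀ v (by
      rwa [mfd_eq_fderiv_coord ((hι₀.smooth x₀).mdifferentiableAt (by simp))]))
    (by rw [orthAlong_self hι₀.smooth]; exact hι₀.orthAt_surjective hα₀ x₀)
    (by rw [orthAlong_self hι'i.smooth]; exact hι'i.orthAt_surjective hα₁ x₀)
    (by
      refine (eventually_extChartAt_iff hx₀).2 ?_
      filter_upwards [hs₀, hsx] with x h1 h2 u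
      obtain ⟨u, rfl⟩ := tr_surjective (mem_extChartAt_source (I := 𝓡 k) x) h2 u
      rw [fderiv_coord_tr h2 h1 (hι₀.smooth x),
        orthAlong_tr_iff h2 h1 (hα₀.formSmoothAt _) (hι₀.smooth x)]
      exact hι₀.orthAt_mfd hα₀.formSmoothAt x u)
    (by
      refine (eventually_extChartAt_iff hx₀).2 ?_
      filter_upwards [hs₁, hsx] with x h1 h2 u
      obtain ⟨u, rfl⟩ := tr_surjective (mem_extChartAt_source (I := 𝓡 k) x) h2 u
      rw [fderiv_coord_tr h2 h1 (hι'i.smooth x),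
        orthAlong_tr_iff h2 h1 (hα₁.formSmoothAt _) (hι'i.smooth x)]
      exact hι'i.orthAt_mfd hα₁.formSmoothAt x u)
    (by
      refine (eventually_extChartAt_iff hx₀).2 ?_
      filter_upwards [hs₀, hs₁, hsx, hBeq, hAi'] with x h0 h1 h2 h3 h4 v hv
      obtain ⟨v, rfl⟩ := tr_surjective (mem_extChartAt_source (I := 𝓡 m) (ι₀ x)) h0 v
      rw [orthAlong_tr_iff h2 h0 (hα₀.formSmoothAt _) (hι₀.smooth x)] at hv
      rw [h3]
      exact (orthAlong_tr_iff h2 h1 (hα₁.formSmoothAt _) (hι'i.smooth x) _).2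
        ((orthAt_comp_eq_zero_iff hι₁.smooth φ).2 (h4.mem (orthAt_eq_zero_iff.1 hv))))
  rw [coord_extChartAt hx₀] at hψ
  replace hD := (eventually_extChartAt_iff hx₀).1 hD
  have hψp : ψ (extChartAt (𝓡 m) p₀ p₀) = extChartAt (𝓡 m) p₁ p₁ := by
    have := hD.self_of_nhds.1
    rwa [coord_extChartAt hx₀, coord_extChartAt hx₀] at this
  have hψt : ∀ᶠ y in 𝓝 (extChartAt (𝓡 m) p₀ p₀), ψ y ∈ (extChartAt (𝓡 m) p₁).target := by
    have h1 := hψ.self_of_nhds.continuousAt.tendsto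
    rw [hψp] at h1
    exact h1.eventually (extChartAt_target_mem_nhds p₁)
  set g : M₀ → M₁ := fun q => (extChartAt (𝓡 m) p₁).symm (ψ (extChartAt (𝓡 m) p₀ q)) with hg
  have hp₀ := mem_extChartAt_source (I := 𝓡 m) p₀
  have hgs : ∀ᶠ q in 𝓝 p₀, ContMDiffAt (𝓡 m) (𝓡 m) ∞ g q := by
    filter_upwards [(eventually_extChartAt_iff hp₀).1 hψ, (eventually_extChartAt_iff hp₀).1 hψt,
      extChartAt_source_mem_nhds (I := 𝓡 m) p₀] with q h1 h2 h3
    have h4 : ContMDiffAt (𝓡 m) 𝓘(ℝ, EuclideanSpace ℝ (Fin m)) ∞ (extChartAt (𝓡 m) p₀) q :=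
      contMDiffAt_extChartAt' (by rwa [extChartAt_source] at h3)
    exact ((contMDiffOn_extChartAt_symm p₁).contMDiffAt (extChartAt_target_mem_nhds' h2)).comp q
      (h1.contMDiffAt.comp q h4)
  have hgc : ∀ᶠ q in 𝓝 p₀, coord m m p₀ p₁ g =ᶠ[𝓝 (extChartAt (𝓡 m) p₀ q)] ψ := by
    refine (eventually_extChartAt_iff (P := fun y => coord m m p₀ p₁ g =ᶠ[𝓝 y] ψ) hp₀).1 ?_
    refine eventually_eventually_nhds.2 ?_
    filter_upwards [hψt, extChartAt_target_mem_nhds (I := 𝓡 m) p₀] with y h1 h2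
    rw [coord_apply]
    simp only [hg]
    rw [(extChartAt (𝓡 m) p₀).right_inv h2, (extChartAt (𝓡 m) p₁).right_inv h1]
  refine ⟨g, hgs, ?_⟩
  have hι₀c : Tendsto ι₀ (𝓝 x₀) (𝓝 p₀) := hι₀.smooth.continuous.continuousAt
  filter_upwards [hs₀, hs₁, hsx, hBeq, hAi', hD, hι₀c.eventually hgs, hι₀c.eventually hgc]
    with x h0 h1 h2 h3 h4 ⟨h5, h6, h7, h8⟩ h9 h10
  have hgx : g (ι₀ x) = ι' x := by
    rw [coord_extChartAt h2, coord_extChartAt h2] at h5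
    simp only [hg]
    rw [h5, (extChartAt (𝓡 m) p₁).left_inv h1]
  have hτ₁ : Function.Injective (tr m (ι' x) p₁ (ι' x)) :=
    tr_injective (mem_extChartAt_source (I := 𝓡 m) (ι' x)) h1
  have hDg : ∀ v, D (extChartAt (𝓡 k) x₀ x) (tr m (ι₀ x) p₀ (ι₀ x) v) =
      tr m (ι' x) p₁ (ι' x) (mfd m m g (ι₀ x) v) := fun v => by
    have h11 := fderiv_coord_tr (f := g) (q := p₁) h0 (by rw [hgx]; exact h1) h9 v
    rw [coord_extChartAt h2] at h6
    rw [h10.fderiv_eq, h6.fderiv, hgx] at h11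
    exact h11
  have hJ₀ : ∀ u, fderiv ℝ (coord k m x₀ p₀ ι₀) (extChartAt (𝓡 k) x₀ x) (tr k x x₀ x u) =
      tr m (ι₀ x) p₀ (ι₀ x) (mfd k m ι₀ x u) := fderiv_coord_tr h2 h0 (hι₀.smooth x)
  have hJ₁ : ∀ u, fderiv ℝ (coord k m x₀ p₁ ι') (extChartAt (𝓡 k) x₀ x) (tr k x x₀ x u) =
      tr m (ι' x) p₁ (ι' x) (mfd k m ι' x u) := fderiv_coord_tr h2 h1 (hι'i.smooth x)
  refine ⟨hgx, ?_, ?_⟩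
  · rw [coord_extChartAt h2, coord_extChartAt h2, chartFun,
      (extChartAt (𝓡 k) x₀).left_inv h2] at h7
    exact h7.transfer hτ₁ (chartForm_tr h0) (dOne_chartForm_tr (hα₀.formSmoothAt _) h0)
      (chartForm_tr h1) (dOne_chartForm_tr (hα₁.formSmoothAt _) h1) hJ₀ hJ₁ hDg
  · suffices H : ∀ v : EuclideanSpace ℝ (Fin m), v ∈ symplOrth k α₀ ι₀ x →
        ∃ u, mfd m m g (ι₀ x) v = A x v + mfd k m ι₁ (φ x) u from h4.congr hι₁ hα₁.formSmoothAt H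
    intro v hv
    obtain ⟨w, hw⟩ := h8 (tr m (ι₀ x) p₀ (ι₀ x) v)
      ((orthAlong_tr_iff h2 h0 (hα₀.formSmoothAt _) (hι₀.smooth x) v).2
        (orthAt_eq_zero_iff.2 hv))
    obtain ⟨w, rfl⟩ := tr_surjective (mem_extChartAt_source (I := 𝓡 k) x) h2 w
    rw [hDg, hJ₀, hJ₁, h3, h3] at hw
    have hw' : mfd m m g (ι₀ x) v = A x v + (mfd k m ι' x w - A x (mfd k m ι₀ x w)) := by
      refine hτ₁ (hw.trans ?_)
      rw [map_add, map_sub]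
      rfl
    have hT : mfd k m ι₀ x w ∈ symplOrth k α₀ ι₀ x :=
      orthAt_eq_zero_iff.1 (hι₀.orthAt_mfd hα₀.formSmoothAt x w)
    -- The adjustment added to `A` on V contains the image of a tangent vector of L₀. That image is
    -- zero in the normal bundle of L₁, so the adjustment is tangent to L₁ and the induced map is
    -- unchanged.
    have h12 : (CSN.mk ⟨A x (mfd k m ι₀ x w), h4.mem hT⟩ : CSN k α₁ ι₁ (φ x)) = 0 := by
      rw [← h4.apply_eq hT, CSN.mk_eq_zero_iff.2 ⟨w, rfl⟩, map_zero]
    obtain ⟨w', hw''⟩ := CSN.mk_eq_zero_iff.1 h12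
    refine ⟨mfd k k φ x w - w', ?_⟩
    have h13 : mfd k m ι' x w = mfd k m ι₁ (φ x) (mfd k k φ x w) :=
      congrArg (fun B => B w) (mfd_comp (φ.contMDiff x) (hι₁.smooth (φ x)))
    rw [hw', map_sub, hw'', h13]

end Admissible

/-! ### Global extension of maps and functions from the submanifold -/

section Global

variable {k m : ℕ}
  {L₀ : Type*} [TopologicalSpace L₀] [ChartedSpace (EuclideanSpace ℝ (Fin k)) L₀]
  [IsManifold (𝓡 k) ∞ L₀]
  {L₁ : Type*} [TopologicalSpace L₁] [ChartedSpace (EuclideanSpace ℝ (Fin k)) L₁]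
  [IsManifold (𝓡 k) ∞ L₁]
  {M₀ : Type*} [TopologicalSpace M₀] [ChartedSpace (EuclideanSpace ℝ (Fin m)) M₀]
  [IsManifold (𝓡 m) ∞ M₀]
  {M₁ : Type*} [TopologicalSpace M₁] [ChartedSpace (EuclideanSpace ℝ (Fin m)) M₁]
  [IsManifold (𝓡 m) ∞ M₁]
  {α₀ : OneForm m M₀} {α₁ : OneForm m M₁} {ι₀ : L₀ → M₀} {ι₁ : L₁ → M₁} {c : L₀ → ℝ}

/-- This is where the topological embedding enters: points of L whose images are near ι x₀ are
themselves near x₀, so distant sheets of L do not interfere. -/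
theorem eventually_of_isEmbedding {X Y : Type*} [TopologicalSpace X] [TopologicalSpace Y]
    {ι : X → Y} (hι : IsEmbedding ι) {x₀ : X} {P : X → Prop} (h : ∀ᶠ x in 𝓝 x₀, P x) :
    ∀ᶠ q in 𝓝 (ι x₀), ∀ x, ι x = q → P x := by
  rw [hι.nhds_eq_comap] at h
  exact eventually_comap.1 h

/-- There is a map with admissible derivatives along `L₀`. -/
theorem exists_admissible_map [T2Space M₀] [CompactSpace L₀] [Nonempty M₁]
    (hα₀ : IsContactForm α₀) (hα₁ : IsContactForm α₁)
    (hι₀ : IsIsotropicEmbedding k α₀ ι₀) (hι₁ : IsIsotropicImmersion k α₁ ι₁)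
    (φ : L₀ ≃ₘ⟮𝓡 k, 𝓡 k⟯ L₁) {Φ : ∀ x, CSN k α₀ ι₀ x →ₗ[ℝ] CSN k α₁ ι₁ (φ x)}
    (hΦ : IsSmoothCSNFamily (𝓡 k) α₀ α₁ ι₀ ι₁ id φ univ Φ) (hc : ContMDiff (𝓡 k) 𝓘(ℝ, ℝ) ∞ c) :
    ∃ ψ : M₀ → M₁, ∀ x, (∀ᶠ q in 𝓝 (ι₀ x), ContMDiffAt (𝓡 m) (𝓡 m) ∞ ψ q) ∧
      ψ (ι₀ x) = ι₁ (φ x) ∧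
      IsAdmissible α₀ α₁ ι₀ ι₁ φ c x (Φ x) (mfd m m ψ (ι₀ x)) := by
  have hemb := hι₀.embedding.isEmbedding
  have hinj := hemb.injective
  set v : M₀ → M₁ := Function.extend ι₀ (ι₁ ∘ φ) fun _ => Classical.arbitrary M₁ with hv
  have hvι : ∀ x, v (ι₀ x) = ι₁ (φ x) := fun x => hinj.extend_apply _ _ x
  -- Off the image of L₀ the condition is empty and the value of `v` is arbitrary; only points of
  -- the image are ever tested.
  set 𝒜 : M₀ → Set (EuclideanSpace ℝ (Fin m) →L[ℝ] EuclideanSpace ℝ (Fin m)) :=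
    fun p => {A | ∀ x, ι₀ x = p → IsAdmissible α₀ α₁ ι₀ ι₁ φ c x (Φ x) A} with h𝒜
  obtain ⟨ψ, hψ⟩ := exists_hasOneJetIn (m := m) (l := m) (K := range ι₀)
    (isCompact_range hι₀.isIsotropicImmersion.smooth.continuous) v 𝒜
    (fun p _ A hA B hB a b ha hb hab x hx =>
      convex_isAdmissible φ x (Φ x) (hA x hx) (hB x hx) ha hb hab) (by
      rintro _ ⟨x₀, rfl⟩
      obtain ⟨g, hg, hgx⟩ := exists_local_admissible hα₀ hα₁ hι₀.isIsotropicImmersion hι₁ φ hΦ hc x₀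
      refine ⟨g, hg.self_of_nhds.continuousAt, by rw [hvι, hgx.self_of_nhds.1], ?_⟩
      filter_upwards [hg.eventually_nhds, eventually_of_isEmbedding hemb hgx] with q h1 h2
      rintro ⟨x, rfl⟩
      refine ⟨h1, by rw [hvι, (h2 x rfl).1], fun y hy => ?_⟩
      have := (h2 y hy).2
      rwa [hy] at this)
  refine ⟨ψ, fun x => ?_⟩
  obtain ⟨h1, h2, h3⟩ := hψ (ι₀ x) ⟨x, rfl⟩
  exact ⟨h1, by rw [h2, hvι], h3 x rfl⟩

/-- A local retraction onto a parametrised submanifold. -/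
theorem exists_manifold_retraction (hι₀ : IsIsotropicImmersion k α₀ ι₀) (x₀ : L₀) :
    ∃ r : EuclideanSpace ℝ (Fin m) → EuclideanSpace ℝ (Fin k),
      SmoothNear r (extChartAt (𝓡 m) (ι₀ x₀) (ι₀ x₀)) ∧
      r (extChartAt (𝓡 m) (ι₀ x₀) (ι₀ x₀)) = extChartAt (𝓡 k) x₀ x₀ ∧
      ∀ᶠ x in 𝓝 x₀, r (extChartAt (𝓡 m) (ι₀ x₀) (ι₀ x)) = extChartAt (𝓡 k) x₀ x := by
  have hx₀ := mem_extChartAt_source (I := 𝓡 k) x₀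
  obtain ⟨r, hr, hrj⟩ := exists_local_retraction (smoothNear_coord hι₀.smooth x₀)
    (fun v hv => hι₀.injective x₀ v (by
      rwa [mfd_eq_fderiv_coord ((hι₀.smooth x₀).mdifferentiableAt (by simp))]))
  rw [coord_extChartAt hx₀] at hr
  have h : ∀ᶠ x in 𝓝 x₀, r (extChartAt (𝓡 m) (ι₀ x₀) (ι₀ x)) = extChartAt (𝓡 k) x₀ x := by
    filter_upwards [(eventually_extChartAt_iff hx₀).1 hrj,
      extChartAt_source_mem_nhds (I := 𝓡 k) x₀] with x h1 h2
    rwa [coord_extChartAt h2] at h1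
  exact ⟨r, hr, h.self_of_nhds, h⟩

/-- A smooth function on a submanifold extends to a function which is smooth near the
submanifold. -/
theorem exists_smooth_extension [T2Space M₀] [CompactSpace L₀]
    (hι₀ : IsIsotropicEmbedding k α₀ ι₀) (hc : ContMDiff (𝓡 k) 𝓘(ℝ, ℝ) ∞ c) :
    ∃ f : M₀ → ℝ, ∀ x, (∀ᶠ q in 𝓝 (ι₀ x), ContMDiffAt (𝓡 m) 𝓘(ℝ, ℝ) ∞ f q) ∧
      f (ι₀ x) = c x := by
  have hemb := hι₀.embedding.isEmbedding
  have hvι : ∀ x, Function.extend ι₀ c 0 (ι₀ x) = c x := fun x => hemb.injective.extend_apply _ _ x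
  obtain ⟨f, hf⟩ := exists_smooth_function (m := m) (K := range ι₀)
    (isCompact_range hι₀.isIsotropicImmersion.smooth.continuous) (Function.extend ι₀ c 0) (by
      rintro _ ⟨x₀, rfl⟩
      obtain ⟨r, hr, hr₀, hrx⟩ := exists_manifold_retraction hι₀.isIsotropicImmersion x₀
      have hp₀ := mem_extChartAt_source (I := 𝓡 m) (ι₀ x₀)
      refine ⟨fun q => c ((extChartAt (𝓡 k) x₀).symm (r (extChartAt (𝓡 m) (ι₀ x₀) q))), ?_, ?_⟩
      · have hrt : ∀ᶠ y in 𝓝 (extChartAt (𝓡 m) (ι₀ x₀) (ι₀ x₀)),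
            r y ∈ (extChartAt (𝓡 k) x₀).target := by
          have h1 := hr.self_of_nhds.continuousAt.tendsto
          rw [hr₀] at h1
          exact h1.eventually (extChartAt_target_mem_nhds x₀)
        filter_upwards [(eventually_extChartAt_iff hp₀).1 hr,
          (eventually_extChartAt_iff hp₀).1 hrt,
          extChartAt_source_mem_nhds (I := 𝓡 m) (ι₀ x₀)] with q h1 h2 h3
        have h4 : ContMDiffAt (𝓡 m) 𝓘(ℝ, EuclideanSpace ℝ (Fin m)) ∞
            (extChartAt (𝓡 m) (ι₀ x₀)) q :=
          contMDiffAt_extChartAt' (by rwa [extChartAt_source] at h3)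
        have h5 : ContMDiffAt 𝓘(ℝ, EuclideanSpace ℝ (Fin k)) (𝓡 k) ∞ (extChartAt (𝓡 k) x₀).symm
            (r (extChartAt (𝓡 m) (ι₀ x₀) q)) :=
          (contMDiffOn_extChartAt_symm x₀).contMDiffAt (extChartAt_target_mem_nhds' h2)
        exact hc.contMDiffAt.comp q (h5.comp q (h1.contMDiffAt.comp q h4))
      · have h1 := hrx.and (extChartAt_source_mem_nhds (I := 𝓡 k) x₀)
        filter_upwards [eventually_of_isEmbedding hemb h1] with q h2
        rintro ⟨x, rfl⟩
        obtain ⟨h3, h4⟩ := h2 x rfl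
        rw [h3, (extChartAt (𝓡 k) x₀).left_inv h4, hvι])
  refine ⟨f, fun x => ?_⟩
  obtain ⟨h1, h2⟩ := hf (ι₀ x) ⟨x, rfl⟩
  exact ⟨h1, by rw [h2, hvι]⟩

end Global

/-! ### Second derivatives at critical points, and the local correction function -/

section Hessian

variable {E : Type} [NormedAddCommGroup E] [NormedSpace ℝ E]

/-- The second derivative of a product of two quantities which vanish at a point. -/
theorem fderiv_fderiv_pairing {b : E → E →L[ℝ] ℝ} {κ : E → E} {y : E} (hb : SmoothNear b y)
    (hκ : SmoothNear κ y) (hby : b y = 0) (hκy : κ y = 0) :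
    fderiv ℝ (fun z => b z (κ z)) y = 0 ∧ ∀ u w,
      fderiv ℝ (fderiv ℝ fun z => b z (κ z)) y u w =
        fderiv ℝ b y w (fderiv ℝ κ y u) + fderiv ℝ b y u (fderiv ℝ κ y w) := by
  have h1 : ∀ᶠ z in 𝓝 y, HasFDerivAt (fun z => b z (κ z))
      ((fderiv ℝ b z).flip (κ z) + (b z).comp (fderiv ℝ κ z)) z := by
    filter_upwards [hb, hκ] with z h1 h2
    refine ((h1.differentiableAt (by simp)).hasFDerivAt.clm_apply
      (h2.differentiableAt (by simp)).hasFDerivAt).congr_fderiv ?_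
    rw [add_comm]
  have h2 : fderiv ℝ (fun z => b z (κ z)) =ᶠ[𝓝 y]
      fun z => (fderiv ℝ b z).flip (κ z) + (b z).comp (fderiv ℝ κ z) := by
    filter_upwards [h1] with z hz
    exact hz.fderiv
  refine ⟨h2.self_of_nhds.trans ?_, fun u w => ?_⟩
  · show (fderiv ℝ b y).flip (κ y) + (b y).comp (fderiv ℝ κ y) = 0
    rw [hby, hκy, map_zero, ContinuousLinearMap.zero_comp, add_zero]
  have h3 : HasFDerivAt (fun z => (fderiv ℝ b z).flip (κ z)) _ y :=
    (hb.fderiv.flip.self_of_nhds.differentiableAt (by simp)).hasFDerivAt.clm_apply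
      (hκ.self_of_nhds.differentiableAt (by simp)).hasFDerivAt
  have h4 : HasFDerivAt (fun z => (b z).comp (fderiv ℝ κ z)) _ y :=
    (hb.self_of_nhds.differentiableAt (by simp)).hasFDerivAt.clm_comp
      (hκ.fderiv.self_of_nhds.differentiableAt (by simp)).hasFDerivAt
  have h5 : HasFDerivAt (fun z => (fderiv ℝ b z).flip (κ z) + (b z).comp (fderiv ℝ κ z)) _ y :=
    h3.add h4
  rw [h2.fderiv_eq, h5.fderiv]
  simp [hby, hκy]

/-- The second derivative of a product with a function which vanishes to first order. -/
theorem fderiv_fderiv_mul {c d : E → ℝ} {y : E} (hc : SmoothNear c y) (hd : SmoothNear d y)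
    (hdy : d y = 0) (hdy' : fderiv ℝ d y = 0) :
    fderiv ℝ (fun z => c z * d z) y = 0 ∧
      fderiv ℝ (fderiv ℝ fun z => c z * d z) y = c y • fderiv ℝ (fderiv ℝ d) y := by
  have h2 : fderiv ℝ (fun z => c z * d z) =ᶠ[𝓝 y]
      fun z => c z • fderiv ℝ d z + d z • fderiv ℝ c z := by
    filter_upwards [hc, hd] with z h1 h2
    exact ((h1.differentiableAt (by simp)).hasFDerivAt.mul
      (h2.differentiableAt (by simp)).hasFDerivAt).fderiv
  refine ⟨h2.self_of_nhds.trans ?_, ?_⟩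
  · show c y • fderiv ℝ d y + d y • fderiv ℝ c y = 0
    rw [hdy, hdy', smul_zero, zero_smul, add_zero]
  have h3 : HasFDerivAt (fun z => c z • fderiv ℝ d z) _ y :=
    (hc.self_of_nhds.differentiableAt (by simp)).hasFDerivAt.smul
      (hd.fderiv.self_of_nhds.differentiableAt (by simp)).hasFDerivAt
  have h4 : HasFDerivAt (fun z => d z • fderiv ℝ c z) _ y :=
    (hd.self_of_nhds.differentiableAt (by simp)).hasFDerivAt.smul
      (hc.fderiv.self_of_nhds.differentiableAt (by simp)).hasFDerivAt
  have h5 : HasFDerivAt (fun z => c z • fderiv ℝ d z + d z • fderiv ℝ c z) _ y := h3.add h4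
  rw [h2.fderiv_eq, h5.fderiv]
  ext u w
  simp [hdy, hdy']

theorem fderiv_fderiv_average {c f g : E → ℝ} {y : E} (hc : SmoothNear c y) (hf : SmoothNear f y)
    (hg : SmoothNear g y) (hfy : f y = 0) (hgy : g y = 0) (hfy' : fderiv ℝ f y = 0)
    (hgy' : fderiv ℝ g y = 0) :
    fderiv ℝ (fun z => (1 - c z) * f z + c z * g z) y = 0 ∧
      fderiv ℝ (fderiv ℝ fun z => (1 - c z) * f z + c z * g z) y =
        (1 - c y) • fderiv ℝ (fderiv ℝ f) y + c y • fderiv ℝ (fderiv ℝ g) y := by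
  have hc' : SmoothNear (fun z => 1 - c z) y := (smoothNear_const (1 : ℝ) y).sub hc
  obtain ⟨h1, h2⟩ := fderiv_fderiv_mul hc' hf hfy hfy'
  obtain ⟨h3, h4⟩ := fderiv_fderiv_mul hc hg hgy hgy'
  have h5 : SmoothNear (fun z => (1 - c z) * f z) y := hc'.smul hf
  have h6 : SmoothNear (fun z => c z * g z) y := hc.smul hg
  have h7 : fderiv ℝ (fun z => (1 - c z) * f z + c z * g z) =ᶠ[𝓝 y]
      fun z => fderiv ℝ (fun z => (1 - c z) * f z) z + fderiv ℝ (fun z => c z * g z) z := by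
    filter_upwards [h5, h6] with z h8 h9
    exact fderiv_add (h8.differentiableAt (by simp)) (h9.differentiableAt (by simp))
  refine ⟨h7.self_of_nhds.trans ?_, ?_⟩
  · show fderiv ℝ (fun z => (1 - c z) * f z) y + fderiv ℝ (fun z => c z * g z) y = 0
    rw [h1, h3, add_zero]
  rw [h7.fderiv_eq, ← h2, ← h4]
  exact fderiv_add (h5.fderiv.self_of_nhds.differentiableAt (by simp))
    (h6.fderiv.self_of_nhds.differentiableAt (by simp))

/-- The local construction of the function used to correct a `1`-form which vanishes along a
submanifold. -/
theorem local_correction {U : Type} [NormedAddCommGroup U] [NormedSpace ℝ U] {j : U → E} {r : E → U}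
    {b : E → E →L[ℝ] ℝ} {z : U} (hj : SmoothNear j z) (hr : SmoothNear r (j z))
    (hb : SmoothNear b (j z)) (hrj : r (j z) = z) (hbj : ∀ᶠ w in 𝓝 z, b (j w) = 0) :
    fderiv ℝ (fun y => -(1 / 2) * b y (y - j (r y))) (j z) = 0 ∧
      ∀ u w, (∀ v, dOne b (j z) u (fderiv ℝ j z v) = 0) →
        (∀ v, dOne b (j z) w (fderiv ℝ j z v) = 0) → dOne b (j z) u w = 0 →
        fderiv ℝ (fderiv ℝ fun y => -(1 / 2) * b y (y - j (r y))) (j z) u w =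
          -fderiv ℝ b (j z) u w := by
  have hs : SmoothNear (fun y => j (r y)) (j z) := SmoothNear.comp (by rwa [hrj]) hr
  have hκ : SmoothNear (fun y => y - j (r y)) (j z) := (smoothNear_id _).sub hs
  have hby : b (j z) = 0 := hbj.self_of_nhds
  obtain ⟨h1, h2⟩ := fderiv_fderiv_pairing hb hκ hby (by rw [hrj, sub_self])
  have hf : SmoothNear (fun y => b y (y - j (r y))) (j z) := hb.clm_apply hκ
  obtain ⟨h3, h4⟩ := fderiv_fderiv_mul (smoothNear_const (-(1 / 2) : ℝ) (j z)) hf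
    (by rw [hby]; rfl) h1
  refine ⟨h3, fun u w hu hw huw => ?_⟩
  rw [h4, smul_apply, smul_apply, h2]
  have h5 : HasFDerivAt (fun y => j (r y)) _ (j z) :=
    (show HasFDerivAt j (fderiv ℝ j z) (r (j z)) by
      rw [hrj]; exact (hj.self_of_nhds.differentiableAt (by simp)).hasFDerivAt).comp _
      (hr.self_of_nhds.differentiableAt (by simp)).hasFDerivAt
  have h6 : ∀ v, fderiv ℝ (fun y => y - j (r y)) (j z) v =
      v - fderiv ℝ j z (fderiv ℝ r (j z) v) := fun v => by
    have h7 : HasFDerivAt (fun y => y - j (r y)) _ (j z) := (hasFDerivAt_id (j z)).sub h5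
    rw [h7.fderiv]
    rfl
  -- Since b vanishes along j, its derivative kills tangent vectors in the first slot; the condition
  -- on `dOne` then kills them in the second slot for the vectors considered.
  have h7 : ∀ v, fderiv ℝ b (j z) (fderiv ℝ j z v) = 0 := fun v => by
    have h8 := (hb.self_of_nhds.differentiableAt (by simp)).hasFDerivAt.comp z
      (hj.self_of_nhds.differentiableAt (by simp)).hasFDerivAt
    have h9 : b ∘ j =ᶠ[𝓝 z] fun _ => 0 := hbj
    have h10 := h8.fderiv.symm.trans h9.fderiv_eq
    have := congrArg (fun B => B v) h10
    simpa using this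
  have h8 : ∀ u, (∀ v, dOne b (j z) u (fderiv ℝ j z v) = 0) → ∀ v,
      fderiv ℝ b (j z) u (fderiv ℝ j z v) = 0 := fun u hu v => by
    have := hu v
    rw [dOne_apply, h7] at this
    simpa using this
  -- What remains is -(Db(w, u) + Db(u, w)) / 2, and db(u, w) = 0 makes the two terms equal. This
  -- explains the factor 1/2.
  rw [h6, h6, map_sub, map_sub, h8 u hu, h8 w hw, smul_eq_mul]
  rw [dOne_apply] at huw
  linarith

end Hessian

/-! ### The Hamiltonian that corrects the 1-form to second order along the submanifold -/

section Correction

variable {k m : ℕ}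
  {L : Type*} [TopologicalSpace L] [ChartedSpace (EuclideanSpace ℝ (Fin k)) L]
  [IsManifold (𝓡 k) ∞ L]
  {M : Type*} [TopologicalSpace M] [ChartedSpace (EuclideanSpace ℝ (Fin m)) M]
  [IsManifold (𝓡 m) ∞ M]
  {α β : OneForm m M} {ι : L → M}

theorem smoothNear_chartForm_of_eventually {p : M} (hβ : ∀ᶠ q in 𝓝 p, FormSmoothAt β q) :
    SmoothNear (chartForm β p) (extChartAt (𝓡 m) p p) := by
  refine (eventually_extChartAt_iff (mem_extChartAt_source p)).2 ?_
  filter_upwards [hβ, extChartAt_source_mem_nhds (I := 𝓡 m) p] with q h1 hq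
  exact h1 p hq

theorem eventually_contMDiffAt_comp_extChartAt {h : EuclideanSpace ℝ (Fin m) → ℝ} {p q : M}
    (hq : q ∈ (extChartAt (𝓡 m) p).source) (hh : SmoothNear h (extChartAt (𝓡 m) p q)) :
    ∀ᶠ z in 𝓝 q, ContMDiffAt (𝓡 m) 𝓘(ℝ, ℝ) ∞ (fun z => h (extChartAt (𝓡 m) p z)) z := by
  filter_upwards [(eventually_extChartAt_iff hq).1 hh,
    extChartAt_source_mem_nhds' (I := 𝓡 m) hq] with z h1 h2
  have h4 : ContMDiffAt (𝓡 m) 𝓘(ℝ, EuclideanSpace ℝ (Fin m)) ∞ (extChartAt (𝓡 m) p) z :=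
    contMDiffAt_extChartAt' (by rwa [extChartAt_source] at h2)
  exact h1.contMDiffAt.comp z h4

theorem chartForm_eq_zero {p q : M} (hq : q ∈ (extChartAt (𝓡 m) p).source) (h : β.val q = 0) :
    chartForm β p (extChartAt (𝓡 m) p q) = 0 := by
  rw [chartForm_eq hq, h, ContinuousLinearMap.zero_comp]

/-- At a point where `β` vanishes, the derivative of `β` does not depend on the chart. -/
theorem fderiv_chartForm_change {p q : M} (hp : p ∈ (extChartAt (𝓡 m) q).source)
    (hβ : FormSmoothAt β p) (h0 : β.val p = 0) (u w : EuclideanSpace ℝ (Fin m)) :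
    fderiv ℝ (chartForm β p) (extChartAt (𝓡 m) p p) u w =
      fderiv ℝ (chartForm β q) (extChartAt (𝓡 m) q p) (tr m p q p u) (tr m p q p w) := by
  have hpp := mem_extChartAt_source (I := 𝓡 m) p
  have h := contDiffAt_coord (f := id) hpp hp contMDiffAt_id
  have h1 : coord m m p q id (extChartAt (𝓡 m) p p) = extChartAt (𝓡 m) q p :=
    coord_extChartAt hpp q id
  rw [(chartForm_eventuallyEq hpp hp β).fderiv_eq,
    fderiv_pull h (by rw [h1]; exact (hβ q hp).differentiableAt (by simp)), h1,
    chartForm_eq_zero hp h0, zero_apply, add_zero]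
  rfl

/-- At a critical point, the second derivative does not depend on the chart. -/
theorem fderiv_chartFun_change {p q : M} (hp : p ∈ (extChartAt (𝓡 m) q).source)
    {h : EuclideanSpace ℝ (Fin m) → ℝ} (hh : SmoothNear h (extChartAt (𝓡 m) q p))
    (h0 : fderiv ℝ h (extChartAt (𝓡 m) q p) = 0) :
    fderiv ℝ (chartFun m (fun z => h (extChartAt (𝓡 m) q z)) p) (extChartAt (𝓡 m) p p) = 0 ∧
      ∀ u w, fderiv ℝ (fderiv ℝ (chartFun m (fun z => h (extChartAt (𝓡 m) q z)) p))
          (extChartAt (𝓡 m) p p) u w =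
        fderiv ℝ (fderiv ℝ h) (extChartAt (𝓡 m) q p) (tr m p q p u) (tr m p q p w) := by
  have hpp := mem_extChartAt_source (I := 𝓡 m) p
  have hc := contDiffAt_coord (f := id) hpp hp contMDiffAt_id
  have h1 : coord m m p q id (extChartAt (𝓡 m) p p) = extChartAt (𝓡 m) q p :=
    coord_extChartAt hpp q id
  have h2 : fderiv ℝ (chartFun m (fun z => h (extChartAt (𝓡 m) q z)) p)
      =ᶠ[𝓝 (extChartAt (𝓡 m) p p)] pull (coord m m p q id) (fderiv ℝ h) := by
    have h3 : ∀ᶠ y in 𝓝 (extChartAt (𝓡 m) p p), ContDiffAt ℝ ∞ h (coord m m p q id y) := by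
      refine hc.continuousAt.eventually ?_
      rw [h1]
      exact hh
    have h4 : SmoothNear (coord m m p q id) (extChartAt (𝓡 m) p p) := by
      refine (eventually_extChartAt_iff hpp).2 ?_
      filter_upwards [extChartAt_source_mem_nhds (I := 𝓡 m) p,
        extChartAt_source_mem_nhds' (I := 𝓡 m) hp] with z h5 h6
      exact contDiffAt_coord h5 h6 contMDiffAt_id
    filter_upwards [h3, h4] with y h4 h5
    exact fderiv_comp y (h4.differentiableAt (by simp)) (h5.differentiableAt (by simp))
  refine ⟨h2.self_of_nhds.trans ?_, fun u w => ?_⟩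
  · rw [pull, h1, h0, ContinuousLinearMap.zero_comp]
  · rw [h2.fderiv_eq,
      fderiv_pull hc (by rw [h1]; exact hh.fderiv.self_of_nhds.differentiableAt (by simp)), h1, h0,
      zero_apply, add_zero]
    rfl

/-- The function `H` vanishes to first order along `L`, and its second derivative cancels the
derivative of `β` on the subsets `V x`. -/
structure IsCorrection (β : OneForm m M) (V : Set (EuclideanSpace ℝ (Fin m)))
    (H : M → ℝ) (p : M) : Prop where
  smooth : ∀ᶠ q in 𝓝 p, ContMDiffAt (𝓡 m) 𝓘(ℝ, ℝ) ∞ H q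
  fun_eq : H p = 0
  fderiv_eq : fderiv ℝ (chartFun m H p) (extChartAt (𝓡 m) p p) = 0
  fderiv_fderiv_eq : ∀ u ∈ V, ∀ w ∈ V,
    fderiv ℝ (fderiv ℝ (chartFun m H p)) (extChartAt (𝓡 m) p p) u w =
      -fderiv ℝ (chartForm β p) (extChartAt (𝓡 m) p p) u w

variable {V : L → Set (EuclideanSpace ℝ (Fin m))}

/-- The local formula is applied in one chart and transferred to the preferred chart at each nearby
point. Both sides are tensorial: the function has critical points along L, and β vanishes there. -/
theorem exists_local_isCorrection (hι : IsIsotropicImmersion k α ι)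
    (hβ : ∀ x, ∀ᶠ q in 𝓝 (ι x), FormSmoothAt β q) (h0 : ∀ x, β.val (ι x) = 0)
    (h1 : ∀ x, ∀ u ∈ V x, ∀ w, β.dval (ι x) u (mfd k m ι x w) = 0)
    (h2 : ∀ x, ∀ u ∈ V x, ∀ w ∈ V x, β.dval (ι x) u w = 0) (x₀ : L) :
    ∃ H : M → ℝ, ∀ᶠ x in 𝓝 x₀, IsCorrection β (V x) H (ι x) := by
  obtain ⟨r, hr, -, hrx⟩ := exists_manifold_retraction hι x₀
  have hx₀ := mem_extChartAt_source (I := 𝓡 k) x₀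
  have hp₀ := mem_extChartAt_source (I := 𝓡 m) (ι x₀)
  have hcont := hι.smooth.continuous.continuousAt (x := x₀)
  set b := chartForm β (ι x₀) with hb
  set j := coord k m x₀ (ι x₀) ι with hj
  refine ⟨fun q => -(1 / 2) * b (extChartAt (𝓡 m) (ι x₀) q)
    (extChartAt (𝓡 m) (ι x₀) q - j (r (extChartAt (𝓡 m) (ι x₀) q))), ?_⟩
  filter_upwards [
    (eventually_extChartAt_iff hx₀).1 (smoothNear_coord hι.smooth x₀).eventually_nhds,
    hcont.eventually ((eventually_extChartAt_iff hp₀).1 hr.eventually_nhds),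
    hcont.eventually ((eventually_extChartAt_iff hp₀).1
      (smoothNear_chartForm_of_eventually (hβ x₀)).eventually_nhds), hrx,
    extChartAt_source_mem_nhds (I := 𝓡 k) x₀,
    hcont.eventually (extChartAt_source_mem_nhds (I := 𝓡 m) (ι x₀))] with x hj₁ hr₁ hb₁ hrj hx hp
  have hjz : j (extChartAt (𝓡 k) x₀ x) = extChartAt (𝓡 m) (ι x₀) (ι x) := coord_extChartAt hx _ _
  have hbj : ∀ᶠ w in 𝓝 (extChartAt (𝓡 k) x₀ x), b (j w) = 0 := by
    refine (eventually_extChartAt_iff hx).2 ?_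
    filter_upwards [extChartAt_source_mem_nhds' (I := 𝓡 k) hx,
      (hι.smooth.continuous.continuousAt (x := x)).eventually
        (extChartAt_source_mem_nhds' (I := 𝓡 m) hp)] with y h3 h4
    rw [hj, coord_extChartAt h3]
    exact chartForm_eq_zero h4 (h0 y)
  obtain ⟨h3, h4⟩ := local_correction (j := j) (r := r) (b := b) hj₁ (by rwa [hjz]) (by rwa [hjz])
    (by rw [hjz, hrj]) hbj
  rw [hjz] at h3
  have hj₂ : SmoothNear j (r (extChartAt (𝓡 m) (ι x₀) (ι x))) := by
    rw [hrj]; exact hj₁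
  have hs : SmoothNear (fun y => -(1 / 2) * b y (y - j (r y)))
      (extChartAt (𝓡 m) (ι x₀) (ι x)) :=
    (smoothNear_const (-(1 / 2) : ℝ) _).smul
      (SmoothNear.clm_apply hb₁ ((smoothNear_id _).sub (SmoothNear.comp hj₂ hr₁)))
  obtain ⟨h5, h6⟩ := fderiv_chartFun_change hp hs h3
  have hby : b (extChartAt (𝓡 m) (ι x₀) (ι x)) = 0 := chartForm_eq_zero hp (h0 x)
  have hT : ∀ u ∈ V x, ∀ v, dOne b (extChartAt (𝓡 m) (ι x₀) (ι x)) (tr m (ι x) (ι x₀) (ι x) u)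
      (fderiv ℝ j (extChartAt (𝓡 k) x₀ x) v) = 0 := by
    intro u hu v
    obtain ⟨v, rfl⟩ := tr_surjective (mem_extChartAt_source (I := 𝓡 k) x) hx v
    rw [hj, fderiv_coord_tr hx hp (hι.smooth x),
      dOne_chartForm_tr (hβ x).self_of_nhds hp]
    exact h1 x u hu v
  refine ⟨eventually_contMDiffAt_comp_extChartAt hp hs, ?_, h5, fun u hu w hw => ?_⟩
  · rw [hby, zero_apply, mul_zero]
  · rw [fderiv_chartForm_change hp (hβ x).self_of_nhds (h0 x)]
    refine (h6 u w).trans ?_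
    rw [hjz] at h4
    refine h4 _ _ (hT u hu) (hT w hw) ?_
    rw [dOne_chartForm_tr (hβ x).self_of_nhds hp]
    exact h2 x u hu w hw

/-- The corrections can be glued. -/
theorem exists_isCorrection [T2Space M] [CompactSpace L] (hι : IsIsotropicEmbedding k α ι)
    (hβ : ∀ x, ∀ᶠ q in 𝓝 (ι x), FormSmoothAt β q) (h0 : ∀ x, β.val (ι x) = 0)
    (h1 : ∀ x, ∀ u ∈ V x, ∀ w, β.dval (ι x) u (mfd k m ι x w) = 0)
    (h2 : ∀ x, ∀ u ∈ V x, ∀ w ∈ V x, β.dval (ι x) u w = 0) :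
    ∃ H : M → ℝ, ∀ x, IsCorrection β (V x) H (ι x) := by
  have hemb := hι.embedding.isEmbedding
  have hcongr : ∀ f g : M → ℝ, ∀ p, f =ᶠ[𝓝 p] g → (∀ x, ι x = p → IsCorrection β (V x) f (ι x)) →
      ∀ x, ι x = p → IsCorrection β (V x) g (ι x) := by
    rintro f g _ hfg hf x rfl
    obtain ⟨h3, h4, h5, h6⟩ := hf x rfl
    have h7 : chartFun m f (ι x) =ᶠ[𝓝 (extChartAt (𝓡 m) (ι x) (ι x))] chartFun m g (ι x) := by
      exact (eventually_extChartAt_symm_iff (P := fun z => f z = g z)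
        (mem_extChartAt_source (I := 𝓡 m) (ι x))).2 hfg
    refine ⟨?_, hfg.self_of_nhds ▸ h4, by rw [← h7.fderiv_eq, h5], fun u hu w hw => ?_⟩
    · filter_upwards [hfg.eventually_nhds, h3] with z h8 h9
      exact h9.congr_of_eventuallyEq (EventuallyEq.symm h8)
    · rw [← h7.fderiv.fderiv_eq]
      exact h6 u hu w hw
  obtain ⟨H, hH⟩ := exists_of_locally_averaging (m := m) (K := range ι)
    (isCompact_range hι.isIsotropicImmersion.smooth.continuous)
    (fun (H : M → ℝ) p => ∀ x, ι x = p → IsCorrection β (V x) H (ι x)) hcongr (by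
      rintro _ ⟨x₀, rfl⟩
      obtain ⟨g, hg⟩ := exists_local_isCorrection hι.isIsotropicImmersion hβ h0 h1 h2 x₀
      refine ⟨_, eventually_of_isEmbedding hemb hg, g, fun c y z => (1 - c) * y + c * z,
        by simp, by simp, ?_⟩
      rintro _ ⟨x, rfl⟩ hxg
      refine ⟨hxg, fun f χ hf hχ _ => ?_⟩
      intro x' hx'
      obtain rfl := hemb.injective hx'
      obtain ⟨f1, f2, f3, f4⟩ := hf x' rfl
      obtain ⟨g1, g2, g3, g4⟩ := hxg x' rfl
      have hpf : chartFun m f (ι x') (extChartAt (𝓡 m) (ι x') (ι x')) = 0 := by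
        rw [chartFun, extChartAt_to_inv, f2]
      have hpg : chartFun m g (ι x') (extChartAt (𝓡 m) (ι x') (ι x')) = 0 := by
        rw [chartFun, extChartAt_to_inv, g2]
      obtain ⟨h3, h4⟩ := fderiv_fderiv_average
        (smoothNear_chartFun (p := ι x') (Eventually.of_forall fun q => hχ.contMDiffAt))
        (smoothNear_chartFun f1) (smoothNear_chartFun g1) hpf hpg f3 g3
      refine ⟨?_, ?_, h3, fun u hu w hw => ?_⟩
      · filter_upwards [f1, g1] with z h3 h4
        exact ((contMDiffAt_const.sub hχ.contMDiffAt).mul h3).add (hχ.contMDiffAt.mul h4)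
      · change (1 - χ (ι x')) * f (ι x') + χ (ι x') * g (ι x') = 0
        rw [f2, g2, mul_zero, mul_zero, add_zero]
      · refine (congrArg (fun B => B u w) h4).trans ?_
        rw [add_apply, add_apply, smul_apply, smul_apply, smul_apply, smul_apply, f4 u hu w hw,
          g4 u hu w hw, smul_eq_mul, smul_eq_mul]
        ring)
  exact ⟨H, fun x => hH _ ⟨x, rfl⟩ x rfl⟩

end Correction

/-! ### Nondegeneracy of 2-forms that agree with a symplectic form on part of the space -/

section LinearAlgebra

variable {E U : Type} [NormedAddCommGroup E] [NormedSpace ℝ E] [NormedAddCommGroup U]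
  [NormedSpace ℝ U] [FiniteDimensional ℝ U]

/-- A linear form which vanishes on the symplectic orthogonal complement of an isotropic subspace is
represented by a vector in the subspace. -/
theorem exists_of_vanishes_on_orth {A : E →L[ℝ] ℝ} {Ω : E →L[ℝ] E →L[ℝ] ℝ} {J : U →L[ℝ] E}
    {g : E →L[ℝ] ℝ} (hg : ∀ v, orthMap A Ω J v = 0 → g v = 0) :
    ∃ r w, ∀ v, g v = r * A v + Ω (J w) v := by
  set e := Module.finBasis ℝ U
  set K : Option (Fin (Module.finrank ℝ U)) → Module.Dual ℝ E :=
    fun o => o.elim A.toLinearMap fun i => (Ω (J (e i))).toLinearMap with hK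
  set R : ℝ × U →ₗ[ℝ] Module.Dual ℝ E :=
    { toFun := fun q => q.1 • A.toLinearMap + (Ω (J q.2)).toLinearMap
      map_add' := fun q q' => by ext v; simp; ring
      map_smul' := fun c q => by ext v; simp; ring } with hR
  have h1 : g.toLinearMap ∈ Submodule.span ℝ (range K) := by
    refine mem_span_of_iInf_ker_le_ker fun v hv => hg v ?_
    rw [Submodule.mem_iInf] at hv
    refine orthMap_eq_zero_iff.2 ⟨hv none, fun u => ?_⟩
    have h2 : (Ω.flip v).comp J = 0 := by
      refine ContinuousLinearMap.coe_injective (e.ext fun i => ?_)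
      exact hv (some i)
    exact congrArg (fun B => B u) h2
  have h2 : Submodule.span ℝ (range K) ≤ LinearMap.range R := by
    rw [Submodule.span_le]
    rintro _ ⟨o, rfl⟩
    cases o with
    | none => exact ⟨(1, 0), by ext v; simp [hR, hK]⟩
    | some i => exact ⟨(0, e i), by ext v; simp [hR, hK]⟩
  obtain ⟨⟨r, w⟩, h3⟩ := h2 h1
  refine ⟨r, w, fun v => ?_⟩
  exact (congrArg (fun B : Module.Dual ℝ E => B v) h3).symm

variable {A : E →L[ℝ] ℝ} {Ω W : E →L[ℝ] E →L[ℝ] ℝ} {J : U →L[ℝ] E} {c : ℝ}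

/-- A vector which is orthogonal, with respect to a form that agrees with the symplectic form to
sufficient order, to the orthogonal complement of an isotropic subspace is in the subspace. -/
theorem exists_eq_of_orthogonal (hc : c ≠ 0)
    (hΩ : ∀ u, A u = 0 → (∀ v, A v = 0 → Ω u v = 0) → u = 0)
    (hJ : ∀ u, orthMap A Ω J (J u) = 0) (hWs : ∀ u v, W u v = -W v u)
    (hWJ : ∀ u v, A v = 0 → W (J u) v = c * Ω (J u) v)
    (hWV : ∀ u v, orthMap A Ω J u = 0 → orthMap A Ω J v = 0 → W u v = c * Ω u v)
    {u : E} (hu : A u = 0) (hW : ∀ v, orthMap A Ω J v = 0 → W u v = 0) : ∃ w, J w = u := by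
  -- Orthogonality to T ⊆ V puts `u` in V. On V the two forms are proportional, so Ω(u, ·) vanishes
  -- on V = T^⊥, and the double orthogonal complement of T is T.
  have h1 : orthMap A Ω J u = 0 := by
    refine orthMap_eq_zero_iff.2 ⟨hu, fun w => ?_⟩
    have h2 := hW _ (hJ w)
    rw [hWs, hWJ w u hu, neg_eq_zero] at h2
    exact (mul_eq_zero.1 h2).resolve_left hc
  obtain ⟨r, w, h3⟩ := exists_of_vanishes_on_orth (g := Ω u) fun v hv => by
    have h4 := hW v hv
    rw [hWV u v h1 hv] at h4
    exact (mul_eq_zero.1 h4).resolve_left hc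
  refine ⟨w, (sub_eq_zero.1 (hΩ (u - J w) ?_ fun v hv => ?_)).symm⟩
  · rw [map_sub, hu, (orthMap_eq_zero_iff.1 (hJ w)).1, sub_zero]
  · rw [map_sub, sub_apply, h3, hv, mul_zero, zero_add, sub_self]

/-- Such a vector is tangent by the preceding argument, and against tangent vectors the two forms
are proportional on all of ker A. -/
theorem eq_zero_of_orthogonal (hc : c ≠ 0)
    (hΩ : ∀ u, A u = 0 → (∀ v, A v = 0 → Ω u v = 0) → u = 0)
    (hJ : ∀ u, orthMap A Ω J (J u) = 0) (hWs : ∀ u v, W u v = -W v u)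
    (hWJ : ∀ u v, A v = 0 → W (J u) v = c * Ω (J u) v)
    (hWV : ∀ u v, orthMap A Ω J u = 0 → orthMap A Ω J v = 0 → W u v = c * Ω u v)
    {u : E} (hu : A u = 0) (hW : ∀ v, A v = 0 → W u v = 0) : u = 0 := by
  obtain ⟨w, rfl⟩ := exists_eq_of_orthogonal hc hΩ hJ hWs hWJ hWV hu fun v hv =>
    hW v (orthMap_eq_zero_iff.1 hv).1
  refine hΩ _ hu fun v hv => ?_
  have h1 := hW v hv
  rw [hWJ w v hv] at h1
  exact (mul_eq_zero.1 h1).resolve_left hc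

end LinearAlgebra

/-! ### Operations on 1-forms and their exterior derivatives -/

section Forms

variable {m : ℕ} {M : Type*} [TopologicalSpace M] [ChartedSpace (EuclideanSpace ℝ (Fin m)) M]
  [IsManifold (𝓡 m) ∞ M] {α β : OneForm m M} {f : M → ℝ} {p : M}

/-- The `1`-form `f α`. -/
def OneForm.smul (f : M → ℝ) (α : OneForm m M) : OneForm m M := fun p => f p • α.val p

/-- The `1`-form `α - β`. -/
def OneForm.sub (α β : OneForm m M) : OneForm m M := fun p => α.val p - β.val p

theorem OneForm.smul_val (f : M → ℝ) (α : OneForm m M) (p : M) :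
    (OneForm.smul f α).val p = f p • α.val p := rfl

theorem OneForm.sub_val (α β : OneForm m M) (p : M) :
    (OneForm.sub α β).val p = α.val p - β.val p := rfl

theorem chartForm_smul (f : M → ℝ) (α : OneForm m M) (p : M) :
    chartForm (OneForm.smul f α) p = fun y => chartFun m f p y • chartForm α p y := rfl

theorem chartForm_sub (α β : OneForm m M) (p : M) :
    chartForm (OneForm.sub α β) p = fun y => chartForm α p y - chartForm β p y := rfl

theorem contDiffAt_chartFun {q : M} (hq : q ∈ (extChartAt (𝓡 m) p).source)
    (hf : ContMDiffAt (𝓡 m) 𝓘(ℝ, ℝ) ∞ f q) :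
    ContDiffAt ℝ ∞ (chartFun m f p) (extChartAt (𝓡 m) p q) := by
  have h3 : ContMDiffAt 𝓘(ℝ, EuclideanSpace ℝ (Fin m)) (𝓡 m) ∞ (extChartAt (𝓡 m) p).symm
      (extChartAt (𝓡 m) p q) :=
    (contMDiffOn_extChartAt_symm p).contMDiffAt
      (extChartAt_target_mem_nhds' ((extChartAt (𝓡 m) p).map_source hq))
  exact (ContMDiffAt.comp_of_eq hf h3 ((extChartAt (𝓡 m) p).left_inv hq)).contDiffAt

theorem FormSmoothAt.smul (hf : ContMDiffAt (𝓡 m) 𝓘(ℝ, ℝ) ∞ f p) (hα : FormSmoothAt α p) :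
    FormSmoothAt (OneForm.smul f α) p := fun q hq => by
  rw [chartForm_smul]
  exact (contDiffAt_chartFun hq hf).smul (hα q hq)

theorem FormSmoothAt.sub (hα : FormSmoothAt α p) (hβ : FormSmoothAt β p) :
    FormSmoothAt (OneForm.sub α β) p := fun q hq => by
  rw [chartForm_sub]
  exact (hα q hq).sub (hβ q hq)

theorem OneForm.dval_sub (hα : FormSmoothAt α p) (hβ : FormSmoothAt β p) :
    (OneForm.sub α β).dval p = α.dval p - β.dval p := by
  have hp := mem_extChartAt_source (I := 𝓡 m) p
  have h1 : fderiv ℝ (chartForm (OneForm.sub α β) p) (extChartAt (𝓡 m) p p) =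
      fderiv ℝ (chartForm α p) (extChartAt (𝓡 m) p p) -
        fderiv ℝ (chartForm β p) (extChartAt (𝓡 m) p p) :=
    (((hα p hp).differentiableAt (by simp)).hasFDerivAt.sub
      ((hβ p hp).differentiableAt (by simp)).hasFDerivAt).fderiv
  ext u v
  rw [OneForm.dval, dOne_apply, h1, sub_apply, sub_apply]
  simp only [OneForm.dval, dOne_apply, sub_apply]
  ring

/-- In d(f α) = df ∧ α + f dα the first term vanishes on ker α. -/
theorem OneForm.dval_smul (hf : ContMDiffAt (𝓡 m) 𝓘(ℝ, ℝ) ∞ f p) (hα : FormSmoothAt α p)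
    {u v : EuclideanSpace ℝ (Fin m)} (hu : α.val p u = 0) (hv : α.val p v = 0) :
    (OneForm.smul f α).dval p u v = f p * α.dval p u v := by
  have hp := mem_extChartAt_source (I := 𝓡 m) p
  have h1 : HasFDerivAt (chartForm (OneForm.smul f α) p) _ (extChartAt (𝓡 m) p p) :=
    ((contDiffAt_chartFun hp hf).differentiableAt (by simp)).hasFDerivAt.smul
      ((hα p hp).differentiableAt (by simp)).hasFDerivAt
  rw [OneForm.dval, dOne_apply, h1.fderiv, chartForm_self]
  have h2 : chartFun m f p (extChartAt (𝓡 m) p p) = f p := by rw [chartFun, extChartAt_to_inv]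
  simp only [add_apply, smul_apply, ContinuousLinearMap.smulRight_apply, hu, hv, h2, OneForm.dval,
    dOne_apply, smul_eq_mul]
  ring

theorem OneForm.dval_pullback {N : Type*} [TopologicalSpace N]
    [ChartedSpace (EuclideanSpace ℝ (Fin m)) N] [IsManifold (𝓡 m) ∞ N] {γ : OneForm m N}
    {ψ : M → N} (hψ : ∀ᶠ q in 𝓝 p, ContMDiffAt (𝓡 m) (𝓡 m) ∞ ψ q)
    (hγ : FormSmoothAt γ (ψ p)) (u v : EuclideanSpace ℝ (Fin m)) :
    (pullback ψ γ : OneForm m M).dval p u v = γ.dval (ψ p) (mfd m m ψ p u) (mfd m m ψ p v) := by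
  rw [← OneForm.extD_apply, ← OneForm.extD_apply]
  exact extD_pullback hψ hγ u v

theorem fderiv_chartFun_eq_zero {H : M → ℝ} {q : M} (hq : q ∈ (extChartAt (𝓡 m) p).source)
    (hH : ContMDiffAt (𝓡 m) 𝓘(ℝ, ℝ) ∞ H q)
    (h : fderiv ℝ (chartFun m H q) (extChartAt (𝓡 m) q q) = 0) :
    fderiv ℝ (chartFun m H p) (extChartAt (𝓡 m) p q) = 0 := by
  have hqq := mem_extChartAt_source (I := 𝓡 m) q
  have h1 : coord m m p q id (extChartAt (𝓡 m) p q) = extChartAt (𝓡 m) q q :=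
    coord_extChartAt hq q id
  rw [(chartFun_eventuallyEq hq hqq H).fderiv_eq, fderiv_comp _
    (by rw [h1]; exact (contDiffAt_chartFun hqq hH).differentiableAt (by simp))
    ((contDiffAt_coord (f := id) hq hqq contMDiffAt_id).differentiableAt (by simp)), h1, h,
    ContinuousLinearMap.zero_comp]

end Forms

/-! ### The discrepancy of a first-order extension satisfies the hypotheses of Moser's method -/

section FirstOrder

variable {k m : ℕ}
  {L₀ : Type*} [TopologicalSpace L₀] [ChartedSpace (EuclideanSpace ℝ (Fin k)) L₀]
  [IsManifold (𝓡 k) ∞ L₀]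
  {L₁ : Type*} [TopologicalSpace L₁] [ChartedSpace (EuclideanSpace ℝ (Fin k)) L₁]
  [IsManifold (𝓡 k) ∞ L₁]
  {M₀ : Type*} [TopologicalSpace M₀] [ChartedSpace (EuclideanSpace ℝ (Fin m)) M₀]
  [IsManifold (𝓡 m) ∞ M₀]
  {M₁ : Type*} [TopologicalSpace M₁] [ChartedSpace (EuclideanSpace ℝ (Fin m)) M₁]
  [IsManifold (𝓡 m) ∞ M₁]
  {α₀ : OneForm m M₀} {α₁ : OneForm m M₁} {ι₀ : L₀ → M₀} {ι₁ : L₁ → M₁} {c : L₀ → ℝ}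
  {φ : L₀ → L₁} {x : L₀} {F : CSN k α₀ ι₀ x →ₗ[ℝ] CSN k α₁ ι₁ (φ x)} {ψ : M₀ → M₁} {f : M₀ → ℝ}

/-- The difference between the pullback of `α₁` and the form `f α₀`. -/
def discrepancy (α₀ : OneForm m M₀) (α₁ : OneForm m M₁) (ψ : M₀ → M₁) (f : M₀ → ℝ) :
    OneForm m M₀ :=
  OneForm.sub (pullback ψ α₁) (OneForm.smul f α₀)

/-- The map `ψ` and the function `f` are, to first order at `ι₀ x`, a conformal symplectic
extension of `φ` and its conformal factor. -/
structure IsFirstOrderExtension (α₀ : OneForm m M₀) (α₁ : OneForm m M₁) (ι₀ : L₀ → M₀)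
    (ι₁ : L₁ → M₁) (φ : L₀ → L₁) (c : L₀ → ℝ) (x : L₀)
    (F : CSN k α₀ ι₀ x →ₗ[ℝ] CSN k α₁ ι₁ (φ x)) (ψ : M₀ → M₁) (f : M₀ → ℝ) : Prop where
  map_smooth : ∀ᶠ q in 𝓝 (ι₀ x), ContMDiffAt (𝓡 m) (𝓡 m) ∞ ψ q
  map_eq : ψ (ι₀ x) = ι₁ (φ x)
  admissible : IsAdmissible α₀ α₁ ι₀ ι₁ φ c x F (mfd m m ψ (ι₀ x))
  factor_smooth : ∀ᶠ q in 𝓝 (ι₀ x), ContMDiffAt (𝓡 m) 𝓘(ℝ, ℝ) ∞ f q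
  factor_eq : f (ι₀ x) = c x
  factor_ne_zero : c x ≠ 0
  conformal : ∀ u v, csnForm k α₁ ι₁ (φ x) (F u) (F v) = c x * csnForm k α₀ ι₀ x u v

namespace IsFirstOrderExtension

variable (h : IsFirstOrderExtension α₀ α₁ ι₀ ι₁ φ c x F ψ f)
include h

theorem discrepancy_val : (discrepancy α₀ α₁ ψ f).val (ι₀ x) = 0 := by
  refine ContinuousLinearMap.ext fun v => ?_
  have h1 := h.admissible.adjusted.form_eq v
  rw [discrepancy, OneForm.sub_val, OneForm.smul_val, pullback_val, sub_apply, smul_apply,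
    ContinuousLinearMap.comp_apply, h.map_eq, h1, h.factor_eq, smul_eq_mul, sub_self, zero_apply]

theorem formSmoothAt_smul (hα₀ : IsContactForm α₀) :
    ∀ᶠ q in 𝓝 (ι₀ x), FormSmoothAt (OneForm.smul f α₀) q := by
  filter_upwards [h.factor_smooth] with q hq
  exact FormSmoothAt.smul hq (hα₀.formSmoothAt q)

theorem formSmoothAt_discrepancy (hα₀ : IsContactForm α₀) (hα₁ : IsContactForm α₁) :
    ∀ᶠ q in 𝓝 (ι₀ x), FormSmoothAt (discrepancy α₀ α₁ ψ f) q := by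
  filter_upwards [h.map_smooth.eventually_nhds, h.formSmoothAt_smul hα₀] with q h1 h2
  exact (formSmoothAt_pullback h1 (mem_extChartAt_source (ψ q))
    (hα₁.formSmoothAt _ _ (mem_extChartAt_source _))).sub h2

theorem discrepancy_dval (hα₀ : IsContactForm α₀) (hα₁ : IsContactForm α₁)
    {u v : EuclideanSpace ℝ (Fin m)} (hu : α₀.val (ι₀ x) u = 0) (hv : α₀.val (ι₀ x) v = 0) :
    (discrepancy α₀ α₁ ψ f).dval (ι₀ x) u v =
      α₁.dval (ι₁ (φ x)) (mfd m m ψ (ι₀ x) u) (mfd m m ψ (ι₀ x) v) -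
        c x * α₀.dval (ι₀ x) u v := by
  rw [discrepancy, OneForm.dval_sub (formSmoothAt_pullback h.map_smooth
      (mem_extChartAt_source (ψ (ι₀ x))) (hα₁.formSmoothAt _ _ (mem_extChartAt_source _)))
      (h.formSmoothAt_smul hα₀).self_of_nhds, sub_apply, sub_apply,
    OneForm.dval_smul h.factor_smooth.self_of_nhds (hα₀.formSmoothAt _) hu hv,
    OneForm.dval_pullback h.map_smooth (hα₁.formSmoothAt _), h.map_eq, h.factor_eq]

theorem discrepancy_dval_tangent (hα₀ : IsContactForm α₀) (hα₁ : IsContactForm α₁)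
    (hι₀ : IsIsotropicImmersion k α₀ ι₀) (w : EuclideanSpace ℝ (Fin k))
    {v : EuclideanSpace ℝ (Fin m)} (hv : α₀.val (ι₀ x) v = 0) :
    (discrepancy α₀ α₁ ψ f).dval (ι₀ x) (mfd k m ι₀ x w) v = 0 := by
  rw [h.discrepancy_dval hα₀ hα₁ (hι₀.isotropic x w) hv, h.admissible.adjusted.comp_eq,
    h.admissible.adjusted.two_form_eq, sub_self]

theorem discrepancy_dval_orth (hα₀ : IsContactForm α₀) (hα₁ : IsContactForm α₁)
    {u v : EuclideanSpace ℝ (Fin m)} (hu : orthAt k α₀ ι₀ x u = 0)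
    (hv : orthAt k α₀ ι₀ x v = 0) : (discrepancy α₀ α₁ ψ f).dval (ι₀ x) u v = 0 := by
  have hu' := orthAt_eq_zero_iff.1 hu
  have hv' := orthAt_eq_zero_iff.1 hv
  have h1 := h.conformal (CSN.mk ⟨u, hu'⟩) (CSN.mk ⟨v, hv'⟩)
  rw [h.admissible.induces.apply_eq hu', h.admissible.induces.apply_eq hv', csnForm_mk,
    csnForm_mk] at h1
  have h2 : α₁.dval (ι₁ (φ x)) (mfd m m ψ (ι₀ x) u) (mfd m m ψ (ι₀ x) v) =
      c x * α₀.dval (ι₀ x) u v := by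
    rw [← OneForm.extD_apply, ← OneForm.extD_apply]
    exact h1
  rw [h.discrepancy_dval hα₀ hα₁ (orthMap_eq_zero_iff.1 hu).1 (orthMap_eq_zero_iff.1 hv).1, h2,
    sub_self]

/-- The discrepancy vanishes at ι₀ x, so the 1-form, and with it the hyperplane, is the same along
the whole path. -/
theorem pathForm_eq (t : ℝ) : pathForm (chartForm (OneForm.smul f α₀) (ι₀ x))
    (chartForm (discrepancy α₀ α₁ ψ f) (ι₀ x)) (t, extChartAt (𝓡 m) (ι₀ x) (ι₀ x)) =
      c x • α₀.val (ι₀ x) := by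
  rw [pathForm, chartForm_self, chartForm_self, h.discrepancy_val, smul_zero, add_zero,
    OneForm.smul_val, h.factor_eq]

theorem pathForm_eq_zero_iff (t : ℝ) (v : EuclideanSpace ℝ (Fin m)) :
    pathForm (chartForm (OneForm.smul f α₀) (ι₀ x)) (chartForm (discrepancy α₀ α₁ ψ f) (ι₀ x))
      (t, extChartAt (𝓡 m) (ι₀ x) (ι₀ x)) v = 0 ↔ α₀.val (ι₀ x) v = 0 := by
  rw [h.pathForm_eq, smul_apply, smul_eq_mul, mul_eq_zero, or_iff_right h.factor_ne_zero]

theorem pathD_eq (hα₀ : IsContactForm α₀) (t : ℝ) {u v : EuclideanSpace ℝ (Fin m)}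
    (hu : α₀.val (ι₀ x) u = 0) (hv : α₀.val (ι₀ x) v = 0) :
    pathD (chartForm (OneForm.smul f α₀) (ι₀ x)) (chartForm (discrepancy α₀ α₁ ψ f) (ι₀ x))
      (t, extChartAt (𝓡 m) (ι₀ x) (ι₀ x)) u v =
      c x * α₀.dval (ι₀ x) u v + t * (discrepancy α₀ α₁ ψ f).dval (ι₀ x) u v := by
  have h1 := OneForm.dval_smul h.factor_smooth.self_of_nhds (hα₀.formSmoothAt _) hu hv
  rw [h.factor_eq] at h1
  rw [← h1]
  rfl

theorem pathD_swap (t : ℝ) (u v : EuclideanSpace ℝ (Fin m)) :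
    pathD (chartForm (OneForm.smul f α₀) (ι₀ x)) (chartForm (discrepancy α₀ α₁ ψ f) (ι₀ x))
      (t, extChartAt (𝓡 m) (ι₀ x) (ι₀ x)) u v =
    -pathD (chartForm (OneForm.smul f α₀) (ι₀ x)) (chartForm (discrepancy α₀ α₁ ψ f) (ι₀ x))
      (t, extChartAt (𝓡 m) (ι₀ x) (ι₀ x)) v u := by
  simp only [pathD, add_apply, smul_apply, dOne_apply, smul_eq_mul]
  ring

theorem pathD_tangent (hα₀ : IsContactForm α₀) (hα₁ : IsContactForm α₁)
    (hι₀ : IsIsotropicImmersion k α₀ ι₀) (t : ℝ) (w : EuclideanSpace ℝ (Fin k))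
    (v : EuclideanSpace ℝ (Fin m)) (hv : α₀.val (ι₀ x) v = 0) :
    pathD (chartForm (OneForm.smul f α₀) (ι₀ x)) (chartForm (discrepancy α₀ α₁ ψ f) (ι₀ x))
      (t, extChartAt (𝓡 m) (ι₀ x) (ι₀ x)) (mfd k m ι₀ x w) v =
      c x * α₀.dval (ι₀ x) (mfd k m ι₀ x w) v := by
  rw [h.pathD_eq hα₀ t (hι₀.isotropic x w) hv, h.discrepancy_dval_tangent hα₀ hα₁ hι₀ w hv,
    mul_zero, add_zero]

theorem pathD_orth (hα₀ : IsContactForm α₀) (hα₁ : IsContactForm α₁) (t : ℝ)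
    (u v : EuclideanSpace ℝ (Fin m)) (hu : orthAt k α₀ ι₀ x u = 0)
    (hv : orthAt k α₀ ι₀ x v = 0) :
    pathD (chartForm (OneForm.smul f α₀) (ι₀ x)) (chartForm (discrepancy α₀ α₁ ψ f) (ι₀ x))
      (t, extChartAt (𝓡 m) (ι₀ x) (ι₀ x)) u v = c x * α₀.dval (ι₀ x) u v := by
  rw [h.pathD_eq hα₀ t (orthMap_eq_zero_iff.1 hu).1 (orthMap_eq_zero_iff.1 hv).1,
    h.discrepancy_dval_orth hα₀ hα₁ hu hv, mul_zero, add_zero]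

/-- The exterior derivative of the discrepancy may be nonzero on ξ₀ × ξ₀, but it vanishes on T × ξ₀
and V × V, which is enough for nondegeneracy for every `t`. -/
theorem moserHyp (hα₀ : IsContactForm α₀) (hα₁ : IsContactForm α₁)
    (hι₀ : IsIsotropicImmersion k α₀ ι₀) {V : Set (EuclideanSpace ℝ (Fin m))} {H : M₀ → ℝ}
    (hH : IsCorrection (discrepancy α₀ α₁ ψ f) V H (ι₀ x)) :
    MoserHyp (OneForm.smul f α₀) (discrepancy α₀ α₁ ψ f) H (ι₀ x) where
  smooth_a := smoothNear_chartForm_of_eventually (h.formSmoothAt_smul hα₀)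
  smooth_b := smoothNear_chartForm_of_eventually (h.formSmoothAt_discrepancy hα₀ hα₁)
  smooth_h := smoothNear_chartFun hH.smooth
  invertible t _ := by
    refine isInvertible_contactSystem ?_ fun u hu huv => ?_
    · rw [h.pathForm_eq]
      exact smul_ne_zero h.factor_ne_zero (hα₀.val_ne_zero _)
    · exact eq_zero_of_orthogonal h.factor_ne_zero (fun _ => hα₀.eq_zero)
        (hι₀.orthAt_mfd hα₀.formSmoothAt x) (h.pathD_swap t) (h.pathD_tangent hα₀ hα₁ hι₀ t)
        (h.pathD_orth hα₀ hα₁ t) ((h.pathForm_eq_zero_iff t u).1 hu) fun v hv =>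
          huv v ((h.pathForm_eq_zero_iff t v).2 hv)
  addD_eq := by
    rw [addD, chartForm_self, h.discrepancy_val, hH.fderiv_eq, add_zero]
  fun_eq := hH.fun_eq
  fderiv_eq := hH.fderiv_eq

/-- The time-one map of Moser's method is the identity, to first order, on the conformal symplectic
normal bundle. -/
theorem exists_mfd_eq_add (hα₀ : IsContactForm α₀) (hα₁ : IsContactForm α₁)
    (hι₀ : IsIsotropicImmersion k α₀ ι₀) (h0 : ∀ y, (discrepancy α₀ α₁ ψ f).val (ι₀ y) = 0)
    {V : L₀ → Set (EuclideanSpace ℝ (Fin m))} (hV : ∀ v, v ∈ V x ↔ orthAt k α₀ ι₀ x v = 0)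
    {H : M₀ → ℝ} (hH : ∀ y, IsCorrection (discrepancy α₀ α₁ ψ f) (V y) H (ι₀ y)) {G : M₀ → M₀}
    (hG : IsMoserMapAt (OneForm.smul f α₀) (discrepancy α₀ α₁ ψ f) H G (ι₀ x))
    {v : EuclideanSpace ℝ (Fin m)} (hv : orthAt k α₀ ι₀ x v = 0) :
    ∃ u, mfd m m G (ι₀ x) v = v + mfd k m ι₀ x u := by
  have hβ := smoothNear_chartForm_of_eventually (h.formSmoothAt_discrepancy hα₀ hα₁)
  have hHs := smoothNear_chartFun (hH x).smooth
  have hx := mem_extChartAt_source (I := 𝓡 k) x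
  have hp := mem_extChartAt_source (I := 𝓡 m) (ι₀ x)
  have hD : fderiv ℝ (addD (chartForm (discrepancy α₀ α₁ ψ f) (ι₀ x)) (chartFun m H (ι₀ x)))
      (extChartAt (𝓡 m) (ι₀ x) (ι₀ x)) =
      fderiv ℝ (chartForm (discrepancy α₀ α₁ ψ f) (ι₀ x)) (extChartAt (𝓡 m) (ι₀ x) (ι₀ x)) +
      fderiv ℝ (fderiv ℝ (chartFun m H (ι₀ x))) (extChartAt (𝓡 m) (ι₀ x) (ι₀ x)) :=
    fderiv_add (hβ.self_of_nhds.differentiableAt (by simp))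
      (hHs.fderiv.self_of_nhds.differentiableAt (by simp))
  have hz : ∀ᶠ z in 𝓝 (extChartAt (𝓡 k) x x),
      addD (chartForm (discrepancy α₀ α₁ ψ f) (ι₀ x)) (chartFun m H (ι₀ x))
        (coord k m x (ι₀ x) ι₀ z) = 0 := by
    refine (eventually_extChartAt_iff hx).2 ?_
    filter_upwards [extChartAt_source_mem_nhds (I := 𝓡 k) x,
      hι₀.smooth.continuous.continuousAt.eventually
        (extChartAt_source_mem_nhds (I := 𝓡 m) (ι₀ x))] with y h1 h2
    rw [coord_extChartAt h1, addD, chartForm_eq_zero h2 (h0 y),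
      fderiv_chartFun_eq_zero h2 (hH y).smooth.self_of_nhds (hH y).fderiv_eq, add_zero]
  have hj : coord k m x (ι₀ x) ι₀ (extChartAt (𝓡 k) x x) = extChartAt (𝓡 m) (ι₀ x) (ι₀ x) :=
    coord_extChartAt hx _ _
  -- The form β + dH vanishes at every point of L₀ near ι₀ x, so its derivative in directions
  -- tangent to L₀ is zero.
  have hT : ∀ w ∈ LinearMap.range (mfd k m ι₀ x).toLinearMap,
      fderiv ℝ (addD (chartForm (discrepancy α₀ α₁ ψ f) (ι₀ x)) (chartFun m H (ι₀ x)))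
        (extChartAt (𝓡 m) (ι₀ x) (ι₀ x)) w = 0 := by
    rintro _ ⟨u, rfl⟩
    have h1 : DifferentiableAt ℝ (addD (chartForm (discrepancy α₀ α₁ ψ f) (ι₀ x))
        (chartFun m H (ι₀ x))) (coord k m x (ι₀ x) ι₀ (extChartAt (𝓡 k) x x)) := by
      rw [hj]
      exact (hβ.self_of_nhds.differentiableAt (by simp)).add
        (hHs.fderiv.self_of_nhds.differentiableAt (by simp))
    have h2 := fderiv_comp _ h1
      ((smoothNear_coord hι₀.smooth x).self_of_nhds.differentiableAt (by simp))
    have h3 : (addD (chartForm (discrepancy α₀ α₁ ψ f) (ι₀ x)) (chartFun m H (ι₀ x))) ∘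
        coord k m x (ι₀ x) ι₀ =ᶠ[𝓝 (extChartAt (𝓡 k) x x)] fun _ => 0 := hz
    rw [h3.fderiv_eq, fderiv_fun_const, hj,
      ← mfd_eq_fderiv_coord ((hι₀.smooth x).mdifferentiableAt (by simp))] at h2
    exact (congrArg (fun B => B u) h2).symm
  obtain ⟨u, hu⟩ := hG.shear (LinearMap.ker (orthAt k α₀ ι₀ x).toLinearMap)
    (LinearMap.range (mfd k m ι₀ x).toLinearMap) hT (by
      intro t _ w hw u hu huv
      -- For w in V the linearised Moser equation makes `u` orthogonal to V, because the Hessian of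
      -- H cancels the derivative of β on V × V; hence `u` is tangent to L₀.
      refine exists_eq_of_orthogonal h.factor_ne_zero (fun _ => hα₀.eq_zero)
        (hι₀.orthAt_mfd hα₀.formSmoothAt x) (h.pathD_swap t) (h.pathD_tangent hα₀ hα₁ hι₀ t)
        (h.pathD_orth hα₀ hα₁ t) ((h.pathForm_eq_zero_iff t u).1 hu) fun v hv => ?_
      rw [huv v ((h.pathForm_eq_zero_iff t v).2 (orthMap_eq_zero_iff.1 hv).1), hD, add_apply,
        add_apply, (hH x).fderiv_fderiv_eq w ((hV w).2 hw) v ((hV v).2 hv), add_neg_cancel,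
        neg_zero]) v hv
  exact ⟨u, (add_eq_of_eq_sub' hu).symm⟩

end IsFirstOrderExtension

end FirstOrder

/-! ### The neighbourhood theorem -/

section Extension

variable {k m : ℕ}
  {L₀ : Type*} [TopologicalSpace L₀] [ChartedSpace (EuclideanSpace ℝ (Fin k)) L₀]
  [IsManifold (𝓡 k) ∞ L₀] [CompactSpace L₀]
  {L₁ : Type*} [TopologicalSpace L₁] [ChartedSpace (EuclideanSpace ℝ (Fin k)) L₁]
  [IsManifold (𝓡 k) ∞ L₁]
  {M₀ : Type*} [TopologicalSpace M₀] [T2Space M₀] [Nonempty M₀]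
  [ChartedSpace (EuclideanSpace ℝ (Fin m)) M₀] [IsManifold (𝓡 m) ∞ M₀]
  {M₁ : Type*} [TopologicalSpace M₁] [T2Space M₁] [Nonempty M₁]
  [ChartedSpace (EuclideanSpace ℝ (Fin m)) M₁] [IsManifold (𝓡 m) ∞ M₁]
  {α₀ : OneForm m M₀} {α₁ : OneForm m M₁} {ι₀ : L₀ → M₀} {ι₁ : L₁ → M₁} {c : L₀ → ℝ}

/-- A map which extends `φ`, is conformal near `L₀`, and induces `Φ`. -/
theorem exists_conformal_map (hα₀ : IsContactForm α₀) (hα₁ : IsContactForm α₁)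
    (hι₀ : IsIsotropicEmbedding k α₀ ι₀) (hι₁ : IsIsotropicEmbedding k α₁ ι₁)
    (φ : L₀ ≃ₘ⟮𝓡 k, 𝓡 k⟯ L₁) {Φ : ∀ x, CSN k α₀ ι₀ x ≃ₗ[ℝ] CSN k α₁ ι₁ (φ x)}
    (hΦ : IsConformalCSNIso α₀ α₁ ι₀ ι₁ φ c Φ) :
    ∃ g : M₀ → M₁, ∀ x, (∀ᶠ q in 𝓝 (ι₀ x), ContMDiffAt (𝓡 m) (𝓡 m) ∞ g q) ∧
      g (ι₀ x) = ι₁ (φ x) ∧ (∀ v, mfd m m g (ι₀ x) v = 0 → v = 0) ∧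
      (∀ᶠ q in 𝓝 (ι₀ x), ∃ r : ℝ, r ≠ 0 ∧ ((∀ x, 0 < c x) → 0 < r) ∧
        ∀ v, α₁.val (g q) (mfd m m g q v) = r * α₀.val q v) ∧
      InducesOnCSN α₀ α₁ ι₀ ι₁ x (φ x) (mfd m m g (ι₀ x)) (Φ x).toLinearMap := by
  have hi₀ := hι₀.isIsotropicImmersion
  have hi₁ := hι₁.isIsotropicImmersion
  obtain ⟨ψ, hψ⟩ := exists_admissible_map hα₀ hα₁ hι₀ hi₁ φ hΦ.smooth hΦ.factor_smooth
  obtain ⟨f, hf⟩ := exists_smooth_extension hι₀ hΦ.factor_smooth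
  have h : ∀ x, IsFirstOrderExtension α₀ α₁ ι₀ ι₁ φ c x (Φ x).toLinearMap ψ f := fun x =>
    { map_smooth := (hψ x).1
      map_eq := (hψ x).2.1
      admissible := (hψ x).2.2
      factor_smooth := (hf x).1
      factor_eq := (hf x).2
      factor_ne_zero := hΦ.factor_ne_zero x
      conformal := hΦ.conformal x }
  obtain ⟨H, hH⟩ := exists_isCorrection (V := fun x => {v | orthAt k α₀ ι₀ x v = 0}) hι₀
    (fun x => (h x).formSmoothAt_discrepancy hα₀ hα₁) (fun x => (h x).discrepancy_val)
    (fun x u hu w => by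
      rw [OneForm.dval_swap, (h x).discrepancy_dval_tangent hα₀ hα₁ hi₀ w
        (orthMap_eq_zero_iff.1 hu).1, neg_zero])
    (fun x u hu v hv => (h x).discrepancy_dval_orth hα₀ hα₁ hu hv)
  obtain ⟨G, hG⟩ := exists_moser_map (K := range ι₀) (H := H)
    (α := OneForm.smul f α₀) (β := discrepancy α₀ α₁ ψ f) (by
      rintro _ ⟨x, rfl⟩
      exact (h x).moserHyp hα₀ hα₁ hi₀ (hH x))
  -- G is the time-one map for the path from f α₀ to ψ*α₁; composing with ψ turns the first-order
  -- extension into a conformal one near L₀.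
  refine ⟨ψ ∘ G, fun x => ?_⟩
  have hGx := hG (ι₀ x) ⟨x, rfl⟩
  have hGc : Tendsto G (𝓝 (ι₀ x)) (𝓝 (ι₀ x)) := by
    have h1 := hGx.smooth.self_of_nhds.continuousAt.tendsto
    rwa [hGx.fixed] at h1
  have hψG := hGc.eventually (h x).map_smooth
  have hmfd : mfd m m (ψ ∘ G) (ι₀ x) = (mfd m m ψ (ι₀ x)).comp (mfd m m G (ι₀ x)) := by
    have h1 := mfd_comp hGx.smooth.self_of_nhds hψG.self_of_nhds
    rwa [hGx.fixed] at h1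
  refine ⟨?_, ?_, fun v hv => ?_, ?_, ?_⟩
  · filter_upwards [hGx.smooth, hψG] with q h1 h2
    exact h2.comp q h1
  · rw [Function.comp_apply, hGx.fixed, (h x).map_eq]
  · rw [hmfd] at hv
    exact hGx.injective v ((h x).admissible.injective φ (hΦ.factor_ne_zero x)
      ((hi₁.comp φ).injective x) _ hv)
  · have hfc : ContinuousAt f (ι₀ x) := (h x).factor_smooth.self_of_nhds.continuousAt
    have hf0 : ∀ᶠ q in 𝓝 (ι₀ x), f q ≠ 0 :=
      hfc.eventually_ne (by rw [(h x).factor_eq]; exact hΦ.factor_ne_zero x)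
    have hfpos : ∀ᶠ q in 𝓝 (ι₀ x), (∀ x, 0 < c x) → 0 < f q := by
      by_cases hc : ∀ x, 0 < c x
      · filter_upwards [hfc.eventually (lt_mem_nhds (by rw [(h x).factor_eq]; exact hc x))]
          with q hq _ using hq
      · exact Eventually.of_forall fun q hq => absurd hq hc
    filter_upwards [hf0, hfpos, hGx.conformal, hGx.smooth, hψG] with q h1 h2 ⟨r, hr, h3⟩ h4 h5
    refine ⟨r * f q, mul_ne_zero hr.ne' h1, fun hc => mul_pos hr (h2 hc), fun v => ?_⟩
    have h6 := h3 v
    rw [discrepancy, OneForm.sub_val, add_sub_cancel, pullback_val, OneForm.smul_val,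
      smul_apply, smul_eq_mul, ← mul_assoc] at h6
    rw [mfd_comp h4 h5]
    exact h6
  · refine (h x).admissible.induces.congr hi₁ hα₁.formSmoothAt ?_
    suffices h1 : ∀ v : EuclideanSpace ℝ (Fin m), v ∈ symplOrth k α₀ ι₀ x →
        ∃ u, mfd m m (ψ ∘ G) (ι₀ x) v = mfd m m ψ (ι₀ x) v + mfd k m ι₁ (φ x) u from h1
    intro v hv
    obtain ⟨u, hu⟩ := (h x).exists_mfd_eq_add hα₀ hα₁ hi₀ (fun y => (h y).discrepancy_val)
      (fun _ => Iff.rfl) hH hGx (orthAt_eq_zero_iff.2 hv)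
    refine ⟨mfd k k φ x u, ?_⟩
    rw [hmfd, ContinuousLinearMap.comp_apply, hu, map_add, (h x).admissible.adjusted.comp_eq,
      mfd_comp (φ.contMDiff x) (hi₁.smooth (φ x))]
    rfl

/-- The neighbourhood theorem for isotropic submanifolds of contact manifolds. -/
theorem exists_contactomorphism (hα₀ : IsContactForm α₀) (hα₁ : IsContactForm α₁)
    (hι₀ : IsIsotropicEmbedding k α₀ ι₀) (hι₁ : IsIsotropicEmbedding k α₁ ι₁)
    (φ : L₀ ≃ₘ⟮𝓡 k, 𝓡 k⟯ L₁) {Φ : ∀ x, CSN k α₀ ι₀ x ≃ₗ[ℝ] CSN k α₁ ι₁ (φ x)}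
    (hΦ : IsConformalCSNIso α₀ α₁ ι₀ ι₁ φ c Φ) :
    ∃ ψ : PartialDiffeomorph (𝓡 m) (𝓡 m) M₀ M₁ ∞, IsNbhdExtension ι₀ ι₁ φ ψ ∧
      IsContactomorphism α₀ α₁ ψ ∧ ((∀ x, 0 < c x) → PreservesCoorientation α₀ α₁ ψ) ∧
      ∀ x, InducesOnCSN α₀ α₁ ι₀ ι₁ x (φ x) (mfderiv (𝓡 m) (𝓡 m) ψ (ι₀ x))
        (Φ x).toLinearMap := by
  obtain ⟨g, hg⟩ := exists_conformal_map hα₀ hα₁ hι₀ hι₁ φ hΦ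
  have hinj : InjOn g (range ι₀) := by
    rintro _ ⟨x, rfl⟩ _ ⟨y, rfl⟩ hxy
    rw [(hg x).2.1, (hg y).2.1] at hxy
    rw [φ.injective (hι₁.embedding.isEmbedding.injective hxy)]
  obtain ⟨ψ, hsource, hψ, hψg⟩ := exists_partialDiffeomorph (f := g)
    (isCompact_range hι₀.isIsotropicImmersion.smooth.continuous)
    (by rintro _ ⟨x, rfl⟩; exact (hg x).1) (by rintro _ ⟨x, rfl⟩; exact (hg x).2.2.1) hinj
    (P := fun q => (∀ v, mfd m m g q v = 0 → v = 0) ∧ ∃ r : ℝ, r ≠ 0 ∧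
      ((∀ x, 0 < c x) → 0 < r) ∧ ∀ v, α₁.val (g q) (mfd m m g q v) = r * α₀.val q v) (by
      rintro _ ⟨x, rfl⟩
      exact (eventually_mfd_injective (hg x).1 (hg x).2.2.1).and (hg x).2.2.2.1)
  have hval : ∀ q ∈ ψ.source, (∀ v, mfd m m ψ q v = 0 → v = 0) ∧ ∃ r : ℝ, r ≠ 0 ∧
      ((∀ x, 0 < c x) → 0 < r) ∧ ∀ v, α₁.val (ψ q) (mfd m m ψ q v) = r * α₀.val q v := by
    have h1 : (ψ : M₀ → M₁) = g := hψg
    rw [h1]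
    exact hψ
  have heq : ∀ x, ψ (ι₀ x) = ι₁ (φ x) := fun x => (congrFun hψg _).trans (hg x).2.1
  refine ⟨ψ, ⟨hsource, ?_, heq⟩, fun q hq => ?_, fun hc q hq v hv => ?_, fun x => ?_⟩
  · rintro _ ⟨y, rfl⟩
    have h1 := ψ.map_source (hsource ⟨φ.symm y, rfl⟩)
    have h2 : ψ (ι₀ (φ.symm y)) = ι₁ y := by rw [heq, φ.apply_symm_apply]
    exact h2 ▸ h1
  · obtain ⟨h1, r, hr, -, h2⟩ := hval q hq
    -- The derivative is injective between spaces of equal dimension, hence onto; as the conformal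
    -- factor is nonzero, the preimage of a vector of ξ₁ lies in ξ₀.
    refine le_antisymm ?_ fun w hw => ?_
    · rintro _ ⟨v, hv, rfl⟩
      have h3 : α₀.val q v = 0 := hv
      have h4 := h2 v
      rw [h3, mul_zero] at h4
      exact h4
    · obtain ⟨v, rfl⟩ := LinearMap.injective_iff_surjective.1
        ((injective_iff_map_eq_zero (mfd m m ψ q).toLinearMap).2 h1) w
      have h3 : α₁.val (ψ q) (mfd m m ψ q v) = 0 := hw
      rw [h2] at h3
      exact ⟨v, (mul_eq_zero.1 h3).resolve_left hr, rfl⟩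
  · obtain ⟨-, r, -, hr, h2⟩ := hval q hq
    have h3 : 0 < r * α₀.val q v := mul_pos (hr hc) hv
    exact h3.trans_eq (h2 v).symm
  · have h1 : (ψ : M₀ → M₁) = g := hψg
    rw [h1]
    exact (hg x).2.2.2.2

/-- The constant homotopy. -/
theorem IsConformalCSNIso.isSymplecticCSNHomotopy {φ : L₀ → L₁}
    {Φ : ∀ x, CSN k α₀ ι₀ x ≃ₗ[ℝ] CSN k α₁ ι₁ (φ x)}
    (hΦ : IsConformalCSNIso α₀ α₁ ι₀ ι₁ φ c Φ) :
    IsSymplecticCSNHomotopy α₀ α₁ ι₀ ι₁ φ c fun _ => Φ where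
  smooth := by
    rintro ⟨t, x⟩ -
    obtain ⟨U, hU, A, hAs, hA⟩ := hΦ.smooth x (mem_univ x)
    refine ⟨Prod.snd ⁻¹' U, continuous_snd.continuousAt.preimage_mem_nhds hU, fun z => A z.2,
      fun z hz => ?_, fun z hz => hA z.2 ⟨mem_univ _, hz.2⟩⟩
    exact (hAs z.2 ⟨mem_univ _, hz.2⟩).comp z contMDiffWithinAt_snd
      fun y hy => ⟨mem_univ _, hy.2⟩
  symplectic _ _ := hΦ.conformal

end Extension

/-! ### Legendrian submanifolds -/

section Legendrian

variable {n : ℕ}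
  {L₀ : Type*} [TopologicalSpace L₀] [ChartedSpace (EuclideanSpace ℝ (Fin n)) L₀]
  [IsManifold (𝓡 n) ∞ L₀]
  {L₁ : Type*} [TopologicalSpace L₁] [ChartedSpace (EuclideanSpace ℝ (Fin n)) L₁]
  [IsManifold (𝓡 n) ∞ L₁]
  {M₀ : Type*} [TopologicalSpace M₀] [ChartedSpace (EuclideanSpace ℝ (Fin (2 * n + 1))) M₀]
  [IsManifold (𝓡 (2 * n + 1)) ∞ M₀]
  {M₁ : Type*} [TopologicalSpace M₁] [ChartedSpace (EuclideanSpace ℝ (Fin (2 * n + 1))) M₁]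
  [IsManifold (𝓡 (2 * n + 1)) ∞ M₁]
  {α₀ : OneForm (2 * n + 1) M₀} {α₁ : OneForm (2 * n + 1) M₁} {ι₀ : L₀ → M₀} {ι₁ : L₁ → M₁}

/-- The conformal symplectic normal bundle of a Legendrian submanifold is zero. -/
theorem IsIsotropicImmersion.subsingleton_csn (hι₀ : IsIsotropicImmersion n α₀ ι₀)
    (hα₀ : IsContactForm α₀) (x : L₀) : Subsingleton (CSN n α₀ ι₀ x) := by
  have h1 : LinearMap.range (mfd n (2 * n + 1) ι₀ x).toLinearMap =
      LinearMap.ker (orthAt n α₀ ι₀ x).toLinearMap := by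
    -- Isotropy gives T ⊆ V. Surjectivity of `orthAt` gives dim V = (2n + 1) - (1 + n) = n = dim T.
    refine Submodule.eq_of_le_of_finrank_eq ?_ ?_
    · rintro _ ⟨u, rfl⟩
      exact hι₀.orthAt_mfd hα₀.formSmoothAt x u
    · have h2 := LinearMap.finrank_range_of_inj
        ((injective_iff_map_eq_zero (mfd n (2 * n + 1) ι₀ x).toLinearMap).2 (hι₀.injective x))
      have h3 := LinearMap.finrank_range_add_finrank_ker (orthAt n α₀ ι₀ x).toLinearMap
      have h4 : Module.finrank ℝ (EuclideanSpace ℝ (Fin n) →L[ℝ] ℝ) = n := by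
        rw [← (LinearMap.toContinuousLinearMap (𝕜 := ℝ) (E := EuclideanSpace ℝ (Fin n))
          (F' := ℝ)).finrank_eq]
        exact (Subspace.dual_finrank_eq (K := ℝ) (V := EuclideanSpace ℝ (Fin n))).trans
          finrank_euclideanSpace_fin
      have h5 : FiniteDimensional ℝ (EuclideanSpace ℝ (Fin n) →L[ℝ] ℝ) :=
        (LinearMap.toContinuousLinearMap (𝕜 := ℝ) (E := EuclideanSpace ℝ (Fin n))
          (F' := ℝ)).finiteDimensional
      rw [LinearMap.range_eq_top.2 (hι₀.orthAt_surjective hα₀ x), finrank_top,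
        Module.finrank_prod, h4, Module.finrank_self, finrank_euclideanSpace_fin] at h3
      rw [h2, finrank_euclideanSpace_fin]
      omega
  refine subsingleton_of_forall_eq 0 fun q => ?_
  obtain ⟨⟨v, hv⟩, rfl⟩ := Submodule.Quotient.mk_surjective _ q
  have h2 : (v : EuclideanSpace ℝ (Fin (2 * n + 1))) ∈
      LinearMap.ker (orthAt n α₀ ι₀ x).toLinearMap := orthAt_eq_zero_iff.2 hv
  rw [← h1] at h2
  obtain ⟨u, hu⟩ := h2
  exact CSN.mk_eq_zero_iff.2 ⟨u, hu⟩

theorem inTangentCoordinates_zero {l m : ℕ} {N : Type*} {M M' : Type*} [TopologicalSpace M]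
    [ChartedSpace (EuclideanSpace ℝ (Fin l)) M] [IsManifold (𝓡 l) ∞ M] [TopologicalSpace M']
    [ChartedSpace (EuclideanSpace ℝ (Fin m)) M'] [IsManifold (𝓡 m) ∞ M'] (f : N → M) (g : N → M')
    (x y : N) : inTangentCoordinates (𝓡 l) (𝓡 m) f g
      (fun _ => (0 : EuclideanSpace ℝ (Fin l) →L[ℝ] EuclideanSpace ℝ (Fin m))) x y = 0 := by
  refine ContinuousLinearMap.ext fun v => ?_
  exact map_zero ((trivializationAt (EuclideanSpace ℝ (Fin m)) (TangentSpace (𝓡 m))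
    (g x)).continuousLinearMapAt ℝ (g y))

/-- The zero family of maps of tangent spaces is smooth and induces the only possible map. -/
theorem isSmoothCSNFamily_of_subsingleton {φ : L₀ → L₁}
    [∀ x, Subsingleton (CSN n α₀ ι₀ x)] (Φ : ∀ x, CSN n α₀ ι₀ x →ₗ[ℝ] CSN n α₁ ι₁ (φ x)) :
    IsSmoothCSNFamily (𝓡 n) α₀ α₁ ι₀ ι₁ id φ univ Φ := by
  refine fun x _ => ⟨univ, univ_mem, fun _ => 0, fun z _ => ?_, fun z _ v => ⟨?_, ?_⟩⟩
  · refine (contMDiffWithinAt_const (c := 0)).congr_of_eventuallyEq (f := fun _ => 0)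
      (Eventually.of_forall fun y => ?_) ?_
    · exact inTangentCoordinates_zero _ _ _ _
    · exact inTangentCoordinates_zero _ _ _ _
  · exact Submodule.zero_mem _
  · rw [Subsingleton.elim (CSN.mk v) 0, map_zero]
    exact (CSN.mk_eq_zero_iff.2 ⟨0, map_zero _⟩).symm

/-- Legendrian submanifolds have conformally isomorphic normal bundles. -/
theorem exists_isConformalCSNIso (hα₀ : IsContactForm α₀) (hα₁ : IsContactForm α₁)
    (hι₀ : IsIsotropicImmersion n α₀ ι₀) (hι₁ : IsIsotropicImmersion n α₁ ι₁) (φ : L₀ → L₁) :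
    ∃ Φ : ∀ x, CSN n α₀ ι₀ x ≃ₗ[ℝ] CSN n α₁ ι₁ (φ x),
      IsConformalCSNIso α₀ α₁ ι₀ ι₁ φ (fun _ => 1) Φ := by
  have h0 := hι₀.subsingleton_csn hα₀
  have h1 := hι₁.subsingleton_csn hα₁
  refine ⟨fun x => LinearEquiv.ofSubsingleton _ _, isSmoothCSNFamily_of_subsingleton _,
    contMDiff_const, fun _ => one_ne_zero, fun x u v => ?_⟩
  rw [Subsingleton.elim u 0, map_zero, map_zero, map_zero, LinearMap.zero_apply,
    LinearMap.zero_apply, mul_zero]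

end Legendrian

end ContactGeometry

end

/-! ### The theorem -/

theorem mainTheorem6 (n k : ℕ)
    {M₀ : Type*} [TopologicalSpace M₀] [T2Space M₀] [SecondCountableTopology M₀] [Nonempty M₀]
    [ChartedSpace (EuclideanSpace ℝ (Fin (2 * n + 1))) M₀] [IsManifold (𝓡 (2 * n + 1)) ∞ M₀]
    {M₁ : Type*} [TopologicalSpace M₁] [T2Space M₁] [SecondCountableTopology M₁] [Nonempty M₁]
    [ChartedSpace (EuclideanSpace ℝ (Fin (2 * n + 1))) M₁] [IsManifold (𝓡 (2 * n + 1)) ∞ M₁]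
    {L₀ : Type*} [TopologicalSpace L₀] [CompactSpace L₀]
    [ChartedSpace (EuclideanSpace ℝ (Fin k)) L₀] [IsManifold (𝓡 k) ∞ L₀]
    {L₁ : Type*} [TopologicalSpace L₁] [CompactSpace L₁]
    [ChartedSpace (EuclideanSpace ℝ (Fin k)) L₁] [IsManifold (𝓡 k) ∞ L₁]
    (α₀ : ContactGeometry.OneForm (2 * n + 1) M₀) (hα₀ : ContactGeometry.IsContactForm α₀)
    (α₁ : ContactGeometry.OneForm (2 * n + 1) M₁) (hα₁ : ContactGeometry.IsContactForm α₁)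
    (ι₀ : L₀ → M₀) (hι₀ : ContactGeometry.IsIsotropicEmbedding k α₀ ι₀)
    (ι₁ : L₁ → M₁) (hι₁ : ContactGeometry.IsIsotropicEmbedding k α₁ ι₁)
    (φ : L₀ ≃ₘ⟮𝓡 k, 𝓡 k⟯ L₁) :
    (∀ (c : L₀ → ℝ)
        (Φ : ∀ x, ContactGeometry.CSN k α₀ ι₀ x ≃ₗ[ℝ] ContactGeometry.CSN k α₁ ι₁ (φ x)),
      ContactGeometry.IsConformalCSNIso α₀ α₁ ι₀ ι₁ φ c Φ →
      ∃ ψ : PartialDiffeomorph (𝓡 (2 * n + 1)) (𝓡 (2 * n + 1)) M₀ M₁ ∞,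
        ContactGeometry.IsNbhdExtension ι₀ ι₁ φ ψ ∧
        ContactGeometry.IsContactomorphism α₀ α₁ ψ ∧
        ((∀ x, 0 < c x) → ContactGeometry.PreservesCoorientation α₀ α₁ ψ) ∧
        ∃ Θ : ℝ → ∀ x, ContactGeometry.CSN k α₀ ι₀ x ≃ₗ[ℝ] ContactGeometry.CSN k α₁ ι₁ (φ x),
          ContactGeometry.IsSymplecticCSNHomotopy α₀ α₁ ι₀ ι₁ φ c Θ ∧
          Θ 0 = Φ ∧
          ∀ x, ContactGeometry.InducesOnCSN α₀ α₁ ι₀ ι₁ x (φ x)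
            (mfderiv (𝓡 (2 * n + 1)) (𝓡 (2 * n + 1)) ψ (ι₀ x)) (Θ 1 x).toLinearMap) ∧
    (k = n →
      ∃ ψ : PartialDiffeomorph (𝓡 (2 * n + 1)) (𝓡 (2 * n + 1)) M₀ M₁ ∞,
        ContactGeometry.IsNbhdExtension ι₀ ι₁ φ ψ ∧
        ContactGeometry.IsContactomorphism α₀ α₁ ψ) := by
  refine ⟨fun c Φ hΦ => ?_, fun hk => ?_⟩
  · obtain ⟨ψ, h1, h2, h3, h4⟩ :=
      ContactGeometry.exists_contactomorphism hα₀ hα₁ hι₀ hι₁ φ hΦ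
    -- The contactomorphism induces `Φ` itself, so the constant homotopy suffices.
    exact ⟨ψ, h1, h2, h3, fun _ => Φ, hΦ.isSymplecticCSNHomotopy, rfl, h4⟩
  · subst hk
    obtain ⟨Φ, hΦ⟩ := ContactGeometry.exists_isConformalCSNIso hα₀ hα₁
      hι₀.isIsotropicImmersion hι₁.isIsotropicImmersion φ
    obtain ⟨ψ, h1, h2, -, -⟩ :=
      ContactGeometry.exists_contactomorphism hα₀ hα₁ hι₀ hι₁ φ hΦ
    exact ⟨ψ, h1, h2⟩
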